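/- **Proposition 2.2.** Let $\Omega$ be a bounded domain (connected open set) in $\mathbb R^N$, $N\ge 1$, with boundary of class $C^2$, $\omega$ a nonempty open subset of $\Omega$, $T>0$, and $Q_T=\Omega\times(0,T)$. Let $p,m,n\ge 1$ be integers with $p,m\le n$, and let $A\in L^\infty(Q_T;\mathcal L(\mathbb R^n))$, $B\in L^\infty(Q_T;\mathcal L(\mathbb R^m,\mathbb R^n))$, with (pointwise) transposes $A^*$, $B^*$. Let $H^{-1}(\Omega)=H^1_0(\Omega)'$ and $$W(0,T)=\{y\in L^2(0,T;H^1_0(\Omega)):\ \partial_t y\in L^2(0,T;H^{-1}(\Omega))\};$$ the values at times $t\in[0,T]$ of an element of $W(0,T)$ are those of its representative in $C^0([0,T];L^2(\Omega))$. Let $\Pi_p(y_1,\dots,y_n)=(y_1,\dots,y_p)$ and $\Pi_p^*(\varphi_1,\dots,\varphi_p)=(\varphi_1,\dots,\varphi_p,0,\dots,0)\in\mathbb R^n$. For every $y_0\in L^2(\Omega)^n$ and $u\in L^2(Q_T)^m$ the system $$\partial_t y=\Delta y+Ay+B\mathbf 1_\omega u\ \text{ in }Q_T,\qquad y=0\ \text{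 on }\partial\Omega\times(0,T),\qquad y(0)=y_0\ \text{ in }\Omega\tag{1}$$ has a unique solution $y=y(\cdot\,;y_0,u)\in W(0,T)^n$ (the equation holding in $H^{-1}(\Omega)^n$ for almost every $t$), and for every $\varphi_T\in L^2(\Omega)^n$ the system $$-\partial_t\varphi=\Delta\varphi+A^*\varphi\ \text{ in }Q_T,\qquad \varphi=0\ \text{ on }\partial\Omega\times(0,T),\qquad \varphi(T)=\varphi_T\ \text{ in }\Omega\tag{2}$$ has, in the same sense, a unique solution $\varphi\in W(0,T)^n$. Moreover: 1. System (1) is $\Pi_p$-null controllable on $(0,T)$, that is, for every $y_0\in L^2(\Omega)^n$ there is $u\in L^2(Q_T)^m$ with $\Pi_p\,y(T;y_0,u)=0$ in $\Omega$, if and only if there is a constant $C_{obs}>0$ such that for every $\varphi_0\in L^2(\Omega)^p$ the solution $\varphi$ of (2) with $\varphi_T=\Pi_p^*\varphi_0$ satisfies $$\|\varphi(0)\|_{L^2(\Omega)^n}^2\le C_{obs}\int_0^T\|B^*\varphi(t)\|_{L^2(\omega)^m}^2\,dt .$$ 2. System (1) is $\Pi_p$-approximately controllable on $(0,T)$, that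 is, for every $\varepsilon>0$ and all $y_0,y_T\in L^2(\Omega)^n$ there is $u\in L^2(Q_T)^m$ with $\|\Pi_p\,y(T;y_0,u)-\Pi_p\,y_T\|_{L^2(\Omega)^p}\le\varepsilon$, if and only if for every $\varphi_0\in L^2(\Omega)^p$ the solution $\varphi$ of (2) with $\varphi_T=\Pi_p^*\varphi_0$ satisfies $$B^*\varphi=0\ \text{ in }\omega\times(0,T)\quad\Longrightarrow\quad \varphi=0\ \text{ in }Q_T .$$ -/

import Mathlib

open MeasureTheory Set
open scoped Matrix

noncomputable section

namespace ParabolicControl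

/-! ### The domain -/

/-- `Ω` has a boundary of class `C²`: near each boundary point, `Ω` is the sublevel set `{g < 0}`
of a `C²` function `g` whose differential does not vanish at that point. -/
def HasC2Boundary {N : ℕ} (Ω : Set (EuclideanSpace ℝ (Fin N))) : Prop :=
  ∀ x₀ ∈ frontier Ω, ∃ (U : Set (EuclideanSpace ℝ (Fin N))) (g : EuclideanSpace ℝ (Fin N) → ℝ),
    IsOpen U ∧ x₀ ∈ U ∧ ContDiffOn ℝ 2 g U ∧ fderiv ℝ g x₀ ≠ 0 ∧ Ω ∩ U = {x ∈ U | g x < 0}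

/-! ### Function spaces -/

/-- The Hilbert space `L²(Ω)`. -/
abbrev L2 {N : ℕ} (Ω : Set (EuclideanSpace ℝ (Fin N))) : Type :=
  Lp ℝ 2 (volume.restrict Ω)

/-- The Hilbert space `L²(Ω; ℝᴺ)` of square integrable vector fields. -/
abbrev L2Field {N : ℕ} (Ω : Set (EuclideanSpace ℝ (Fin N))) : Type :=
  Lp (EuclideanSpace ℝ (Fin N)) 2 (volume.restrict Ω)

/-- The Hilbert space `L²(Ω)ᵏ`. -/
abbrev L2Vec {N : ℕ} (Ω : Set (EuclideanSpace ℝ (Fin N))) (k : ℕ) : Type :=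
  PiLp 2 (fun _ : Fin k => L2 Ω)

/-- The space-time cylinder, points being written `(t, x)`. -/
abbrev cylinder {N : ℕ} (T : ℝ) (Ω : Set (EuclideanSpace ℝ (Fin N))) :
    Set (ℝ × EuclideanSpace ℝ (Fin N)) :=
  Ioo 0 T ×ˢ Ω

/-- The Hilbert space `L²(Q_T)ᵏ`. -/
abbrev L2Cyl {N : ℕ} (T : ℝ) (Ω : Set (EuclideanSpace ℝ (Fin N))) (k : ℕ) : Type :=
  PiLp 2 (fun _ : Fin k => Lp ℝ 2 (volume.restrict (cylinder T Ω)))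

/-- A function `M` on the cylinder with values in the matrices belongs to `L^∞(Q_T)`. -/
def IsLInfty {N k l : ℕ} (T : ℝ) (Ω : Set (EuclideanSpace ℝ (Fin N)))
    (M : ℝ × EuclideanSpace ℝ (Fin N) → Matrix (Fin k) (Fin l) ℝ) : Prop :=
  ∀ i j, MemLp (fun z => M z i j) ⊤ (volume.restrict (cylinder T Ω))

/-- `C_c^∞(Ω)`. -/
def IsTest {N : ℕ} (Ω : Set (EuclideanSpace ℝ (Fin N)))
    (ψ : EuclideanSpace ℝ (Fin N) → ℝ) : Prop :=
  ContDiff ℝ (⊤ : ℕ∞) ψ ∧ HasCompactSupport ψ ∧ tsupport ψ ⊆ Ω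

/-- The pairs `(ψ, ∇ψ)`, `ψ ∈ C_c^∞(Ω)`, in `L²(Ω) × L²(Ω; ℝᴺ)`, with the Hilbert norm
`(‖·‖² + ‖·‖²)^{1/2}`, which on these pairs is the `H¹` norm. -/
def testGraph {N : ℕ} (Ω : Set (EuclideanSpace ℝ (Fin N))) :
    Submodule ℝ (WithLp 2 (L2 Ω × L2Field Ω)) where
  carrier := {z | ∃ ψ, IsTest Ω ψ ∧ z.fst =ᵐ[volume.restrict Ω] ψ ∧
    z.snd =ᵐ[volume.restrict Ω] gradient ψ}
  add_mem' := by
    rintro a b ⟨ψ, ⟨h1, h2, h3⟩, h4, h5⟩ ⟨χ, ⟨k1, k2, k3⟩, k4, k5⟩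
    refine ⟨ψ + χ, ⟨h1.add k1, h2.add k2, (tsupport_add ψ χ).trans (union_subset h3 k3)⟩, ?_, ?_⟩
    · exact (Lp.coeFn_add a.fst b.fst).trans (h4.add k4)
    · refine (Lp.coeFn_add a.snd b.snd).trans ((h5.add k5).trans (ae_of_all _ fun x => ?_))
      have hψ : DifferentiableAt ℝ ψ x := h1.differentiable (by simp) x
      have hχ : DifferentiableAt ℝ χ x := k1.differentiable (by simp) x
      simp [gradient, fderiv_add hψ hχ]
  zero_mem' := by
    refine ⟨0, ⟨contDiff_const, HasCompactSupport.zero, by simp [tsupport]⟩, ?_, ?_⟩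
    · exact Lp.coeFn_zero _ _ _
    · refine (Lp.coeFn_zero _ _ _).trans (ae_of_all _ fun x => ?_)
      simp [gradient]
  smul_mem' := by
    rintro c a ⟨ψ, ⟨h1, h2, h3⟩, h4, h5⟩
    refine ⟨c • ψ, ⟨h1.const_smul c, h2.smul_left (f := fun _ => c), ?_⟩, ?_, ?_⟩
    · exact (closure_mono (Function.support_const_smul_subset c ψ)).trans h3
    · exact (Lp.coeFn_smul c a.fst).trans (h4.const_smul c)
    · refine (Lp.coeFn_smul c a.snd).trans ((h5.const_smul c).trans (ae_of_all _ fun x => ?_))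
      have hψ : DifferentiableAt ℝ ψ x := h1.differentiable (by simp) x
      simp [gradient, fderiv_const_smul hψ c]

/-- `H¹₀(Ω)`, the closure of `C_c^∞(Ω)` for the `H¹` norm, with the `H¹` inner product. An element
is recorded as the pair `(v, ∇v)` of a function and its (weak) gradient. -/
abbrev H10 {N : ℕ} (Ω : Set (EuclideanSpace ℝ (Fin N))) : Type :=
  (testGraph Ω).topologicalClosure

/-- The inclusion `H¹₀(Ω) → L²(Ω)`. -/
def toL2 {N : ℕ} {Ω : Set (EuclideanSpace ℝ (Fin N))} : H10 Ω →L[ℝ] L2 Ω :=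
  (WithLp.fstL 2 ℝ (L2 Ω) (L2Field Ω)).comp (testGraph Ω).topologicalClosure.subtypeL

/-- The weak gradient `H¹₀(Ω) → L²(Ω; ℝᴺ)`. -/
def grad {N : ℕ} {Ω : Set (EuclideanSpace ℝ (Fin N))} : H10 Ω →L[ℝ] L2Field Ω :=
  (WithLp.sndL 2 ℝ (L2 Ω) (L2Field Ω)).comp (testGraph Ω).topologicalClosure.subtypeL

/-- `H⁻¹(Ω)`, the topological dual of `H¹₀(Ω)`. -/
abbrev Hm1 {N : ℕ} (Ω : Set (EuclideanSpace ℝ (Fin N))) : Type :=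
  StrongDual ℝ (H10 Ω)

/-- The inclusion `L²(Ω) → H⁻¹(Ω)`, `f ↦ (v ↦ ∫_Ω f v)`. -/
def toHm1 {N : ℕ} {Ω : Set (EuclideanSpace ℝ (Fin N))} (f : L2 Ω) : Hm1 Ω :=
  (innerSL ℝ f).comp toL2

/-- `g` is the derivative of `f` on `(0,T)` in the sense of distributions with values in `X`. -/
def HasWeakTimeDeriv {X : Type*} [NormedAddCommGroup X] [NormedSpace ℝ X]
    (T : ℝ) (f g : ℝ → X) : Prop :=
  ∀ θ : ℝ → ℝ, ContDiff ℝ (⊤ : ℕ∞) θ → HasCompactSupport θ → tsupport θ ⊆ Ioo 0 T →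
    ∫ t in Ioo 0 T, deriv θ t • f t = - ∫ t in Ioo 0 T, θ t • g t

/-- `w` belongs to `W(0,T) = {w ∈ L²(0,T; H¹₀(Ω)), ∂ₜw ∈ L²(0,T; H⁻¹(Ω))}`, and `∂ₜw = dw`. -/
structure MemW {N : ℕ} (T : ℝ) (Ω : Set (EuclideanSpace ℝ (Fin N)))
    (w : ℝ → H10 Ω) (dw : ℝ → Hm1 Ω) : Prop where
  memLp : MemLp w 2 (volume.restrict (Ioo 0 T))
  memLp_deriv : MemLp dw 2 (volume.restrict (Ioo 0 T))
  weak_deriv : HasWeakTimeDeriv T (fun t => toHm1 (toL2 (w t))) dw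

/-- `w ∈ W(0,T)ᵏ`, `∂ₜw = dw`, and `y` is the representative of `w` in `C⁰([0,T]; L²(Ω)ᵏ)`; it is
the one through which the values at the times `0` and `T` are taken. -/
structure MemWVec {N k : ℕ} (T : ℝ) (Ω : Set (EuclideanSpace ℝ (Fin N)))
    (w : Fin k → ℝ → H10 Ω) (dw : Fin k → ℝ → Hm1 Ω) (y : ℝ → L2Vec Ω k) : Prop where
  memW : ∀ i, MemW T Ω (w i) (dw i)
  continuousOn : ContinuousOn y (Icc 0 T)
  ae_eq : ∀ᵐ t ∂volume.restrict (Ioo 0 T), ∀ i, y t i = toL2 (w i t)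

/-! ### The system and its adjoint -/

/-- `y` is the solution in `W(0,T)ⁿ` of `∂ₜy = Δy + A y + B 1_ω u` in `Q_T`, `y = 0` on the lateral
boundary, `y(0) = y₀`. The equation holds in `H⁻¹(Ω)ⁿ` for almost every time. -/
def IsSolution {N n m : ℕ} (T : ℝ) (Ω ω : Set (EuclideanSpace ℝ (Fin N)))
    (A : ℝ × EuclideanSpace ℝ (Fin N) → Matrix (Fin n) (Fin n) ℝ)
    (B : ℝ × EuclideanSpace ℝ (Fin N) → Matrix (Fin n) (Fin m) ℝ)
    (y₀ : L2Vec Ω n) (u : L2Cyl T Ω m) (y : ℝ → L2Vec Ω n) : Prop :=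
  y 0 = y₀ ∧ ∃ (w : Fin n → ℝ → H10 Ω) (dw : Fin n → ℝ → Hm1 Ω), MemWVec T Ω w dw y ∧
    ∀ᵐ t ∂volume.restrict (Ioo 0 T), ∀ (i : Fin n) (v : H10 Ω),
      dw i t v = - inner ℝ (grad (w i t)) (grad v)
        + (∫ x in Ω, (A (t, x) *ᵥ fun j => toL2 (w j t) x) i * toL2 v x)
        + (∫ x in ω, (B (t, x) *ᵥ fun k => u k (t, x)) i * toL2 v x)

/-- `φ` is the solution in `W(0,T)ⁿ` of `-∂ₜφ = Δφ + A* φ` in `Q_T`, `φ = 0` on the lateral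
boundary, `φ(T) = φT`. -/
def IsAdjointSolution {N n : ℕ} (T : ℝ) (Ω : Set (EuclideanSpace ℝ (Fin N)))
    (A : ℝ × EuclideanSpace ℝ (Fin N) → Matrix (Fin n) (Fin n) ℝ)
    (φT : L2Vec Ω n) (φ : ℝ → L2Vec Ω n) : Prop :=
  φ T = φT ∧ ∃ (w : Fin n → ℝ → H10 Ω) (dw : Fin n → ℝ → Hm1 Ω), MemWVec T Ω w dw φ ∧
    ∀ᵐ t ∂volume.restrict (Ioo 0 T), ∀ (i : Fin n) (v : H10 Ω),
      - dw i t v = - inner ℝ (grad (w i t)) (grad v)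
        + (∫ x in Ω, ((A (t, x))ᵀ *ᵥ fun j => toL2 (w j t) x) i * toL2 v x)

/-- `Π_p (y₁, …, yₙ) = (y₁, …, y_p)`. -/
def proj {N n p : ℕ} {Ω : Set (EuclideanSpace ℝ (Fin N))} (hp : p ≤ n) (y : L2Vec Ω n) :
    L2Vec Ω p :=
  WithLp.toLp 2 fun i => y (Fin.castLE hp i)

/-- `Π_p^* (φ₁, …, φ_p) = (φ₁, …, φ_p, 0, …, 0)`. -/
def projAdj {N p : ℕ} {Ω : Set (EuclideanSpace ℝ (Fin N))} (n : ℕ) (φ : L2Vec Ω p) :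
    L2Vec Ω n :=
  WithLp.toLp 2 fun i => if h : (i : ℕ) < p then φ ⟨i, h⟩ else 0

/-- `Π_p`-null controllability on the time interval `(0,T)`. -/
def NullControllable {N n m p : ℕ} (T : ℝ) (Ω ω : Set (EuclideanSpace ℝ (Fin N)))
    (A : ℝ × EuclideanSpace ℝ (Fin N) → Matrix (Fin n) (Fin n) ℝ)
    (B : ℝ × EuclideanSpace ℝ (Fin N) → Matrix (Fin n) (Fin m) ℝ) (hp : p ≤ n) : Prop :=
  ∀ y₀ : L2Vec Ω n, ∃ (u : L2Cyl T Ω m) (y : ℝ → L2Vec Ω n),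
    IsSolution T Ω ω A B y₀ u y ∧ proj hp (y T) = 0

/-- `Π_p`-approximate controllability on the time interval `(0,T)`. -/
def ApproxControllable {N n m p : ℕ} (T : ℝ) (Ω ω : Set (EuclideanSpace ℝ (Fin N)))
    (A : ℝ × EuclideanSpace ℝ (Fin N) → Matrix (Fin n) (Fin n) ℝ)
    (B : ℝ × EuclideanSpace ℝ (Fin N) → Matrix (Fin n) (Fin m) ℝ) (hp : p ≤ n) : Prop :=
  ∀ ε : ℝ, 0 < ε → ∀ y₀ yT : L2Vec Ω n, ∃ (u : L2Cyl T Ω m) (y : ℝ → L2Vec Ω n),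
    IsSolution T Ω ω A B y₀ u y ∧ ‖proj hp (y T) - proj hp yT‖ ≤ ε

/-- The function `B* φ` of time and space, with values in `ℝᵐ`. -/
def ctrlAdj {N n m : ℕ} {Ω : Set (EuclideanSpace ℝ (Fin N))}
    (B : ℝ × EuclideanSpace ℝ (Fin N) → Matrix (Fin n) (Fin m) ℝ)
    (φ : ℝ → L2Vec Ω n) (t : ℝ) (x : EuclideanSpace ℝ (Fin N)) : Fin m → ℝ :=
  (B (t, x))ᵀ *ᵥ fun i => φ t i x

end ParabolicControl

end

open ParabolicControl

/-! ### Measurability in separable Hilbert spaces -/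

/-! Both equivalences are dualities between the controlled system and its adjoint. If `y` solves (1)
and `φ` solves (2) with `φ(T) = Π_p^* φ₀`, testing each equation with the other solution and
integrating over `(0,T)` makes the diffusion and zero order terms cancel, and leaves ⟨Π_p y(T), φ₀⟩
- ⟨y₀, φ(0)⟩ = ∫₀ᵀ ⟨u, 1_ω B*φ⟩ dt. Put R(y₀, u) = Π_p y(T), S φ₀ = φ(0), K φ₀ = 1_ω B*φ. The
identity ⟨R(y,U), φ⟩ - ⟨y, S φ⟩ = ⟨U, K φ⟩ already forces S and K to be linear, and the rest is
Hilbert space theory. If every y can be steered to 0, the functionals ⟨S φ, ·⟩ with ‖K φ‖ ≤ 1 are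
pointwise bounded, hence uniformly bounded, which is observability. Conversely, observability says
that φ ↦ -⟨y, S φ⟩ is dominated by ‖K φ‖; it therefore factors through K, and Hahn–Banach with Riesz
produces the control (`forall_exists_eq_zero_iff_observability`). Approximate controllability means
that R(0, ·) has dense range, and the orthogonal complement of that range is ker K
(`forall_exists_norm_sub_le_iff_injective`). Finally φ vanishes in Q_T exactly when φ₀ = 0, by
continuity up to T and uniqueness.

Most of the work is the well-posedness and the pairing formula. They are proved for maps J : V → H
and G : V → G' with ‖v‖² = ‖J v‖² + ‖G v‖² (the inclusion of H¹₀ in L² and the gradient) and a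
bounded, weakly measurable family of operators P(t) on H. The product rule for ⟨w, z⟩
(`IsW.hasWeakTimeDeriv_inner`) comes from difference quotients and the continuity of translations in
L²; it yields the continuous representative, uniqueness through Gronwall's lemma, and the duality
formula. Existence (`exists_isW_solution`) follows Lions' projection method: an exponentially
weighted a priori estimate for the formal adjoint, then Riesz representation. The adjoint system is
solved by reversing time. Slicing functions of `(t, x)` into functions of t with values in L²(Ω)
translates the abstract statements back into those on the cylinder. -/

/-- Distinct orthonormal vectors are at distance √2, so the balls of radius 1/2 around them are
disjoint, and a separable space holds only countably many disjoint nonempty open sets. -/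
theorem Orthonormal.countable_of_separable {H ι : Type*} [NormedAddCommGroup H]
    [InnerProductSpace ℝ H] [TopologicalSpace.SeparableSpace H] {b : ι → H}
    (hb : Orthonormal ℝ b) : Countable ι := by
  have hd : Pairwise (Function.onFun Disjoint fun i => Metric.ball (b i) (1 / 2)) := by
    intro i j hij
    apply Metric.ball_disjoint_ball
    have h : ‖b i - b j‖ ^ 2 = 2 := by
      rw [norm_sub_sq_real, hb.1 i, hb.1 j, hb.2 hij]; norm_num
    rw [dist_eq_norm]
    nlinarith [norm_nonneg (b i - b j)]
  exact Pairwise.countable_of_isOpen_disjoint hd (fun _ => Metric.isOpen_ball)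
    fun i => ⟨b i, Metric.mem_ball_self (by norm_num)⟩

/-- Pettis' theorem: the finite partial sums of a Hilbert basis expansion are measurable and
converge pointwise. Countability of the basis makes `atTop` on its finite subsets countably
generated, so measurability passes to the limit. -/
theorem aestronglyMeasurable_of_inner {α H : Type*} [MeasurableSpace α] {μ : Measure α}
    [NormedAddCommGroup H] [InnerProductSpace ℝ H] [CompleteSpace H]
    [TopologicalSpace.SeparableSpace H] {f : α → H}
    (hf : ∀ k, AEStronglyMeasurable (fun t => inner ℝ k (f t)) μ) :
    AEStronglyMeasurable f μ := by
  obtain ⟨w, b, hb⟩ := exists_hilbertBasis ℝ H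
  have : Countable w := b.orthonormal.countable_of_separable
  refine aestronglyMeasurable_of_tendsto_ae (u := Filter.atTop)
    (f := fun (s : Finset w) t => ∑ i ∈ s, inner ℝ (b i) (f t) • b i) (fun s => ?_)
    (Filter.Eventually.of_forall fun t => ?_)
  · exact Finset.aestronglyMeasurable_fun_sum _ fun i _ => (hf (b i)).smul_const (b i)
  · have := b.hasSum_repr (f t)
    simp only [b.repr_apply_apply] at this
    exact this

/-! ### Primitives and weak derivatives -/

section weak
variable {X : Type*} [NormedAddCommGroup X] [NormedSpace ℝ X]

theorem integrable_smul_of_test {θ : ℝ → ℝ} {s : Set ℝ} {f : ℝ → X} (hθ : Continuous θ)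
    (hc : HasCompactSupport θ) (hf : IntegrableOn f s) : IntegrableOn (fun t => θ t • f t) s := by
  obtain ⟨C, hC⟩ := hc.exists_bound_of_continuous hθ
  exact hf.bdd_smul C hθ.aestronglyMeasurable (Filter.Eventually.of_forall hC)

theorem integral_Ioo_deriv_of_tsupport {θ : ℝ → ℝ} {T s : ℝ}
    (hθ : ContDiff ℝ (⊤ : ℕ∞) θ)
    (hs : tsupport θ ⊆ Ioo 0 T) (h0s : s ∈ Ioo 0 T) :
    ∫ t in Ioo 0 T, (Ioi s).indicator (deriv θ) t = - θ s := by
  have hsub : Ioo 0 T ∩ Ioi s = Ioo s T := by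
    ext t; simp only [mem_inter_iff, mem_Ioo, mem_Ioi]
    exact ⟨fun h => ⟨h.2, h.1.2⟩, fun h => ⟨⟨h0s.1.trans h.1, h.2⟩, h.1⟩⟩
  rw [setIntegral_indicator measurableSet_Ioi, hsub, ← integral_Ioc_eq_integral_Ioo,
    ← intervalIntegral.integral_of_le h0s.2.le,
    intervalIntegral.integral_deriv_eq_sub (fun t _ => hθ.differentiable (by simp) t)
      ((hθ.continuous_deriv (by simp)).intervalIntegrable _ _)]
  rw [image_eq_zero_of_notMem_tsupport (fun h => lt_irrefl _ (hs h).2), zero_sub]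

/-- The primitive of an integrable function has that function as weak derivative. -/
theorem hasWeakTimeDeriv_primitive [CompleteSpace X] {T : ℝ} {g : ℝ → X}
    (hg : IntegrableOn g (Ioo 0 T)) :
    HasWeakTimeDeriv T (fun t => ∫ s in (0 : ℝ)..t, g s) g := by
  intro θ hθ hc hs
  have hθ' : Continuous (deriv θ) := hθ.continuous_deriv (by simp)
  obtain ⟨C, hC⟩ := hc.deriv.exists_bound_of_continuous hθ'
  set μ := (volume : Measure ℝ).restrict (Ioo 0 T) with hμ
  -- Kernel of the Fubini argument on the triangle `s < t`; its integral in t at fixed s is `-θ s •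
  -- g s`.
  let F : ℝ → ℝ → X := fun t s => (Ioi s).indicator (deriv θ) t • g s
  have hF : Integrable (Function.uncurry F) (μ.prod μ) := by
    have h2 : Integrable (fun z : ℝ × ℝ => g z.2) (μ.prod μ) := by
      have : IsFiniteMeasure μ := by rw [hμ]; infer_instance
      exact hg.comp_snd μ
    have h3 : Measurable (fun z : ℝ × ℝ => (Ioi z.2).indicator (deriv θ) z.1) := by
      have : (fun z : ℝ × ℝ => (Ioi z.2).indicator (deriv θ) z.1)
          = {z : ℝ × ℝ | z.2 < z.1}.indicator fun z => deriv θ z.1 := by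
        ext z; simp [indicator]
      rw [this]
      exact (hθ'.measurable.comp measurable_fst).indicator
        (measurableSet_lt measurable_snd measurable_fst)
    refine h2.bdd_smul C h3.aestronglyMeasurable (Filter.Eventually.of_forall fun z => ?_)
    exact (norm_indicator_le_norm_self _ _).trans (hC _)
  have h1 : ∀ t ∈ Ioo 0 T, deriv θ t • ∫ s in (0 : ℝ)..t, g s = ∫ s in Ioo 0 T, F t s := by
    intro t ht
    rw [intervalIntegral.integral_of_le ht.1.le, ← integral_smul]
    have hsub : Ioo 0 T ∩ Iio t = Ioo 0 t := by
      ext s; simp only [mem_inter_iff, mem_Ioo, mem_Iio]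
      exact ⟨fun h => ⟨h.1.1, h.2⟩, fun h => ⟨⟨h.1, h.2.trans ht.2⟩, h.2⟩⟩
    rw [integral_Ioc_eq_integral_Ioo, ← hsub, ← setIntegral_indicator measurableSet_Iio]
    refine integral_congr_ae (Filter.Eventually.of_forall fun s => ?_)
    by_cases h : s < t <;> simp [F, indicator, h]
  rw [setIntegral_congr_fun measurableSet_Ioo h1, integral_integral_swap hF, ← integral_neg]
  refine setIntegral_congr_fun measurableSet_Ioo fun s h0s => ?_
  have := integral_Ioo_deriv_of_tsupport hθ hs h0s
  simp only [F]
  rw [integral_smul_const, this, neg_smul]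

/-- A smooth function compactly supported in `(0,T)` with zero mean is the derivative of such a
function. -/
theorem exists_primitive_test {T : ℝ} {ψ : ℝ → ℝ} (hψ : ContDiff ℝ (⊤ : ℕ∞) ψ)
    (hs : tsupport ψ ⊆ Ioo 0 T) (hc : HasCompactSupport ψ) (h0 : ∫ t, ψ t = 0) :
    ∃ θ : ℝ → ℝ, ContDiff ℝ (⊤ : ℕ∞) θ ∧ HasCompactSupport θ ∧ tsupport θ ⊆ Ioo 0 T ∧
      deriv θ = ψ := by
  rcases (tsupport ψ).eq_empty_or_nonempty with he | hne
  · rw [tsupport_eq_empty_iff] at he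
    subst he
    exact ⟨0, contDiff_const, HasCompactSupport.zero, by simp [tsupport], by ext; simp⟩
  obtain ⟨a, haψ, ha⟩ := hc.isCompact.exists_isLeast hne
  obtain ⟨b, hbψ, hb⟩ := hc.isCompact.exists_isGreatest hne
  have hsub : tsupport ψ ⊆ Icc a b := fun x hx => ⟨ha hx, hb hx⟩
  have ha0 := (hs haψ).1
  have hbT := (hs hbψ).2
  have hder : ∀ t, HasDerivAt (fun t => ∫ s in (0 : ℝ)..t, ψ s) (ψ t) t := fun t =>
    intervalIntegral.integral_hasDerivAt_right (hψ.continuous.intervalIntegrable _ _)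
      hψ.continuous.aestronglyMeasurable.stronglyMeasurableAtFilter hψ.continuous.continuousAt
  have hd : deriv (fun t => ∫ s in (0 : ℝ)..t, ψ s) = ψ := funext fun t => (hder t).deriv
  have hzero : ∀ t, t ∉ Icc a b → ψ t = 0 := fun t ht =>
    image_eq_zero_of_notMem_tsupport fun h => ht (hsub h)
  -- To the left of `a` the integrand vanishes; to the right of `b` the primitive equals the full
  -- integral of `ψ`, which is zero.
  have hsupp : Function.support (fun t => ∫ s in (0 : ℝ)..t, ψ s) ⊆ Icc a b := by
    intro t ht
    by_contra hab
    apply ht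
    rcases not_and_or.1 hab with h | h
    · refine (intervalIntegral.integral_congr (g := fun _ => 0) fun s hs' => ?_).trans (by simp)
      have : s < a := lt_of_le_of_lt hs'.2 (max_lt ha0 (not_le.1 h))
      exact hzero s fun h' => absurd h'.1 (not_le.2 this)
    · have h' : b < t := not_le.1 h
      have hab' : a ≤ b := ha hbψ
      simp only
      rw [intervalIntegral.integral_eq_integral_of_support_subset, h0]
      intro s hs'
      have := hsub (subset_tsupport _ hs')
      exact ⟨ha0.trans_le this.1, this.2.trans h'.le⟩
  have hts : tsupport (fun t => ∫ s in (0 : ℝ)..t, ψ s) ⊆ Icc a b :=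
    closure_minimal hsupp isClosed_Icc
  refine ⟨_, ?_, HasCompactSupport.intro (K := Icc a b) isCompact_Icc fun t ht => ?_, hts.trans ?_, hd⟩
  · refine contDiff_infty_iff_deriv.2 ⟨fun t => (hder t).differentiableAt, ?_⟩
    rw [hd]; exact hψ
  · by_contra h; exact ht (hsupp h)
  · exact fun t ht => ⟨ha0.trans_le ht.1, ht.2.trans_lt hbT⟩

theorem exists_test_integral_eq_one {T : ℝ} (hT : 0 < T) :
    ∃ η : ℝ → ℝ, ContDiff ℝ (⊤ : ℕ∞) η ∧ HasCompactSupport η ∧ tsupport η ⊆ Ioo 0 T ∧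
      ∫ t, η t = 1 := by
  let f : ContDiffBump (T / 2) := ⟨T / 8, T / 4, by positivity, by linarith⟩
  refine ⟨f.normed volume, f.contDiff_normed, f.hasCompactSupport_normed, ?_, f.integral_normed⟩
  rw [f.tsupport_normed_eq, Real.closedBall_eq_Icc]
  intro t ht
  constructor <;> [have := ht.1; have := ht.2] <;> simp only [f] at this <;> linarith

/-- A function with zero weak derivative is constant. -/
theorem ParabolicControl.HasWeakTimeDeriv.ae_const [CompleteSpace X] {T : ℝ} (hT : 0 < T) {F : ℝ → X}
    (hF : IntegrableOn F (Ioo 0 T)) (h : HasWeakTimeDeriv T F 0) :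
    ∃ c, ∀ᵐ t ∂volume.restrict (Ioo 0 T), F t = c := by
  obtain ⟨η, hη, hηc, hηs, hη1⟩ := exists_test_integral_eq_one hT
  set c := ∫ t in Ioo 0 T, η t • F t
  refine ⟨c, ?_⟩
  have := isOpen_Ioo.ae_eq_zero_of_integral_contDiff_smul_eq_zero (U := Ioo 0 T) (μ := volume)
    (f := fun t => F t - c)
    (IntegrableOn.locallyIntegrableOn (hF.sub (integrableOn_const (by simp)))) ?_
  · rw [ae_restrict_iff' measurableSet_Ioo]
    filter_upwards [this] with t ht htm using sub_eq_zero.1 (ht htm)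
  intro ψ hψ hψc hψs
  -- Du Bois-Reymond: `ψ - I η` has zero mean, hence is the derivative of a test function, and `F`
  -- integrates to zero against it.
  set I := ∫ t, ψ t
  have hs1 : tsupport (fun t => ψ t - I * η t) ⊆ Ioo 0 T :=
    (tsupport_sub _ _).trans (union_subset hψs
      ((closure_mono (Function.support_mul_subset_right _ _)).trans hηs))
  have hi1 : ∫ t, (ψ t - I * η t) = 0 := by
    rw [integral_sub (hψ.continuous.integrable_of_hasCompactSupport hψc)
      ((hη.continuous.integrable_of_hasCompactSupport hηc).const_mul I), integral_const_mul, hη1,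
      mul_one, sub_self]
  obtain ⟨θ, hθ, hθc, hθs, hd⟩ := exists_primitive_test
    (hψ.sub (contDiff_const.mul hη)) hs1 (hψc.sub hηc.mul_left) hi1
  have h1 := h θ hθ hθc hθs
  rw [hd] at h1
  simp only [Pi.zero_apply, smul_zero, integral_zero, neg_zero, sub_smul, mul_smul] at h1
  rw [integral_sub (integrable_smul_of_test hψ.continuous hψc hF)
    (show Integrable (fun t => I • η t • F t) _ from
      (integrable_smul_of_test hη.continuous hηc hF).smul I), integral_smul, sub_eq_zero] at h1
  have h2 : ∫ t, ψ t • (F t - c) = ∫ t in Ioo 0 T, ψ t • (F t - c) := by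
    rw [setIntegral_eq_integral_of_forall_compl_eq_zero]
    intro t ht
    rw [image_eq_zero_of_notMem_tsupport (fun h => ht (hψs h)), zero_smul]
  have h3 : ∫ t in Ioo 0 T, ψ t = I := by
    rw [setIntegral_eq_integral_of_forall_compl_eq_zero]
    intro t ht
    rw [image_eq_zero_of_notMem_tsupport (fun h => ht (hψs h))]
  rw [h2]
  simp only [smul_sub]
  rw [integral_sub (integrable_smul_of_test hψ.continuous hψc hF)
    (integrable_smul_of_test hψ.continuous hψc (integrableOn_const (by simp))), h1,
    integral_smul_const, h3, sub_self]

/-- A function is a.e. equal to a primitive of its weak derivative. -/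
theorem ParabolicControl.HasWeakTimeDeriv.ae_eq_primitive [CompleteSpace X] {T : ℝ} (hT : 0 < T) {f g : ℝ → X}
    (hf : IntegrableOn f (Ioo 0 T)) (hg : IntegrableOn g (Ioo 0 T)) (h : HasWeakTimeDeriv T f g) :
    ∃ c, ∀ᵐ t ∂volume.restrict (Ioo 0 T), f t = c + ∫ s in (0 : ℝ)..t, g s := by
  have hcont : ContinuousOn (fun t => ∫ s in (0 : ℝ)..t, g s) (Icc 0 T) := by
    have : IntegrableOn g (uIcc 0 T) := by
      rw [uIcc_of_le hT.le]; exact (integrableOn_Icc_iff_integrableOn_Ioo).2 hg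
    simpa [uIcc_of_le hT.le] using
      intervalIntegral.continuousOn_primitive_interval (μ := volume) this
  have hp : IntegrableOn (fun t => ∫ s in (0 : ℝ)..t, g s) (Ioo 0 T) :=
    (hcont.integrableOn_Icc).mono_set Ioo_subset_Icc_self
  obtain ⟨c, hc⟩ := HasWeakTimeDeriv.ae_const (F := fun t => f t - ∫ s in (0 : ℝ)..t, g s) hT
    (hf.sub hp) (by
      intro θ hθ hθc hθs
      simp only [smul_sub, Pi.zero_apply, smul_zero, integral_zero, neg_zero]
      have hθ' : Continuous (deriv θ) := hθ.continuous_deriv (by simp)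
      rw [integral_sub (integrable_smul_of_test hθ' hθc.deriv hf)
        (integrable_smul_of_test hθ' hθc.deriv hp), h θ hθ hθc hθs,
        hasWeakTimeDeriv_primitive hg θ hθ hθc hθs, sub_self])
  refine ⟨c, ?_⟩
  filter_upwards [hc] with t ht
  rw [← ht, sub_add_cancel]

end weak

/-! ### Gelfand triples and the energy identity -/

section gelfand
open Filter Topology

variable {V H : Type*} [NormedAddCommGroup V] [InnerProductSpace ℝ V]
  [NormedAddCommGroup H] [InnerProductSpace ℝ H]

/-- The map from `V` to its dual, `u ↦ (v ↦ ⟪J u, J v⟫)`, attached to `J : V → H`. -/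
noncomputable def gelfand (J : V →L[ℝ] H) : V →L[ℝ] StrongDual ℝ V :=
  ((ContinuousLinearMap.compL ℝ V H ℝ).flip J).comp ((innerSL ℝ).comp J)

theorem gelfand_apply (J : V →L[ℝ] H) (u v : V) : gelfand J u v = inner ℝ (J u) (J v) := rfl

/-- `w` is square integrable with values in `V`, and `∂ₜ w = dw` is square integrable with values
in the dual of `V`. -/
structure IsW (T : ℝ) (J : V →L[ℝ] H) (w : ℝ → V) (dw : ℝ → StrongDual ℝ V) : Prop where
  memLp : MemLp w 2 (volume.restrict (Ioo 0 T))
  memLp_deriv : MemLp dw 2 (volume.restrict (Ioo 0 T))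
  weak_deriv : HasWeakTimeDeriv T (fun t => gelfand J (w t)) dw

section shift
variable {X : Type*} [NormedAddCommGroup X]

/-- The translate `t ↦ F (h + t)`. -/
noncomputable def lpShift (h : ℝ) (F : Lp X 2 (volume : Measure ℝ)) : Lp X 2 (volume : Measure ℝ) :=
  DomAddAct.mk h +ᵥ F

theorem continuous_lpShift (F : Lp X 2 (volume : Measure ℝ)) :
    Continuous fun h => lpShift h F := by
  unfold lpShift
  have h1 : Continuous fun h : ℝ => (DomAddAct.mk h : ℝᵈᵃᵃ) := DomAddAct.continuous_mk
  have : Fact ((2 : ENNReal) ≠ ⊤) := ⟨by simp⟩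
  exact h1.vadd continuous_const

theorem lpShift_toLp {f : ℝ → X} (hf : MemLp f 2 volume) (h : ℝ) :
    lpShift h (hf.toLp f) =ᵐ[volume] fun t => f (h + t) := by
  have h1 := DomAddAct.vadd_Lp_ae_eq (DomAddAct.mk h) (hf.toLp f)
  have h2 := (measurePreserving_add_left (volume : Measure ℝ) h).quasiMeasurePreserving.ae
    hf.coeFn_toLp
  filter_upwards [h1, h2] with t ht1 ht2
  exact ht1.trans ht2

end shift

/-- The pairing `∫ θ (f (σ + t)) (g (h + t)) dt` depends continuously on the two translations. -/
theorem exists_continuous_pairing {f : ℝ → StrongDual ℝ V} {g : ℝ → V} {θ : ℝ → ℝ}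
    (hf : MemLp f 2 volume) (hg : MemLp g 2 volume) (hθ : MemLp θ ⊤ volume) :
    Continuous fun z : ℝ × ℝ => ∫ t, θ t * f (z.1 + t) (g (z.2 + t)) := by
  let B := ContinuousLinearMap.id ℝ (StrongDual ℝ V)
  let Φ := B.lpPairing (volume : Measure ℝ) 2 2
  -- The integral is a bounded bilinear pairing evaluated at two translates, and translation is
  -- continuous in L².
  have hc : Continuous fun z : ℝ × ℝ =>
      Φ (lpShift z.1 (hf.toLp f))
        ((ContinuousLinearMap.lsmul ℝ ℝ).holderL volume ⊤ 2 2 (hθ.toLp θ)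
          (lpShift z.2 (hg.toLp g))) := by
    have h1 : Continuous fun z : ℝ × ℝ => lpShift z.1 (hf.toLp f) :=
      (continuous_lpShift _).comp continuous_fst
    have h2 : Continuous fun z : ℝ × ℝ => lpShift z.2 (hg.toLp g) :=
      (continuous_lpShift _).comp continuous_snd
    exact (Φ.continuous.comp h1).clm_apply ((ContinuousLinearMap.continuous _).comp h2)
  refine hc.congr fun z => ?_
  simp only [Φ]
  rw [ContinuousLinearMap.lpPairing_eq_integral]
  refine integral_congr_ae ?_
  have h3 := ContinuousLinearMap.coeFn_holder (r := 2) (B := ContinuousLinearMap.lsmul ℝ ℝ)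
    (hθ.toLp θ) (lpShift z.2 (hg.toLp g))
  filter_upwards [h3, lpShift_toLp hf z.1, lpShift_toLp hg z.2, hθ.coeFn_toLp] with t h3 h4 h5 h6
  have h7 : ((ContinuousLinearMap.lsmul ℝ ℝ).holderL volume ⊤ 2 2 (hθ.toLp θ)
      (lpShift z.2 (hg.toLp g))) t = θ t • g (z.2 + t) := by
    rw [← h5, ← h6]; exact h3
  rw [h4, h7]
  simp [B]

/-- The segment `{(σ, h) : 0 ≤ σ ≤ h}` shrinks to the origin. It will be applied to the pairing of
two translates, where the first one comes from writing an increment over `[t, t + h]` as an integral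
in `σ`. -/
theorem tendsto_average_of_continuous {Φ : ℝ × ℝ → ℝ} (hΦ : Continuous Φ) :
    Tendsto (fun h : ℝ => h⁻¹ * ∫ σ in (0 : ℝ)..h, Φ (σ, h)) (𝓝[>] 0) (𝓝 (Φ (0, 0))) := by
  rw [Metric.tendsto_nhdsWithin_nhds]
  intro ε hε
  obtain ⟨δ, hδ, H⟩ := Metric.continuousAt_iff.1 (hΦ.continuousAt (x := (0, 0))) (ε / 2)
    (by positivity)
  refine ⟨δ, hδ, fun {h} hh hd => ?_⟩
  have hh : 0 < h := hh
  rw [Real.dist_eq, sub_zero, abs_of_pos hh] at hd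
  have h1 : ‖∫ σ in (0 : ℝ)..h, (Φ (σ, h) - Φ (0, 0))‖ ≤ (ε / 2) * |h - 0| := by
    refine intervalIntegral.norm_integral_le_of_norm_le_const fun σ hσ => ?_
    rw [uIoc_of_le hh.le] at hσ
    rw [← dist_eq_norm]
    refine (H ?_).le
    rw [Prod.dist_eq, max_lt_iff, Real.dist_eq, Real.dist_eq]
    simp only [sub_zero]
    rw [abs_of_pos hσ.1, abs_of_pos hh]
    exact ⟨hσ.2.trans_lt hd, hd⟩
  have hcσ : Continuous fun σ => Φ (σ, h) := hΦ.comp (by fun_prop)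
  rw [intervalIntegral.integral_sub (hcσ.intervalIntegrable _ _) (by simp), intervalIntegral.integral_const, sub_zero, smul_eq_mul, abs_of_pos hh] at h1
  rw [dist_eq_norm]
  have : h⁻¹ * (∫ σ in (0 : ℝ)..h, Φ (σ, h)) - Φ (0, 0)
      = h⁻¹ * ((∫ σ in (0 : ℝ)..h, Φ (σ, h)) - h * Φ (0, 0)) := by
    field_simp
  rw [this, norm_mul, norm_inv, Real.norm_of_nonneg hh.le]
  calc h⁻¹ * _ ≤ h⁻¹ * (ε / 2 * h) := by gcongr
    _ = ε / 2 := by field_simp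
    _ < ε := by linarith

/-- Fubini's theorem; the joint integrability holds because the shear `(σ, t) ↦ (σ, σ + t)`
preserves the product measure, so that `f (σ + t)` is square integrable on `(0, h] × ℝ`. -/
theorem integral_mul_intervalIntegral_swap {f : ℝ → StrongDual ℝ V} {g : ℝ → V} {θ : ℝ → ℝ}
    (hf : MemLp f 2 volume) (hg : MemLp g 2 volume) (hθ : Continuous θ) (hc : HasCompactSupport θ)
    {h : ℝ} (hh : 0 < h) (a : ℝ) (hfi : ∀ t, IntervalIntegrable (fun σ => f (σ + t)) volume 0 h) :
    Integrable (fun t => θ t * (∫ σ in (0 : ℝ)..h, f (σ + t)) (g (a + t))) ∧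
    ∫ t, θ t * (∫ σ in (0 : ℝ)..h, f (σ + t)) (g (a + t))
      = ∫ σ in (0 : ℝ)..h, ∫ t, θ t * f (σ + t) (g (a + t)) := by
  obtain ⟨C, hC⟩ := hc.exists_bound_of_continuous hθ
  set μ := (volume : Measure ℝ).restrict (Ioc 0 h) with hμ
  have hsh := measurePreserving_prod_add μ (volume : Measure ℝ)
  have hga : MemLp (fun t => g (a + t)) 2 volume :=
    hg.comp_measurePreserving (measurePreserving_add_left volume a)
  have hf2 : MemLp (fun z : ℝ × ℝ => f (z.1 + z.2)) 2 (μ.prod volume) :=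
    (hf.comp_snd μ).comp_measurePreserving hsh
  have hg2 : MemLp (fun z : ℝ × ℝ => g (a + z.2)) 2 (μ.prod volume) := hga.comp_snd μ
  have hi : Integrable (fun z : ℝ × ℝ => θ z.2 * f (z.1 + z.2) (g (a + z.2))) (μ.prod volume) := by
    have := (ContinuousLinearMap.id ℝ (StrongDual ℝ V)).memLp_of_bilin 1 hf2 hg2
    rw [memLp_one_iff_integrable] at this
    exact this.bdd_mul (c := C) (hθ.comp continuous_snd).aestronglyMeasurable
      (Eventually.of_forall fun z => hC _)
  have hev : ∀ t, θ t * (∫ σ in (0 : ℝ)..h, f (σ + t)) (g (a + t))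
      = ∫ σ, θ t * f (σ + t) (g (a + t)) ∂μ := by
    intro t
    rw [intervalIntegral.integral_of_le hh.le, integral_const_mul,
      ← ContinuousLinearMap.integral_apply]
    have := hfi t
    rwa [intervalIntegrable_iff_integrableOn_Ioc_of_le hh.le] at this
  simp only [hev]
  refine ⟨hi.integral_prod_right, ?_⟩
  rw [intervalIntegral.integral_of_le hh.le]
  exact (integral_integral_swap (f := fun σ t => θ t * f (σ + t) (g (a + t))) hi).symm

theorem MemLp.intervalIntegrable_shift {X : Type*} [NormedAddCommGroup X] {f : ℝ → X}
    (hf : MemLp f 2 volume) (a b t : ℝ) :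
    IntervalIntegrable (fun σ => f (σ + t)) volume a b := by
  have h1 : MemLp (fun σ => f (σ + t)) 2 volume :=
    hf.comp_measurePreserving (measurePreserving_add_right volume t)
  rw [intervalIntegrable_iff, uIoc]
  exact (h1.restrict _).integrable (by norm_num)

theorem integrable_mul_dual {f : ℝ → StrongDual ℝ V} {g : ℝ → V} {θ : ℝ → ℝ}
    (hf : MemLp f 2 volume) (hg : MemLp g 2 volume) (hθ : Continuous θ)
    (hc : HasCompactSupport θ) : Integrable fun t => θ t * f t (g t) := by
  obtain ⟨C, hC⟩ := hc.exists_bound_of_continuous hθ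
  have := (ContinuousLinearMap.id ℝ (StrongDual ℝ V)).memLp_of_bilin 1 hf hg
  rw [memLp_one_iff_integrable] at this
  exact this.bdd_mul (c := C) hθ.aestronglyMeasurable (Eventually.of_forall hC)

/-- A translation of the variable moves the increment from `e`, which is only integrable, to the
smooth `θ`; one then differentiates under the integral sign. -/
theorem tendsto_difference_quotient_test {θ e : ℝ → ℝ} (hθ : ContDiff ℝ (⊤ : ℕ∞) θ)
    (hc : HasCompactSupport θ) (he : Integrable e) :
    Tendsto (fun h : ℝ => h⁻¹ * ∫ t, θ t * (e (h + t) - e t)) (𝓝[>] 0)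
      (𝓝 (-∫ t, deriv θ t * e t)) := by
  have hθ' : Continuous (deriv θ) := hθ.continuous_deriv (by simp)
  obtain ⟨C₀, hC₀⟩ := hc.exists_bound_of_continuous hθ.continuous
  obtain ⟨C, hC⟩ := hc.deriv.exists_bound_of_continuous hθ'
  have hint : ∀ h : ℝ, Integrable fun t => θ (t - h) * e t := fun h =>
    he.bdd_mul (c := C₀) (hθ.continuous.comp (by fun_prop)).aestronglyMeasurable
      (Eventually.of_forall fun t => hC₀ _)
  have hder : HasDerivAt (fun h : ℝ => ∫ t, θ (t - h) * e t) (∫ t, -deriv θ (t - 0) * e t) 0 := by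
    refine (hasDerivAt_integral_of_dominated_loc_of_deriv_le (μ := volume) (s := univ)
      (F := fun h t => θ (t - h) * e t) (F' := fun h t => -deriv θ (t - h) * e t)
      (bound := fun t => C * ‖e t‖) univ_mem
      (Eventually.of_forall fun h => (hint h).aestronglyMeasurable) (hint 0) ?_
      (Eventually.of_forall fun t h _ => ?_) (he.norm.const_mul C)
      (Eventually.of_forall fun t h _ => ?_)).2
    · exact ((hθ'.comp (by fun_prop)).neg.aestronglyMeasurable).mul he.aestronglyMeasurable
    · rw [norm_mul, norm_neg]
      exact mul_le_mul_of_nonneg_right (hC _) (norm_nonneg _)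
    · have h1 : HasDerivAt (fun h : ℝ => t - h) (-1) h := by
        simpa using (hasDerivAt_id h).const_sub t
      have h2 : HasDerivAt θ (deriv θ (t - h)) (t - h) :=
        (hθ.differentiable (by simp) _).hasDerivAt
      have h3 := (h2.comp h h1).mul_const (e t)
      simpa using h3
  have hs := hder.tendsto_slope_zero_right
  simp only [sub_zero, zero_add, neg_mul, integral_neg] at hs
  refine hs.congr fun h => ?_
  rw [smul_eq_mul]
  congr 1
  have h1 : ∫ t, θ (t - h) * e t = ∫ t, θ t * e (h + t) := by
    rw [← integral_add_left_eq_self _ h]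
    simp
  have hi : Integrable fun t => θ t * e (h + t) := by
    have := he.comp_add_left h
    exact this.bdd_mul (c := C₀) hθ.continuous.aestronglyMeasurable (Eventually.of_forall hC₀)
  have hi0 : Integrable fun t => θ t * e t := by simpa using hint 0
  rw [h1, ← integral_sub hi hi0]
  simp only [mul_sub]

/-- Discrete product rule: the increment of ⟨J w, J z⟩ between t and t + h is ⟨J (w(t+h) - w(t)), J
z(t+h)⟩ + ⟨J (z(t+h) - z(t)), J w(t)⟩. By hypothesis both increments are integrals of `dw` and `dz`
over `[t, t + h]`, so after division by h the right side is an average of continuous pairings. No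
regularisation of `w` or `z` is needed. -/
theorem integral_deriv_test_mul_inner (J : V →L[ℝ] H) {w z : ℝ → V} {dw dz : ℝ → StrongDual ℝ V}
    {θ : ℝ → ℝ} (hw : MemLp w 2 volume) (hz : MemLp z 2 volume) (hdw : MemLp dw 2 volume)
    (hdz : MemLp dz 2 volume) (hθ : ContDiff ℝ (⊤ : ℕ∞) θ) (hc : HasCompactSupport θ)
    (hincw : ∀ᶠ h in 𝓝[>] (0 : ℝ), ∀ᵐ t, θ t ≠ 0 →
      gelfand J (w (h + t) - w t) = ∫ σ in (0 : ℝ)..h, dw (σ + t))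
    (hincz : ∀ᶠ h in 𝓝[>] (0 : ℝ), ∀ᵐ t, θ t ≠ 0 →
      gelfand J (z (h + t) - z t) = ∫ σ in (0 : ℝ)..h, dz (σ + t)) :
    ∫ t, deriv θ t * inner ℝ (J (w t)) (J (z t)) = -∫ t, θ t * (dw t (z t) + dz t (w t)) := by
  have he : Integrable fun t => (inner ℝ (J (w t)) (J (z t)) : ℝ) := by
    have := (innerSL ℝ (E := H)).memLp_of_bilin (r := 1) (J.comp_memLp' hw) (J.comp_memLp' hz)
    rwa [memLp_one_iff_integrable] at this
  have hθm : MemLp θ ⊤ volume := by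
    obtain ⟨C₀, hC₀⟩ := hc.exists_bound_of_continuous hθ.continuous
    exact memLp_top_of_bound hθ.continuous.aestronglyMeasurable C₀ (Eventually.of_forall hC₀)
  have hL := tendsto_difference_quotient_test hθ hc he
  have hR1 := tendsto_average_of_continuous (exists_continuous_pairing hdw hz hθm)
  -- The second translation is frozen at 0 because in the second term of the product rule `w` is
  -- taken at time t, not t + h.
  have hR2 := tendsto_average_of_continuous
    ((exists_continuous_pairing hdz hw hθm).comp
      (f := fun p : ℝ × ℝ => (p.1, (0 : ℝ))) (by fun_prop))
  have hR := hR1.add hR2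
  simp only [Function.comp, zero_add] at hR
  rw [← integral_add (integrable_mul_dual hdw hz hθ.continuous hc)
    (integrable_mul_dual hdz hw hθ.continuous hc)] at hR
  have hEq : (fun h : ℝ => h⁻¹ * (∫ σ in (0 : ℝ)..h, ∫ t, θ t * dw (σ + t) (z (h + t)))
      + h⁻¹ * (∫ σ in (0 : ℝ)..h, ∫ t, θ t * dz (σ + t) (w t))) =ᶠ[𝓝[>] 0]
      fun h : ℝ => h⁻¹ * ∫ t, θ t * (inner ℝ (J (w (h + t))) (J (z (h + t)))
        - inner ℝ (J (w t)) (J (z t))) := by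
    filter_upwards [hincw, hincz, self_mem_nhdsWithin] with h h1 h2 hh
    have hh : 0 < h := hh
    obtain ⟨i1, e1⟩ := integral_mul_intervalIntegral_swap hdw hz hθ.continuous hc hh h
      (MemLp.intervalIntegrable_shift hdw 0 h)
    obtain ⟨i2, e2⟩ := integral_mul_intervalIntegral_swap hdz hw hθ.continuous hc hh 0
      (MemLp.intervalIntegrable_shift hdz 0 h)
    simp only [zero_add] at i2 e2
    rw [← e1, ← e2, ← mul_add, ← integral_add i1 i2]
    congr 1
    refine integral_congr_ae ?_
    filter_upwards [h1, h2] with t h1 h2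
    by_cases h0 : θ t = 0
    · simp [h0]
    · rw [← h1 h0, ← h2 h0, gelfand_apply, gelfand_apply, ← mul_add]
      congr 1
      simp only [map_sub, inner_sub_left]
      rw [real_inner_comm (J (w t)) (J (z (h + t))), real_inner_comm (J (w t)) (J (z t))]
      ring
  have := tendsto_nhds_unique hL (hR.congr' hEq)
  simp only [mul_add]
  linarith

theorem exists_margin_of_tsupport {θ : ℝ → ℝ} {T : ℝ} (hc : HasCompactSupport θ)
    (hs : tsupport θ ⊆ Ioo 0 T) : ∃ δ > 0, ∀ t, θ t ≠ 0 → 0 < t ∧ t < T - δ := by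
  rcases (tsupport θ).eq_empty_or_nonempty with he | hne
  · rw [tsupport_eq_empty_iff] at he
    exact ⟨1, one_pos, fun t ht => absurd (by simp [he]) ht⟩
  · obtain ⟨b, hbψ, hb⟩ := hc.isCompact.exists_isGreatest hne
    refine ⟨(T - b) / 2, by linarith [(hs hbψ).2], fun t ht => ?_⟩
    have h1 := subset_tsupport θ ht
    exact ⟨(hs h1).1, by linarith [(hs hbψ).2, hb h1]⟩

theorem MemLp.indicator_of_restrict {X : Type*} [NormedAddCommGroup X] {f : ℝ → X} {s : Set ℝ}
    (hs : MeasurableSet s) (hf : MemLp f 2 (volume.restrict s)) :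
    MemLp (s.indicator f) 2 volume :=
  (memLp_indicator_iff_restrict hs).2 hf

variable {T : ℝ} {J : V →L[ℝ] H} {w z : ℝ → V} {dw dz : ℝ → StrongDual ℝ V}

theorem IsW.ae_eq_primitive (hw : IsW T J w dw) (hT : 0 < T) :
    ∃ c, ∀ᵐ t ∂volume.restrict (Ioo 0 T), gelfand J (w t) = c + ∫ s in (0 : ℝ)..t, dw s :=
  hw.weak_deriv.ae_eq_primitive hT
    (((gelfand J).comp_memLp' hw.memLp).integrable (by norm_num))
    (hw.memLp_deriv.integrable (by norm_num))

/-- Extension by zero may create jumps at 0 and T. For h smaller than the margin left by the support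
of `θ` before T, both t and t + h stay in `(0,T)` wherever `θ t ≠ 0`, so the jumps are not seen. -/
theorem IsW.increments (hw : IsW T J w dw) (hT : 0 < T) {θ : ℝ → ℝ}
    (hc : HasCompactSupport θ) (hs : tsupport θ ⊆ Ioo 0 T) :
    ∀ᶠ h in 𝓝[>] (0 : ℝ), ∀ᵐ t, θ t ≠ 0 →
      gelfand J ((Ioo 0 T).indicator w (h + t) - (Ioo 0 T).indicator w t)
        = ∫ σ in (0 : ℝ)..h, (Ioo 0 T).indicator dw (σ + t) := by
  obtain ⟨δ, hδ, hδs⟩ := exists_margin_of_tsupport hc hs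
  obtain ⟨c, hcw⟩ := hw.ae_eq_primitive hT
  rw [ae_restrict_iff' measurableSet_Ioo] at hcw
  filter_upwards [Ioo_mem_nhdsGT hδ] with h hh
  have hcw' := (measurePreserving_add_left (volume : Measure ℝ) h).quasiMeasurePreserving.ae hcw
  filter_upwards [hcw, hcw'] with t h1 h2 h0
  have ht := hδs t h0
  have m1 : t ∈ Ioo 0 T := ⟨ht.1, by linarith⟩
  have m2 : h + t ∈ Ioo 0 T := ⟨by linarith [hh.1], by linarith [hh.2]⟩
  have hi : ∀ a ∈ Icc 0 T, IntervalIntegrable dw volume 0 a := by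
    intro a ha
    rw [intervalIntegrable_iff_integrableOn_Ioo_of_le ha.1]
    exact IntegrableOn.mono_set (hw.memLp_deriv.integrable (by norm_num))
      (Ioo_subset_Ioo_right ha.2)
  rw [indicator_of_mem m1, indicator_of_mem m2, map_sub, h1 m1, h2 m2, add_sub_add_left_eq_sub,
    intervalIntegral.integral_interval_sub_left (hi _ (Ioo_subset_Icc_self m2))
      (hi _ (Ioo_subset_Icc_self m1))]
  rw [intervalIntegral.integral_comp_add_right (fun s => (Ioo 0 T).indicator dw s), zero_add]
  refine intervalIntegral.integral_congr fun s hs' => ?_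
  rw [uIcc_of_le (by linarith [hh.1])] at hs'
  have : s ∈ Ioo 0 T := ⟨m1.1.trans_le hs'.1, hs'.2.trans_lt m2.2⟩
  simp only [indicator_of_mem this]

/-- `d/dt ⟪w, z⟫ = ⟨∂ₜ w, z⟩ + ⟨∂ₜ z, w⟩` in the sense of distributions. -/
theorem IsW.hasWeakTimeDeriv_inner (hw : IsW T J w dw) (hz : IsW T J z dz) (hT : 0 < T) :
    HasWeakTimeDeriv T (fun t => (inner ℝ (J (w t)) (J (z t)) : ℝ))
      fun t => dw t (z t) + dz t (w t) := by
  intro θ hθ hc hs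
  have hm : MeasurableSet (Ioo 0 T) := measurableSet_Ioo
  have h1 : MemLp ((Ioo 0 T).indicator w) 2 volume := MemLp.indicator_of_restrict hm hw.memLp
  have h2 : MemLp ((Ioo 0 T).indicator z) 2 volume := MemLp.indicator_of_restrict hm hz.memLp
  have h3 : MemLp ((Ioo 0 T).indicator dw) 2 volume :=
    MemLp.indicator_of_restrict hm hw.memLp_deriv
  have h4 : MemLp ((Ioo 0 T).indicator dz) 2 volume :=
    MemLp.indicator_of_restrict hm hz.memLp_deriv
  have h5 := hw.increments hT hc hs
  have h6 := hz.increments hT hc hs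
  have key := integral_deriv_test_mul_inner J h1 h2 h3 h4 hθ hc h5 h6
  simp only [smul_eq_mul]
  rw [← integral_indicator hm, ← integral_indicator hm]
  have e1 : (fun t => deriv θ t * (inner ℝ (J ((Ioo 0 T).indicator w t))
      (J ((Ioo 0 T).indicator z t)) : ℝ))
      = (Ioo 0 T).indicator fun t => deriv θ t * (inner ℝ (J (w t)) (J (z t)) : ℝ) := by
    ext t
    by_cases h : t ∈ Ioo 0 T
    · simp only [indicator_of_mem h]
    · simp only [indicator_of_notMem h, map_zero, inner_zero_left, mul_zero]
  have e2 : (fun t => θ t * ((Ioo 0 T).indicator dw t ((Ioo 0 T).indicator z t)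
        + (Ioo 0 T).indicator dz t ((Ioo 0 T).indicator w t)))
      = (Ioo 0 T).indicator fun t => θ t * (dw t (z t) + dz t (w t)) := by
    ext t
    by_cases h : t ∈ Ioo 0 T
    · simp only [indicator_of_mem h]
    · simp only [indicator_of_notMem h, map_zero, add_zero, mul_zero]
  rw [e1, e2] at key
  exact key

end gelfand

/-! ### The representative of an element of W(0,T) in C⁰([0,T]; H) -/

section representative
open Filter Topology

/-- The variance of `g` with respect to the normalised measure is nonnegative. -/
theorem sq_integral_le_measure_mul {α : Type*} [MeasurableSpace α] {μ : Measure α}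
    [IsFiniteMeasure μ] {g : α → ℝ} (hg : Integrable g μ) (hg2 : Integrable (fun t => g t ^ 2) μ) :
    (∫ t, g t ∂μ) ^ 2 ≤ μ.real univ * ∫ t, g t ^ 2 ∂μ := by
  rcases eq_or_ne μ 0 with rfl | h
  · simp
  set L := μ.real univ
  have hL : 0 < L := by
    have : NeZero μ := ⟨h⟩
    exact measureReal_univ_pos
  set I := ∫ t, g t ∂μ
  have h1 : 0 ≤ ∫ t, (g t - I / L) ^ 2 ∂μ := integral_nonneg fun t => sq_nonneg _
  have h2 : ∀ t, (g t - I / L) ^ 2 = g t ^ 2 - 2 * (I / L) * g t + (I / L) ^ 2 := fun t => by ring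
  simp only [h2] at h1
  have hi : Integrable (fun t => g t ^ 2 - 2 * (I / L) * g t) μ := hg2.sub (hg.const_mul _)
  rw [integral_add hi (integrable_const _), integral_sub hg2 (hg.const_mul _), integral_const_mul, integral_const, smul_eq_mul] at h1
  change 0 ≤ (∫ t, g t ^ 2 ∂μ) - 2 * (I / L) * I + L * (I / L) ^ 2 at h1
  have h3 : (∫ t, g t ^ 2 ∂μ) - 2 * (I / L) * I + L * (I / L) ^ 2
      = (L * (∫ t, g t ^ 2 ∂μ) - I ^ 2) / L := by
    field_simp; ring
  rw [h3] at h1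
  have := (div_nonneg_iff.1 h1)
  rcases this with h | h
  · linarith [h.1]
  · linarith [h.2]

/-- Cauchy–Schwarz makes primitives of square integrable functions Hölder continuous of exponent
1/2. The factor `|b - a|` is matched with the one in `exists_mul_sq_norm_lt`. -/
theorem sq_norm_intervalIntegral_le {X : Type*} [NormedAddCommGroup X] [NormedSpace ℝ X] {T : ℝ}
    {f : ℝ → X} (hf : MemLp f 2 (volume.restrict (Ioo 0 T))) {a b : ℝ} (ha : a ∈ Icc 0 T)
    (hb : b ∈ Icc 0 T) :
    ‖∫ s in a..b, f s‖ ^ 2 ≤ |b - a| * ∫ s in Ioo 0 T, ‖f s‖ ^ 2 := by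
  wlog hab : a ≤ b generalizing a b
  · rw [intervalIntegral.integral_symm, norm_neg, abs_sub_comm]
    exact this hb ha (le_of_not_ge hab)
  have hsub : Ioo a b ⊆ Ioo 0 T := Ioo_subset_Ioo ha.1 hb.2
  have hf2 : IntegrableOn (fun s => ‖f s‖ ^ 2) (Ioo 0 T) := hf.integrable_norm_pow (by norm_num)
  have hf1 : IntegrableOn (fun s => ‖f s‖) (Ioo 0 T) := (hf.integrable (by norm_num)).norm
  rw [intervalIntegral.integral_of_le hab, integral_Ioc_eq_integral_Ioo]
  calc ‖∫ s in Ioo a b, f s‖ ^ 2 ≤ (∫ s in Ioo a b, ‖f s‖) ^ 2 := by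
        gcongr; exact norm_integral_le_integral_norm _
    _ ≤ (volume.restrict (Ioo a b)).real univ * ∫ s in Ioo a b, ‖f s‖ ^ 2 :=
        sq_integral_le_measure_mul (hf1.mono_set hsub) (hf2.mono_set hsub)
    _ ≤ |b - a| * ∫ s in Ioo 0 T, ‖f s‖ ^ 2 := by
        have : (volume.restrict (Ioo a b)).real univ = |b - a| := by
          rw [measureReal_restrict_apply_univ, Real.volume_real_Ioo_of_le hab,
            abs_of_nonneg (sub_nonneg.2 hab)]
        rw [this]
        exact mul_le_mul_of_nonneg_left (setIntegral_mono_set hf2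
          (Eventually.of_forall fun s => sq_nonneg _) hsub.eventuallyLE) (abs_nonneg _)

theorem continuousOn_primitive_of_integrableOn_Ioo {X : Type*} [NormedAddCommGroup X]
    [NormedSpace ℝ X] {T : ℝ} (hT : 0 < T) {g : ℝ → X} (hg : IntegrableOn g (Ioo 0 T)) :
    ContinuousOn (fun t => ∫ s in (0 : ℝ)..t, g s) (Icc 0 T) := by
  have : IntegrableOn g (uIcc 0 T) := by
    rw [uIcc_of_le hT.le]; exact (integrableOn_Icc_iff_integrableOn_Ioo).2 hg
  simpa [uIcc_of_le hT.le] using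
    intervalIntegral.continuousOn_primitive_interval (μ := volume) this

theorem intervalIntegrable_of_integrableOn_Ioo {X : Type*} [NormedAddCommGroup X] {T : ℝ}
    {g : ℝ → X} (hg : IntegrableOn g (Ioo 0 T)) {a b : ℝ} (ha : a ∈ Icc 0 T) (hb : b ∈ Icc 0 T) :
    IntervalIntegrable g volume a b := by
  wlog hab : a ≤ b generalizing a b
  · exact (this hb ha (le_of_not_ge hab)).symm
  rw [intervalIntegrable_iff_integrableOn_Ioo_of_le hab]
  exact hg.mono_set (Ioo_subset_Ioo ha.1 hb.2)

theorem eqOn_Icc_of_ae_eq_Ioo {X : Type*} [TopologicalSpace X] [T2Space X] {T : ℝ} (hT : 0 < T)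
    {f g : ℝ → X} (hf : ContinuousOn f (Icc 0 T)) (hg : ContinuousOn g (Icc 0 T))
    (h : ∀ᵐ t ∂volume.restrict (Ioo 0 T), f t = g t) : EqOn f g (Icc 0 T) := by
  refine Measure.eqOn_Icc_of_ae_eq volume hT.ne ?_ hf hg
  rwa [restrict_Ioo_eq_restrict_Icc] at h

theorem Icc_subset_closure_of_ae {T : ℝ} (hT : 0 < T) {D : Set ℝ}
    (hD : ∀ᵐ t ∂volume.restrict (Ioo 0 T), t ∈ D) : Icc 0 T ⊆ closure (D ∩ Ioo 0 T) := by
  rw [← closure_Ioo hT.ne]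
  refine closure_minimal (fun t ht => ?_) isClosed_closure
  rw [mem_closure_iff]
  intro o ho hto
  have hopen : IsOpen (o ∩ Ioo 0 T) := ho.inter isOpen_Ioo
  rw [ae_restrict_iff' measurableSet_Ioo] at hD
  have hpos : volume (o ∩ Ioo 0 T) ≠ 0 := (hopen.measure_pos volume ⟨t, hto, ht⟩).ne'
  by_contra hemp
  apply hpos
  refine measure_mono_null (fun s hs => ?_) hD
  simp only [mem_compl_iff, mem_ofPred_eq]
  exact fun hh => hemp ⟨s, hs.1, hh hs.2, hs.2⟩

/-- A square integrable function cannot dominate `|r - t₀|^{-1/2}` near `t₀`. -/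
theorem exists_mul_sq_norm_lt {X : Type*} [NormedAddCommGroup X] {T : ℝ}
    {w : ℝ → X} (hw : MemLp w 2 (volume.restrict (Ioo 0 T))) {a b t₀ : ℝ} (ha : 0 ≤ a) (hb : b ≤ T)
    (hab : a < b) (ht₀ : t₀ ∈ Icc a b) {D : Set ℝ} (hD : ∀ᵐ t ∂volume.restrict (Ioo 0 T), t ∈ D)
    {c : ℝ} (hc : 0 < c) : ∃ r ∈ D ∩ Ioo a b, |r - t₀| * ‖w r‖ ^ 2 < c := by
  by_contra! hcon
  have hw2 : IntegrableOn (fun s => ‖w s‖ ^ 2) (Ioo 0 T) := hw.integrable_norm_pow (by norm_num)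
  have hsub : Ioo a b ⊆ Ioo 0 T := Ioo_subset_Ioo ha hb
  -- Were the claim false, `|r - t₀|⁻¹` would be dominated by `c⁻¹ ‖w r‖ ^ 2`, hence integrable up
  -- to `t₀`.
  have hi : IntervalIntegrable (fun r => (r - t₀)⁻¹) volume a b := by
    rw [intervalIntegrable_iff_integrableOn_Ioo_of_le hab.le]
    refine Integrable.mono' ((hw2.mono_set hsub).const_mul c⁻¹)
      (by fun_prop) ?_
    have hD' := ae_restrict_of_ae_restrict_of_subset hsub hD
    filter_upwards [hD', ae_restrict_mem measurableSet_Ioo] with r h1 h2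
    have h3 := hcon r ⟨h1, h2⟩
    rw [norm_inv, Real.norm_eq_abs]
    have h4 : 0 < |r - t₀| := by
      by_contra h
      have : |r - t₀| = 0 := le_antisymm (not_lt.1 h) (abs_nonneg _)
      rw [this, zero_mul] at h3
      linarith
    rw [inv_mul_eq_div, ← one_div, div_le_div_iff₀ h4 hc]
    linarith
  rw [intervalIntegrable_sub_inv_iff] at hi
  rcases hi with h | h
  · exact hab.ne h
  · exact h (by rwa [uIcc_of_le hab.le])

variable {V H : Type*} [NormedAddCommGroup V] [InnerProductSpace ℝ V]
  [NormedAddCommGroup H] [InnerProductSpace ℝ H]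
  {T : ℝ} {J : V →L[ℝ] H} {w z : ℝ → V} {dw dz : ℝ → StrongDual ℝ V}

theorem IsW.integrableOn_pairing (hw : IsW T J w dw) (hz : IsW T J z dz) :
    IntegrableOn (fun t => dw t (z t)) (Ioo 0 T) := by
  have := (ContinuousLinearMap.id ℝ (StrongDual ℝ V)).memLp_of_bilin 1 hw.memLp_deriv hz.memLp
  rwa [memLp_one_iff_integrable] at this

theorem IsW.integrableOn_inner (hw : IsW T J w dw) (hz : IsW T J z dz) :
    IntegrableOn (fun t => (inner ℝ (J (w t)) (J (z t)) : ℝ)) (Ioo 0 T) := by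
  have := (innerSL ℝ (E := H)).memLp_of_bilin 1 (J.comp_memLp' hw.memLp) (J.comp_memLp' hz.memLp)
  rwa [memLp_one_iff_integrable] at this

theorem IsW.inner_ae_eq_primitive (hw : IsW T J w dw) (hz : IsW T J z dz) (hT : 0 < T) :
    ∃ c, ∀ᵐ t ∂volume.restrict (Ioo 0 T), (inner ℝ (J (w t)) (J (z t)) : ℝ)
      = c + ∫ s in (0 : ℝ)..t, (dw s (z s) + dz s (w s)) :=
  (hw.hasWeakTimeDeriv_inner hz hT).ae_eq_primitive hT (hw.integrableOn_inner hz)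
    ((hw.integrableOn_pairing hz).add (hz.integrableOn_pairing hw))

theorem IsW.inner_sub_inner (hw : IsW T J w dw) (hz : IsW T J z dz) (hT : 0 < T) {y ζ : ℝ → H}
    (hy : ContinuousOn y (Icc 0 T)) (hyw : ∀ᵐ t ∂volume.restrict (Ioo 0 T), y t = J (w t))
    (hζ : ContinuousOn ζ (Icc 0 T)) (hζz : ∀ᵐ t ∂volume.restrict (Ioo 0 T), ζ t = J (z t)) :
    ∀ t ∈ Icc 0 T, (inner ℝ (y t) (ζ t) : ℝ) - inner ℝ (y 0) (ζ 0)
      = ∫ s in (0 : ℝ)..t, (dw s (z s) + dz s (w s)) := by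
  obtain ⟨c, hc⟩ := hw.inner_ae_eq_primitive hz hT
  have hcont := continuousOn_primitive_of_integrableOn_Ioo hT
    ((hw.integrableOn_pairing hz).add (hz.integrableOn_pairing hw))
  have h := eqOn_Icc_of_ae_eq_Ioo hT (f := fun t => (inner ℝ (y t) (ζ t) : ℝ))
    (g := fun t => c + ∫ s in (0 : ℝ)..t, (dw s (z s) + dz s (w s))) (hy.inner hζ)
    (continuousOn_const.add hcont) (by
      filter_upwards [hc, hyw, hζz] with t h1 h2 h3
      rw [h2, h3, h1])
  intro t ht
  have h1 := h ht
  have h0 := h (left_mem_Icc.2 hT.le)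
  simp only [intervalIntegral.integral_same, add_zero] at h0 h1
  rw [h0, h1, add_sub_cancel_left]

/-- An element of `W(0,T)` has a representative in `C⁰([0,T]; H)`. -/
theorem IsW.exists_continuousOn_rep [CompleteSpace H] (hw : IsW T J w dw) (hT : 0 < T) :
    ∃ y : ℝ → H, ContinuousOn y (Icc 0 T) ∧
      ∀ᵐ t ∂volume.restrict (Ioo 0 T), y t = J (w t) := by
  obtain ⟨c, hc⟩ := hw.inner_ae_eq_primitive hw hT
  obtain ⟨c', hc'⟩ := hw.ae_eq_primitive hT
  have hQi : IntegrableOn dw (Ioo 0 T) := hw.memLp_deriv.integrable (by norm_num)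
  set E : ℝ → ℝ := fun t => c + ∫ s in (0 : ℝ)..t, (dw s (w s) + dw s (w s)) with hE
  set Q : ℝ → StrongDual ℝ V := fun t => c' + ∫ s in (0 : ℝ)..t, dw s with hQ
  have hEc : ContinuousOn E (Icc 0 T) := continuousOn_const.add
    (continuousOn_primitive_of_integrableOn_Ioo hT
      ((hw.integrableOn_pairing hw).add (hw.integrableOn_pairing hw)))
  have hQc : ContinuousOn Q (Icc 0 T) := continuousOn_const.add
    (continuousOn_primitive_of_integrableOn_Ioo hT hQi)
  -- The times at which the energy and the functional agree with their continuous versions `E` and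
  -- `Q`. The representative is the extension by continuity of `J (w t)` from these times.
  let D₀ : Set ℝ := {t | (inner ℝ (J (w t)) (J (w t)) : ℝ) = E t ∧ gelfand J (w t) = Q t}
  have hD₀ : ∀ᵐ t ∂volume.restrict (Ioo 0 T), t ∈ D₀ := by
    filter_upwards [hc, hc'] with t h1 h2 using ⟨h1, h2⟩
  set D := D₀ ∩ Ioo 0 T with hD
  have hDsub : D ⊆ Icc 0 T := fun t ht => Ioo_subset_Icc_self ht.2
  have hdense : Icc 0 T ⊆ closure D := Icc_subset_closure_of_ae hT hD₀
  -- For fixed r the squared distance is a continuous function of t that makes sense on all of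
  -- `[0,T]`, also at times where `w` is not controlled.
  have hdist : ∀ t ∈ D, ∀ r ∈ D, ‖J (w t) - J (w r)‖ ^ 2 = E t + E r - 2 * Q t (w r) := by
    intro t ht r hr
    rw [norm_sub_sq_real, ← real_inner_self_eq_norm_sq, ← real_inner_self_eq_norm_sq, ht.1.1,
      hr.1.1, ← ht.1.2, gelfand_apply]
    ring
  set M := ∫ s in Ioo 0 T, ‖dw s‖ ^ 2 with hM
  have hM0 : 0 ≤ M := integral_nonneg fun s => sq_nonneg _
  -- The quantity equals `E t₀ - E r + 2 (Q r - Q t₀) (w r)`. The last term is at most 2 (|r - t₀|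
  -- M)^{1/2} ‖w r‖, and r can be chosen near `t₀` so that |r - t₀| ‖w r‖² is as small as desired.
  have hsmall : ∀ t₀ ∈ Icc 0 T, ∀ ε > 0, ∃ r ∈ D, E t₀ + E r - 2 * Q t₀ (w r) < ε := by
    intro t₀ ht₀ ε hε
    obtain ⟨η, hη, hηE⟩ := Metric.continuousWithinAt_iff.1 (hEc t₀ ht₀) (ε / 2) (by positivity)
    have hab : max 0 (t₀ - η / 2) < min T (t₀ + η / 2) := by
      rw [max_lt_iff, lt_min_iff, lt_min_iff]
      exact ⟨⟨hT, by linarith [ht₀.1]⟩, by linarith [ht₀.2], by linarith⟩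
    obtain ⟨r, hr, hrc⟩ := exists_mul_sq_norm_lt hw.memLp (le_max_left 0 (t₀ - η / 2))
      (min_le_left T (t₀ + η / 2)) hab (t₀ := t₀)
      ⟨max_le ht₀.1 (by linarith), le_min ht₀.2 (by linarith)⟩ hD₀
      (c := (ε / 4) ^ 2 / (M + 1)) (by positivity)
    have hr0 : r ∈ Ioo 0 T := ⟨(le_max_left _ _).trans_lt hr.2.1, hr.2.2.trans_le (min_le_left _ _)⟩
    have hrD : r ∈ D := ⟨hr.1, hr0⟩
    refine ⟨r, hrD, ?_⟩
    have h1 : E r = Q r (w r) := by rw [← hrD.1.1, ← hrD.1.2, gelfand_apply]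
    have h2 : Q r - Q t₀ = ∫ s in t₀..r, dw s := by
      simp only [hQ, add_sub_add_left_eq_sub]
      exact intervalIntegral.integral_interval_sub_left
        (intervalIntegrable_of_integrableOn_Ioo hQi (left_mem_Icc.2 hT.le) (hDsub hrD))
        (intervalIntegrable_of_integrableOn_Ioo hQi (left_mem_Icc.2 hT.le) ht₀)
    have h3 : ‖Q r - Q t₀‖ ^ 2 ≤ |r - t₀| * M := by
      rw [h2]
      exact sq_norm_intervalIntegral_le hw.memLp_deriv ht₀ (hDsub hrD)
    have h4 : ‖(Q r - Q t₀) (w r)‖ ^ 2 < (ε / 4) ^ 2 := by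
      calc ‖(Q r - Q t₀) (w r)‖ ^ 2 ≤ (‖Q r - Q t₀‖ * ‖w r‖) ^ 2 := by
            gcongr; exact ContinuousLinearMap.le_opNorm _ _
        _ = ‖Q r - Q t₀‖ ^ 2 * ‖w r‖ ^ 2 := by ring
        _ ≤ (|r - t₀| * M) * ‖w r‖ ^ 2 := by gcongr
        _ ≤ (|r - t₀| * ‖w r‖ ^ 2) * (M + 1) := by
            have : 0 ≤ |r - t₀| * ‖w r‖ ^ 2 := by positivity
            nlinarith
        _ < ((ε / 4) ^ 2 / (M + 1)) * (M + 1) := by gcongr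
        _ = (ε / 4) ^ 2 := by field_simp
    have h5 : ‖(Q r - Q t₀) (w r)‖ < ε / 4 := lt_of_pow_lt_pow_left₀ 2 (by positivity) h4
    have h6 : |E r - E t₀| < ε / 2 := by
      rw [← Real.dist_eq]
      refine hηE (hDsub hrD) ?_
      rw [Real.dist_eq, abs_lt]
      have := hr.2.1; have := hr.2.2
      constructor
      · linarith [le_max_right 0 (t₀ - η / 2)]
      · linarith [min_le_right T (t₀ + η / 2)]
    rw [Real.norm_eq_abs] at h5
    have h7 := (abs_lt.1 h5).2
    have h8 := (abs_lt.1 h6).1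
    rw [sub_apply] at h7
    rw [h1] at h8 ⊢
    linarith
  -- Cauchy criterion: with r from `hsmall`, all good times close to `t₀` have `J (w t)` within `ε /
  -- 2` of `J (w r)`.
  have hlim : ∀ t₀ ∈ Icc 0 T, ∃ y, Tendsto (fun t => J (w t)) (𝓝[D] t₀) (𝓝 y) := by
    intro t₀ ht₀
    have : (𝓝[D] t₀).NeBot := mem_closure_iff_nhdsWithin_neBot.1 (hdense ht₀)
    refine cauchy_map_iff_exists_tendsto.1 (Metric.cauchy_iff.2 ⟨this.map _, fun ε hε => ?_⟩)
    obtain ⟨r, hr, hrs⟩ := hsmall t₀ ht₀ ((ε / 2) ^ 2) (by positivity)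
    have hcont : ContinuousWithinAt (fun t => E t + E r - 2 * Q t (w r)) D t₀ := by
      have h1 := (hEc t₀ ht₀).mono hDsub
      have h2 := (hQc t₀ ht₀).mono hDsub
      exact (h1.add continuousWithinAt_const).sub
        (continuousWithinAt_const.mul (h2.clm_apply continuousWithinAt_const))
    have hev := (hcont.eventually_lt continuousWithinAt_const hrs).and self_mem_nhdsWithin
    refine ⟨_, image_mem_map hev, ?_⟩
    have hclose : ∀ t, (E t + E r - 2 * Q t (w r) < (ε / 2) ^ 2 ∧ t ∈ D) →
        dist (J (w t)) (J (w r)) < ε / 2 := by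
      rintro t ⟨h1, h2⟩
      rw [dist_eq_norm]
      refine lt_of_pow_lt_pow_left₀ 2 (by positivity) ?_
      rwa [hdist t h2 r hr]
    rintro _ ⟨s, hs, rfl⟩ _ ⟨t, ht, rfl⟩
    calc dist (J (w s)) (J (w t)) ≤ dist (J (w s)) (J (w r)) + dist (J (w t)) (J (w r)) :=
          dist_triangle_right _ _ _
      _ < ε / 2 + ε / 2 := add_lt_add (hclose s hs) (hclose t ht)
      _ = ε := by ring
  refine ⟨extendFrom D fun t => J (w t), continuousOn_extendFrom hdense hlim, ?_⟩
  filter_upwards [hD₀, ae_restrict_mem measurableSet_Ioo] with t h1 h2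
  have htD : t ∈ D := ⟨h1, h2⟩
  obtain ⟨y, hy⟩ := hlim t (hDsub htD)
  have h3 : J (w t) = y := by
    have : Tendsto (fun t => J (w t)) (pure t) (𝓝 y) := hy.mono_left (pure_le_nhdsWithin htD)
    exact tendsto_nhds_unique (tendsto_pure_nhds _ _) this
  rw [extendFrom_eq (hdense (hDsub htD)) hy, h3]

end representative

/-! ### Representation of functionals, uniqueness, and measurability of operator families -/

section abstractProblem
open Filter Topology ContinuousLinearMap

/-- A functional dominated by the norm of a linear map is represented through that map. -/
theorem exists_inner_eq_of_le_norm {E W : Type*} [AddCommGroup E] [Module ℝ E]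
    [NormedAddCommGroup W] [InnerProductSpace ℝ W] [CompleteSpace W] (K : E →ₗ[ℝ] W)
    (l : E →ₗ[ℝ] ℝ) (C : ℝ) (h : ∀ φ, |l φ| ≤ C * ‖K φ‖) : ∃ w : W, ∀ φ, inner ℝ w (K φ) = l φ := by
  have hker : LinearMap.ker K ≤ LinearMap.ker l := by
    intro φ hφ
    rw [LinearMap.mem_ker] at hφ ⊢
    have := h φ
    rw [hφ, norm_zero, mul_zero] at this
    exact abs_nonpos_iff.1 this
  -- The bound kills `l` on the kernel of `K`, so `l` descends to a bounded functional on the range.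
  -- That range need not be closed, so Hahn–Banach precedes Riesz.
  let l' : LinearMap.range K →ₗ[ℝ] ℝ :=
    (Submodule.liftQ _ l hker).comp K.quotKerEquivRange.symm.toLinearMap
  have hl' : ∀ φ, l' ⟨K φ, LinearMap.mem_range_self K φ⟩ = l φ := by
    intro φ
    have : K.quotKerEquivRange.symm ⟨K φ, LinearMap.mem_range_self K φ⟩
        = (LinearMap.ker K).mkQ φ := by
      rw [LinearEquiv.symm_apply_eq]; rfl
    simp only [l', LinearMap.comp_apply, LinearEquiv.coe_coe, this, Submodule.mkQ_apply,
      Submodule.liftQ_apply]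
  let L : StrongDual ℝ (LinearMap.range K) := l'.mkContinuous C (by
    rintro ⟨_, φ, rfl⟩
    rw [hl', Real.norm_eq_abs]
    exact h φ)
  obtain ⟨g, hg, -⟩ := _root_.exists_extension_norm_eq (LinearMap.range K) L
  refine ⟨(InnerProductSpace.toDual ℝ W).symm g, fun φ => ?_⟩
  rw [InnerProductSpace.toDual_symm_apply, ← hl' φ]
  exact hg ⟨K φ, LinearMap.mem_range_self K φ⟩

variable {V H G' : Type*} [NormedAddCommGroup V] [InnerProductSpace ℝ V]
  [NormedAddCommGroup H] [InnerProductSpace ℝ H]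
  [NormedAddCommGroup G'] [InnerProductSpace ℝ G']
  {T : ℝ} {J : V →L[ℝ] H} {w z : ℝ → V} {dw dz : ℝ → StrongDual ℝ V}

theorem ParabolicControl.HasWeakTimeDeriv.sub {X : Type*} [NormedAddCommGroup X] [NormedSpace ℝ X]
    {f g df dg : ℝ → X} (hf : HasWeakTimeDeriv T f df) (hg : HasWeakTimeDeriv T g dg)
    (hfi : IntegrableOn f (Ioo 0 T)) (hgi : IntegrableOn g (Ioo 0 T))
    (hdfi : IntegrableOn df (Ioo 0 T)) (hdgi : IntegrableOn dg (Ioo 0 T)) :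
    HasWeakTimeDeriv T (fun t => f t - g t) (fun t => df t - dg t) := by
  intro θ hθ hc hs
  have hθ' : Continuous (deriv θ) := hθ.continuous_deriv (by simp)
  simp only [smul_sub]
  rw [integral_sub (integrable_smul_of_test hθ' hc.deriv hfi)
    (integrable_smul_of_test hθ' hc.deriv hgi),
    integral_sub (integrable_smul_of_test hθ.continuous hc hdfi)
    (integrable_smul_of_test hθ.continuous hc hdgi), hf θ hθ hc hs, hg θ hθ hc hs]
  abel

theorem IsW.integrableOn_gelfand (hw : IsW T J w dw) :
    IntegrableOn (fun t => gelfand J (w t)) (Ioo 0 T) :=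
  ((gelfand J).comp_memLp' hw.memLp).integrable (by norm_num)

theorem IsW.integrableOn_deriv (hw : IsW T J w dw) : IntegrableOn dw (Ioo 0 T) :=
  hw.memLp_deriv.integrable (by norm_num)

theorem IsW.sub (hw : IsW T J w dw) (hz : IsW T J z dz) :
    IsW T J (fun t => w t - z t) (fun t => dw t - dz t) := by
  refine ⟨hw.memLp.sub hz.memLp, hw.memLp_deriv.sub hz.memLp_deriv, ?_⟩
  have := hw.weak_deriv.sub hz.weak_deriv hw.integrableOn_gelfand hz.integrableOn_gelfand
    hw.integrableOn_deriv hz.integrableOn_deriv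
  simpa only [← map_sub] using this

theorem eqOn_zero_of_le_integral {g : ℝ → ℝ} {K : ℝ} (hT : 0 < T)
    (hg : ContinuousOn g (Icc 0 T)) (h0 : ∀ t ∈ Icc 0 T, 0 ≤ g t)
    (h : ∀ t ∈ Icc 0 T, g t ≤ K * ∫ s in (0 : ℝ)..t, g s) : EqOn g 0 (Icc 0 T) := by
  -- Extending `g` by its end values makes the primitive differentiable everywhere, so that
  -- Gronwall's lemma applies to it.
  let g' : ℝ → ℝ := IccExtend hT.le ((Icc 0 T).domRestrict g)
  have hg' : Continuous g' := (continuousOn_iff_continuous_domRestrict.1 hg).Icc_extend'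
  have heq : ∀ t ∈ Icc 0 T, g' t = g t := fun t ht => IccExtend_of_mem hT.le _ ht
  have hint : ∀ t ∈ Icc 0 T, ∫ s in (0 : ℝ)..t, g' s = ∫ s in (0 : ℝ)..t, g s := fun t ht =>
    intervalIntegral.integral_congr fun s hs => by
      rw [uIcc_of_le ht.1] at hs
      exact heq s ⟨hs.1, hs.2.trans ht.2⟩
  have hder : ∀ t, HasDerivAt (fun t => ∫ s in (0 : ℝ)..t, g' s) (g' t) t := fun t =>
    intervalIntegral.integral_hasDerivAt_right (hg'.intervalIntegrable _ _)
      hg'.aestronglyMeasurable.stronglyMeasurableAtFilter hg'.continuousAt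
  have hnn : ∀ t ∈ Icc 0 T, 0 ≤ ∫ s in (0 : ℝ)..t, g' s := fun t ht =>
    intervalIntegral.integral_nonneg ht.1 fun s hs => by
      have hs' : s ∈ Icc 0 T := ⟨hs.1, hs.2.trans ht.2⟩
      rw [heq s hs']; exact h0 s hs'
  have key := norm_le_gronwallBound_of_norm_deriv_right_le (δ := 0) (K := K) (ε := 0) (a := 0)
    (b := T) (f := fun t => ∫ s in (0 : ℝ)..t, g' s) (f' := g')
    (fun t _ => (hder t).continuousAt.continuousWithinAt)
    (fun t _ => (hder t).hasDerivWithinAt) (by simp) (fun t ht => by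
      have ht' := Ico_subset_Icc_self ht
      rw [heq t ht', Real.norm_of_nonneg (h0 t ht'), Real.norm_of_nonneg (hnn t ht'), hint t ht',
        add_zero]
      exact h t ht')
  intro t ht
  have h1 := key t ht
  rw [gronwallBound_ε0_δ0, norm_le_zero_iff, hint t ht] at h1
  have h2 := h t ht
  rw [h1, mul_zero] at h2
  exact le_antisymm h2 (h0 t ht)

/-- Uniqueness for the homogeneous problem. -/
theorem IsW.eqOn_zero (hw : IsW T J w dw) (hT : 0 < T) (G : V →L[ℝ] G') {P : ℝ → H →L[ℝ] H}
    {M : ℝ} (hM : ∀ t, ‖P t‖ ≤ M) {y : ℝ → H} (hy : ContinuousOn y (Icc 0 T))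
    (hyw : ∀ᵐ t ∂volume.restrict (Ioo 0 T), y t = J (w t)) (hy0 : y 0 = 0)
    (heq : ∀ᵐ t ∂volume.restrict (Ioo 0 T), ∀ v,
      dw t v = - inner ℝ (G (w t)) (G v) + inner ℝ (P t (J (w t))) (J v)) :
    EqOn y 0 (Icc 0 T) := by
  -- Energy identity: ‖y(t)‖² is twice the integral of ⟨dw, w⟩. The `G` term has a favourable sign
  -- and `P` costs at most `M`, whence the Gronwall constant `2 * M`.
  have hE := hw.inner_sub_inner hw hT hy hyw hy hyw
  have hg : ContinuousOn (fun t => ‖y t‖ ^ 2) (Icc 0 T) := hy.norm.pow 2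
  have key := eqOn_zero_of_le_integral (K := 2 * M) hT hg (fun t _ => sq_nonneg _) (by
    intro t ht
    have h1 := hE t ht
    rw [hy0, inner_zero_left, sub_zero, real_inner_self_eq_norm_sq] at h1
    rw [h1, ← intervalIntegral.integral_const_mul, intervalIntegral.integral_of_le ht.1,
      intervalIntegral.integral_of_le ht.1, integral_Ioc_eq_integral_Ioo,
      integral_Ioc_eq_integral_Ioo]
    have hsub : Ioo 0 t ⊆ Ioo 0 T := Ioo_subset_Ioo_right ht.2
    refine integral_mono_ae
      (((hw.integrableOn_pairing hw).add (hw.integrableOn_pairing hw)).mono_set hsub)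
      (((hg.mono (Icc_subset_Icc_right ht.2)).integrableOn_Icc.mono_set Ioo_subset_Icc_self).const_mul
        (2 * M)) ?_
    filter_upwards [ae_restrict_of_ae_restrict_of_subset hsub hyw,
      ae_restrict_of_ae_restrict_of_subset hsub heq] with s h2 h3
    rw [h3, h2, real_inner_self_eq_norm_sq]
    have h4 : inner ℝ (P s (J (w s))) (J (w s)) ≤ M * ‖J (w s)‖ ^ 2 := by
      calc inner ℝ (P s (J (w s))) (J (w s)) ≤ ‖P s (J (w s))‖ * ‖J (w s)‖ :=
            real_inner_le_norm _ _
        _ ≤ (M * ‖J (w s)‖) * ‖J (w s)‖ := by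
            gcongr; exact (P s).le_of_opNorm_le (hM s) _
        _ = M * ‖J (w s)‖ ^ 2 := by ring
    nlinarith [sq_nonneg ‖G (w s)‖])
  intro t ht
  have := key ht
  simpa using this

/-- The family `P` is only weakly measurable. Passing to the adjoint separates the two dependences
on t: `adjoint (P t) k` is measurable for fixed k, and its inner product with `x t` is then one of
two measurable functions. -/
theorem aestronglyMeasurable_operator_apply {τ H₁ H₂ : Type*} [MeasurableSpace τ]
    [NormedAddCommGroup H₁] [InnerProductSpace ℝ H₁] [CompleteSpace H₁]
    [TopologicalSpace.SeparableSpace H₁] [NormedAddCommGroup H₂] [InnerProductSpace ℝ H₂]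
    [CompleteSpace H₂] [TopologicalSpace.SeparableSpace H₂] {P : τ → H₁ →L[ℝ] H₂} {μ : Measure τ}
    (hP : ∀ h k, AEStronglyMeasurable (fun t => (inner ℝ k (P t h) : ℝ)) μ) {x : τ → H₁}
    (hx : AEStronglyMeasurable x μ) : AEStronglyMeasurable (fun t => P t (x t)) μ := by
  refine aestronglyMeasurable_of_inner fun k => ?_
  have hinner : (fun t => (inner ℝ k (P t (x t)) : ℝ))
      = fun t => (inner ℝ (adjoint (P t) k) (x t) : ℝ) :=
    funext fun t => (adjoint_inner_left (P t) (x t) k).symm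
  rw [hinner]
  have h1 : AEStronglyMeasurable (fun t => adjoint (P t) k) μ :=
    aestronglyMeasurable_of_inner fun h => by
      have : (fun t => (inner ℝ h (adjoint (P t) k) : ℝ)) = fun t => (inner ℝ k (P t h) : ℝ) :=
        funext fun t => (adjoint_inner_right (P t) h k).trans (real_inner_comm _ _)
      rw [this]
      exact hP h k
  exact h1.inner hx

theorem aestronglyMeasurable_adjoint_apply [CompleteSpace H] [TopologicalSpace.SeparableSpace H]
    {P : ℝ → H →L[ℝ] H} {μ : Measure ℝ}
    (hP : ∀ h k, AEStronglyMeasurable (fun t => (inner ℝ k (P t h) : ℝ)) μ) {x : ℝ → H}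
    (hx : AEStronglyMeasurable x μ) : AEStronglyMeasurable (fun t => adjoint (P t) (x t)) μ :=
  aestronglyMeasurable_operator_apply (P := fun t => adjoint (P t)) (fun h k => by
    have : (fun t => (inner ℝ k (adjoint (P t) h) : ℝ)) = fun t => (inner ℝ h (P t k) : ℝ) :=
      funext fun t => (adjoint_inner_right (P t) k h).trans (real_inner_comm _ _)
    rw [this]
    exact hP k h) hx

theorem memLp_operator_apply {τ H₁ H₂ : Type*} [MeasurableSpace τ]
    [NormedAddCommGroup H₁] [NormedSpace ℝ H₁] [NormedAddCommGroup H₂] [NormedSpace ℝ H₂]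
    {P : τ → H₁ →L[ℝ] H₂} {μ : Measure τ} {M : ℝ} (hM : ∀ t, ‖P t‖ ≤ M)
    {x : τ → H₁} (hx : MemLp x 2 μ) (hm : AEStronglyMeasurable (fun t => P t (x t)) μ) :
    MemLp (fun t => P t (x t)) 2 μ :=
  hx.of_le_mul hm (Eventually.of_forall fun t => (P t).le_of_opNorm_le (hM t) _)

theorem Continuous.memLp_Ioo {X : Type*} [NormedAddCommGroup X] {f : ℝ → X} (hf : Continuous f)
    (a b : ℝ) : MemLp f 2 (volume.restrict (Ioo a b)) := by
  obtain ⟨C, hC⟩ := isCompact_Icc.exists_bound_of_continuousOn (hf.continuousOn (s := Icc a b))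
  refine MemLp.of_bound hf.aestronglyMeasurable C ?_
  filter_upwards [ae_restrict_mem measurableSet_Ioo] with t ht using hC t (Ioo_subset_Icc_self ht)

/-- A scalar `C¹` function times a constant vector has the expected weak derivative. -/
theorem hasWeakTimeDeriv_smul_const {X : Type*} [NormedAddCommGroup X] [NormedSpace ℝ X]
    [CompleteSpace X] (hT : 0 < T) {a : ℝ → ℝ} (ha : ContDiff ℝ 1 a) (x : X) :
    HasWeakTimeDeriv T (fun t => a t • x) (fun t => deriv a t • x) := by
  intro θ hθ hc hs
  have h0 : ∀ t, t ∉ Ioo 0 T → θ t = 0 := fun t ht =>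
    image_eq_zero_of_notMem_tsupport fun h => ht (hs h)
  have hθ' : Continuous (deriv θ) := hθ.continuous_deriv (by simp)
  have ha' : Continuous (deriv a) := ha.continuous_deriv (by simp)
  simp only [smul_smul]
  rw [integral_smul_const, integral_smul_const, ← neg_smul]
  congr 1
  rw [← integral_Ioc_eq_integral_Ioo, ← integral_Ioc_eq_integral_Ioo,
    ← intervalIntegral.integral_of_le hT.le, ← intervalIntegral.integral_of_le hT.le,
    intervalIntegral.integral_mul_deriv_eq_deriv_mul (u := θ) (v := a)
      (fun t _ => (hθ.differentiable (by simp) t).hasDerivAt)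
      (fun t _ => (ha.differentiable (by simp) t).hasDerivAt)
      (hθ'.intervalIntegrable _ _) (ha'.intervalIntegrable _ _)]
  rw [h0 0 (by simp), h0 T (by simp)]
  simp

theorem isW_smul_const (J : V →L[ℝ] H) (hT : 0 < T) {a : ℝ → ℝ} (ha : ContDiff ℝ 1 a) (v : V) :
    IsW T J (fun t => a t • v) (fun t => deriv a t • gelfand J v) := by
  have ha' : Continuous (deriv a) := ha.continuous_deriv (by simp)
  refine ⟨(ha.continuous.smul continuous_const).memLp_Ioo 0 T,
    (ha'.smul continuous_const).memLp_Ioo 0 T, ?_⟩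
  simpa only [map_smul] using hasWeakTimeDeriv_smul_const hT ha (gelfand J v)

end abstractProblem

/-! ### A priori estimates for the formal adjoint -/

section existence
open Filter Topology ContinuousLinearMap

variable {V H G' : Type*} [NormedAddCommGroup V] [InnerProductSpace ℝ V] [CompleteSpace V]
  [NormedAddCommGroup H] [InnerProductSpace ℝ H] [CompleteSpace H]
  [NormedAddCommGroup G'] [InnerProductSpace ℝ G'] [CompleteSpace G']
  {T : ℝ} {J : V →L[ℝ] H} {G : V →L[ℝ] G'} {P : ℝ → H →L[ℝ] H} {M : ℝ}

/-- The `C¹` functions with values in `V` which vanish at time `T`. -/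
def finalZeroTest (V : Type*) [NormedAddCommGroup V] [NormedSpace ℝ V] (T : ℝ) :
    Submodule ℝ (ℝ → V) where
  carrier := {ψ | ContDiff ℝ 1 ψ ∧ ψ T = 0}
  add_mem' := fun ha hb => ⟨ha.1.add hb.1, by simp [ha.2, hb.2]⟩
  zero_mem' := ⟨contDiff_const, rfl⟩
  smul_mem' := fun c _ ha => ⟨contDiff_const.smul ha.1, by simp [ha.2]⟩

/-- The formal adjoint of `∂ₜ + G*G - P` applied to a test function, seen in `V`. -/
noncomputable def formalAdjoint (J : V →L[ℝ] H) (G : V →L[ℝ] G') (P : ℝ → H →L[ℝ] H) (ψ : ℝ → V)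
    (t : ℝ) : V :=
  adjoint G (G (ψ t)) - adjoint J (J (deriv ψ t)) - adjoint J (adjoint (P t) (J (ψ t)))

theorem inner_formalAdjoint (ψ : ℝ → V) (t : ℝ) (v : V) :
    inner ℝ v (formalAdjoint J G P ψ t) = inner ℝ (G v) (G (ψ t)) - inner ℝ (J v) (J (deriv ψ t))
      - inner ℝ (P t (J v)) (J (ψ t)) := by
  simp only [formalAdjoint, inner_sub_right, adjoint_inner_right]

theorem memLp_formalAdjoint [TopologicalSpace.SeparableSpace H] (hM : ∀ t, ‖P t‖ ≤ M)
    (hP : ∀ h k, AEStronglyMeasurable (fun t => (inner ℝ k (P t h) : ℝ))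
      (volume.restrict (Ioo 0 T))) {ψ : ℝ → V} (hψ : ContDiff ℝ 1 ψ) :
    MemLp (formalAdjoint J G P ψ) 2 (volume.restrict (Ioo 0 T)) := by
  have h1 : MemLp ψ 2 (volume.restrict (Ioo 0 T)) := hψ.continuous.memLp_Ioo 0 T
  have h2 : MemLp (deriv ψ) 2 (volume.restrict (Ioo 0 T)) :=
    (hψ.continuous_deriv (by simp)).memLp_Ioo 0 T
  have h3 : MemLp (fun t => J (ψ t)) 2 (volume.restrict (Ioo 0 T)) := J.comp_memLp' h1
  have h4 : MemLp (fun t => adjoint (P t) (J (ψ t))) 2 (volume.restrict (Ioo 0 T)) :=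
    memLp_operator_apply (P := fun t => adjoint (P t)) (M := M)
      (fun t => by rw [LinearIsometryEquiv.norm_map]; exact hM t) h3
      (aestronglyMeasurable_adjoint_apply hP h3.aestronglyMeasurable)
  exact (((adjoint G ∘L G).comp_memLp' h1).sub ((adjoint J ∘L J).comp_memLp' h2)).sub
    ((adjoint J).comp_memLp' h4)

/-- With the weight n(t) = exp(2(M+1)t), integration by parts of the time derivative gives ‖J
ψ(0)‖²/2, as `ψ` vanishes at T, plus (M+1) ∫ n ‖J ψ‖². Of this, M absorbs the operator `P`, and 1
supplies the part ‖J ψ‖² of ‖ψ‖² that `G` does not control. The weight is at least 1, so it can be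
dropped from the lower bound. -/
theorem formalAdjoint_coercive (hT : 0 < T) (hV : ∀ v, ‖v‖ ^ 2 = ‖J v‖ ^ 2 + ‖G v‖ ^ 2)
    (hM0 : 0 ≤ M) (hM : ∀ t, ‖P t‖ ≤ M) {ψ : ℝ → V} (hψ : ContDiff ℝ 1 ψ) (hψT : ψ T = 0)
    (hi : IntegrableOn (fun t => (inner ℝ (Real.exp (2 * (M + 1) * t) • ψ t)
      (formalAdjoint J G P ψ t) : ℝ)) (Ioo 0 T)) :
    ‖J (ψ 0)‖ ^ 2 / 2 + ∫ t in Ioo 0 T, ‖ψ t‖ ^ 2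
      ≤ ∫ t in Ioo 0 T, (inner ℝ (Real.exp (2 * (M + 1) * t) • ψ t)
        (formalAdjoint J G P ψ t) : ℝ) := by
  set n : ℝ → ℝ := fun t => Real.exp (2 * (M + 1) * t) with hn
  have hψ' : Continuous (deriv ψ) := hψ.continuous_deriv (by simp)
  have hψc := hψ.continuous
  have hnc : Continuous n := by fun_prop
  let q' : ℝ → ℝ := fun t => 2 * (M + 1) * n t * ‖J (ψ t)‖ ^ 2
    + n t * (2 * inner ℝ (J (ψ t)) (J (deriv ψ t)))
  have hq'c : Continuous q' := by fun_prop
  have hder : ∀ t, HasDerivAt (fun t => n t * ‖J (ψ t)‖ ^ 2) (q' t) t := by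
    intro t
    have h1 : HasDerivAt n (2 * (M + 1) * n t) t := by
      have : HasDerivAt (fun t : ℝ => 2 * (M + 1) * t) (2 * (M + 1)) t := by
        simpa using (hasDerivAt_id t).const_mul (2 * (M + 1))
      simpa [hn, mul_comm] using this.exp
    have h2 : HasDerivAt (fun t => J (ψ t)) (J (deriv ψ t)) t :=
      J.hasFDerivAt.comp_hasDerivAt t (hψ.differentiable (by simp) t).hasDerivAt
    exact h1.mul h2.norm_sq
  have hint : ∫ t in Ioo 0 T, q' t = -‖J (ψ 0)‖ ^ 2 := by
    rw [← integral_Ioc_eq_integral_Ioo, ← intervalIntegral.integral_of_le hT.le,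
      intervalIntegral.integral_eq_sub_of_hasDerivAt (fun t _ => hder t)
        (hq'c.intervalIntegrable _ _), hψT]
    simp [hn]
  have hq'i : IntegrableOn q' (Ioo 0 T) :=
    hq'c.continuousOn.integrableOn_Icc.mono_set Ioo_subset_Icc_self
  have hψi : IntegrableOn (fun t => ‖ψ t‖ ^ 2) (Ioo 0 T) :=
    (hψc.norm.pow 2).continuousOn.integrableOn_Icc.mono_set Ioo_subset_Icc_self
  have hle : ∫ t in Ioo 0 T, (‖ψ t‖ ^ 2 - q' t / 2)
      ≤ ∫ t in Ioo 0 T, (inner ℝ (n t • ψ t) (formalAdjoint J G P ψ t) : ℝ) := by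
    refine setIntegral_mono_on (hψi.sub (hq'i.div_const 2)) hi measurableSet_Ioo fun t ht => ?_
    have h1 : 1 ≤ n t := Real.one_le_exp (by have := ht.1; positivity)
    have h4 : inner ℝ (P t (J (ψ t))) (J (ψ t)) ≤ M * ‖J (ψ t)‖ ^ 2 := by
      calc inner ℝ (P t (J (ψ t))) (J (ψ t)) ≤ ‖P t (J (ψ t))‖ * ‖J (ψ t)‖ :=
            real_inner_le_norm _ _
        _ ≤ (M * ‖J (ψ t)‖) * ‖J (ψ t)‖ := by
            gcongr; exact (P t).le_of_opNorm_le (hM t) _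
        _ = M * ‖J (ψ t)‖ ^ 2 := by ring
    rw [real_inner_smul_left, inner_formalAdjoint, real_inner_self_eq_norm_sq]
    have h5 : ‖ψ t‖ ^ 2 ≤ n t * ‖ψ t‖ ^ 2 := le_mul_of_one_le_left (sq_nonneg _) h1
    have h6 : n t * inner ℝ (P t (J (ψ t))) (J (ψ t)) ≤ n t * (M * ‖J (ψ t)‖ ^ 2) := by gcongr
    rw [hV] at h5 ⊢
    simp only [q']
    nlinarith
  rw [integral_sub hψi (hq'i.div_const 2), integral_div, hint] at hle
  linarith

theorem norm_toLp_sq {α X : Type*} [MeasurableSpace α] {μ : Measure α} [NormedAddCommGroup X]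
    [InnerProductSpace ℝ X] {f : α → X} (hf : MemLp f 2 μ) :
    ‖hf.toLp f‖ ^ 2 = ∫ t, ‖f t‖ ^ 2 ∂μ := by
  rw [← real_inner_self_eq_norm_sq, L2.inner_def]
  refine integral_congr_ae ?_
  filter_upwards [hf.coeFn_toLp] with t ht
  rw [ht, real_inner_self_eq_norm_sq]

theorem inner_toLp_toLp {α X : Type*} [MeasurableSpace α] {μ : Measure α} [NormedAddCommGroup X]
    [InnerProductSpace ℝ X] {f g : α → X} (hf : MemLp f 2 μ) (hg : MemLp g 2 μ) :
    inner ℝ (hf.toLp f) (hg.toLp g) = ∫ t, (inner ℝ (f t) (g t) : ℝ) ∂μ := by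
  rw [L2.inner_def]
  refine integral_congr_ae ?_
  filter_upwards [hf.coeFn_toLp, hg.coeFn_toLp] with t ht ht'
  rw [ht, ht']

theorem integrable_inner_of_memLp {α X : Type*} [MeasurableSpace α] {μ : Measure α}
    [NormedAddCommGroup X] [InnerProductSpace ℝ X] {f g : α → X} (hf : MemLp f 2 μ)
    (hg : MemLp g 2 μ) : Integrable (fun t => (inner ℝ (f t) (g t) : ℝ)) μ := by
  have := (innerSL ℝ (E := X)).memLp_of_bilin 1 hf hg
  rwa [memLp_one_iff_integrable] at this

/-- Cauchy–Schwarz in the coercivity estimate. These two bounds are what dominates the data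
functional, initial value included, by the norm of the formal adjoint. -/
theorem formalAdjoint_norm_bounds [TopologicalSpace.SeparableSpace H] (hT : 0 < T)
    (hV : ∀ v, ‖v‖ ^ 2 = ‖J v‖ ^ 2 + ‖G v‖ ^ 2) (hM0 : 0 ≤ M) (hM : ∀ t, ‖P t‖ ≤ M)
    (hP : ∀ h k, AEStronglyMeasurable (fun t => (inner ℝ k (P t h) : ℝ))
      (volume.restrict (Ioo 0 T))) :
    ∃ C, 0 ≤ C ∧ ∀ (ψ : ℝ → V) (hψ : ContDiff ℝ 1 ψ), ψ T = 0 →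
      ‖(hψ.continuous.memLp_Ioo 0 T).toLp ψ‖
        ≤ C * ‖(memLp_formalAdjoint (J := J) (G := G) hM hP hψ).toLp _‖ ∧
      ‖J (ψ 0)‖ ≤ C * ‖(memLp_formalAdjoint (J := J) (G := G) hM hP hψ).toLp _‖ := by
  set N := Real.exp (2 * (M + 1) * T)
  have hN : 1 ≤ N := Real.one_le_exp (by positivity)
  -- The estimate gives `‖Ψ‖ ≤ N * ‖K‖` and then `‖J (ψ 0)‖ ^ 2 ≤ 2 * (N * ‖K‖) ^ 2`; the constant
  -- `2 * N` serves both.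
  refine ⟨2 * N, by positivity, fun ψ hψ hψT => ?_⟩
  set Ψ := (hψ.continuous.memLp_Ioo 0 T).toLp ψ
  set K := (memLp_formalAdjoint (J := J) (G := G) hM hP hψ).toLp _
  have hnc : Continuous fun t => Real.exp (2 * (M + 1) * t) • ψ t := by
    have := hψ.continuous
    fun_prop
  have hn := hnc.memLp_Ioo 0 T
  have h1 := formalAdjoint_coercive hT hV hM0 hM hψ hψT
    (integrable_inner_of_memLp hn (memLp_formalAdjoint (J := J) (G := G) hM hP hψ))
  rw [← inner_toLp_toLp hn (memLp_formalAdjoint (J := J) (G := G) hM hP hψ),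
    ← norm_toLp_sq (hψ.continuous.memLp_Ioo 0 T)] at h1
  change ‖J (ψ 0)‖ ^ 2 / 2 + ‖Ψ‖ ^ 2 ≤ inner ℝ (hn.toLp _) K at h1
  have h2 : ‖hn.toLp _‖ ≤ N * ‖Ψ‖ := by
    refine Lp.norm_le_mul_norm_of_ae_le_mul ?_
    filter_upwards [hn.coeFn_toLp, (hψ.continuous.memLp_Ioo 0 T).coeFn_toLp,
      ae_restrict_mem measurableSet_Ioo] with t ht ht' htm
    rw [ht, ht', norm_smul, Real.norm_of_nonneg (Real.exp_pos _).le]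
    have h3 : Real.exp (2 * (M + 1) * t) ≤ N := Real.exp_le_exp.2 (by
      have := htm.2.le; gcongr)
    gcongr
  have h3 : inner ℝ (hn.toLp _) K ≤ N * ‖Ψ‖ * ‖K‖ :=
    (real_inner_le_norm _ _).trans (by gcongr)
  have hΨ := norm_nonneg Ψ
  have hK := norm_nonneg K
  have h4 : ‖Ψ‖ ≤ N * ‖K‖ := by
    rcases hΨ.eq_or_lt with h | h
    · rw [← h]; positivity
    · refine le_of_mul_le_mul_right ?_ h
      nlinarith [sq_nonneg ‖J (ψ 0)‖]
  refine ⟨h4.trans (by nlinarith [mul_nonneg (zero_le_one.trans hN) hK]), ?_⟩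
  refine le_of_sq_le_sq ?_ (by positivity)
  have h5 : N * ‖Ψ‖ * ‖K‖ ≤ N * (N * ‖K‖) * ‖K‖ := by gcongr
  nlinarith [sq_nonneg ‖Ψ‖, sq_nonneg (N * ‖K‖)]

end existence

/-! ### Existence of solutions by the projection method -/

section existence
open Filter Topology ContinuousLinearMap

variable {V H G' : Type*} [NormedAddCommGroup V] [InnerProductSpace ℝ V] [CompleteSpace V]
  [NormedAddCommGroup H] [InnerProductSpace ℝ H] [CompleteSpace H]
  [NormedAddCommGroup G'] [InnerProductSpace ℝ G'] [CompleteSpace G']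
  {T : ℝ} {J : V →L[ℝ] H} {G : V →L[ℝ] G'} {P : ℝ → H →L[ℝ] H} {M : ℝ}

/-- Lions' projection method: the right side is a functional of `ψ` dominated by the L² norm of the
formal adjoint of `ψ`, hence is represented through it by some `w`. Neither Galerkin approximation
nor compactness enters. -/
theorem exists_variational_solution [TopologicalSpace.SeparableSpace H] (hT : 0 < T)
    (hV : ∀ v, ‖v‖ ^ 2 = ‖J v‖ ^ 2 + ‖G v‖ ^ 2) (hM0 : 0 ≤ M) (hM : ∀ t, ‖P t‖ ≤ M)
    (hP : ∀ h k, AEStronglyMeasurable (fun t => (inner ℝ k (P t h) : ℝ))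
      (volume.restrict (Ioo 0 T))) {f : ℝ → H} (hf : MemLp f 2 (volume.restrict (Ioo 0 T)))
    (y₀ : H) :
    ∃ w : ℝ → V, MemLp w 2 (volume.restrict (Ioo 0 T)) ∧
      ∀ ψ : ℝ → V, ContDiff ℝ 1 ψ → ψ T = 0 →
        ∫ t in Ioo 0 T, (inner ℝ (w t) (formalAdjoint J G P ψ t) : ℝ)
          = inner ℝ y₀ (J (ψ 0)) + ∫ t in Ioo 0 T, (inner ℝ (f t) (J (ψ t)) : ℝ) := by
  obtain ⟨C, hC0, hC⟩ := formalAdjoint_norm_bounds (J := J) (G := G) hT hV hM0 hM hP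
  have hK : ∀ ψ : finalZeroTest V T,
      MemLp (formalAdjoint J G P ψ.1) 2 (volume.restrict (Ioo 0 T)) :=
    fun ψ => memLp_formalAdjoint hM hP ψ.2.1
  have hJm : ∀ ψ : finalZeroTest V T, MemLp (fun t => J (ψ.1 t)) 2 (volume.restrict (Ioo 0 T)) :=
    fun ψ => J.comp_memLp' (ψ.2.1.continuous.memLp_Ioo 0 T)
  have hd : ∀ ψ : finalZeroTest V T, Differentiable ℝ ψ.1 := fun ψ => ψ.2.1.differentiable (by simp)
  let K : finalZeroTest V T →ₗ[ℝ] Lp V 2 (volume.restrict (Ioo 0 T)) :=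
    { toFun := fun ψ => (hK ψ).toLp _
      map_add' := fun a b => by
        rw [← MemLp.toLp_add]
        congr 1
        ext t
        have : deriv (a.1 + b.1) t = deriv a.1 t + deriv b.1 t := deriv_add (hd a t) (hd b t)
        simp only [formalAdjoint, Submodule.coe_add, this, Pi.add_apply, map_add]
        abel
      map_smul' := fun c a => by
        rw [RingHom.id_apply, ← MemLp.toLp_const_smul]
        congr 1
        ext t
        have : deriv (c • a.1) t = c • deriv a.1 t := deriv_const_smul c (hd a t)
        simp only [formalAdjoint, Submodule.coe_smul, this, Pi.smul_apply, map_smul, smul_sub] }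
  let l : finalZeroTest V T →ₗ[ℝ] ℝ :=
    { toFun := fun ψ => inner ℝ y₀ (J (ψ.1 0)) + inner ℝ (hf.toLp f) ((hJm ψ).toLp _)
      map_add' := fun a b => by
        have : (hJm (a + b)).toLp _ = (hJm a).toLp _ + (hJm b).toLp _ := by
          rw [← MemLp.toLp_add]
          congr 1
          ext t
          simp
        rw [this, inner_add_right]
        simp only [Submodule.coe_add, Pi.add_apply, map_add, inner_add_right]
        ring
      map_smul' := fun c a => by
        have : (hJm (c • a)).toLp _ = c • (hJm a).toLp _ := by
          rw [← MemLp.toLp_const_smul]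
          congr 1
          ext t
          simp
        rw [this, inner_smul_right]
        simp only [Submodule.coe_smul, Pi.smul_apply, map_smul, inner_smul_right, RingHom.id_apply,
          smul_eq_mul]
        ring }
  obtain ⟨w, hw⟩ := exists_inner_eq_of_le_norm K l (‖y₀‖ * C + ‖hf.toLp f‖ * (‖J‖ * C)) (by
    intro ψ
    obtain ⟨h1, h2⟩ := hC ψ.1 ψ.2.1 ψ.2.2
    change ‖(ψ.2.1.continuous.memLp_Ioo 0 T).toLp ψ.1‖ ≤ C * ‖K ψ‖ at h1
    change ‖J (ψ.1 0)‖ ≤ C * ‖K ψ‖ at h2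
    have h3 : ‖(hJm ψ).toLp _‖ ≤ ‖J‖ * ‖(ψ.2.1.continuous.memLp_Ioo 0 T).toLp ψ.1‖ := by
      refine Lp.norm_le_mul_norm_of_ae_le_mul ?_
      filter_upwards [(hJm ψ).coeFn_toLp, (ψ.2.1.continuous.memLp_Ioo 0 T).coeFn_toLp]
        with t ht ht'
      rw [ht, ht']
      exact J.le_opNorm _
    calc |l ψ| ≤ |inner ℝ y₀ (J (ψ.1 0))| + |inner ℝ (hf.toLp f) ((hJm ψ).toLp _)| :=
          abs_add_le _ _
      _ ≤ ‖y₀‖ * ‖J (ψ.1 0)‖ + ‖hf.toLp f‖ * ‖(hJm ψ).toLp _‖ :=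
          add_le_add (abs_real_inner_le_norm _ _) (abs_real_inner_le_norm _ _)
      _ ≤ ‖y₀‖ * (C * ‖K ψ‖) + ‖hf.toLp f‖ * (‖J‖ * (C * ‖K ψ‖)) := by
          gcongr
          exact h3.trans (by gcongr)
      _ = _ := by ring)
  refine ⟨w, Lp.memLp w, fun ψ hψ hψT => ?_⟩
  have h1 := hw ⟨ψ, hψ, hψT⟩
  have h2 : inner ℝ (hf.toLp f) ((hJm ⟨ψ, hψ, hψT⟩).toLp _)
      = ∫ t in Ioo 0 T, (inner ℝ (f t) (J (ψ t)) : ℝ) := inner_toLp_toLp _ _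
  have h3 : inner ℝ w (K ⟨ψ, hψ, hψT⟩)
      = ∫ t in Ioo 0 T, (inner ℝ (w t) (formalAdjoint J G P ψ t) : ℝ) := by
    rw [L2.inner_def]
    refine integral_congr_ae ?_
    filter_upwards [(hK ⟨ψ, hψ, hψT⟩).coeFn_toLp] with t ht
    exact congrArg _ ht
  rw [← h3, h1, ← h2]
  rfl

theorem integrableOn_add_of_normed {X : Type*} [NormedAddCommGroup X] {f g : ℝ → X} {s : Set ℝ}
    (hf : IntegrableOn f s) (hg : IntegrableOn g s) : IntegrableOn (fun t => f t + g t) s :=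
  Integrable.add hf hg

/-- Existence of a solution of `∂ₜ w = -G*G w + P w + f`, `w(0) = y₀`. -/
theorem exists_isW_solution [TopologicalSpace.SeparableSpace H] (hT : 0 < T)
    (hV : ∀ v, ‖v‖ ^ 2 = ‖J v‖ ^ 2 + ‖G v‖ ^ 2) (hJ : ∀ h : H, (∀ v, inner ℝ h (J v) = (0 : ℝ)) → h = 0)
    (hM0 : 0 ≤ M) (hM : ∀ t, ‖P t‖ ≤ M)
    (hP : ∀ h k, AEStronglyMeasurable (fun t => (inner ℝ k (P t h) : ℝ))
      (volume.restrict (Ioo 0 T))) {f : ℝ → H} (hf : MemLp f 2 (volume.restrict (Ioo 0 T)))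
    (y₀ : H) :
    ∃ (w : ℝ → V) (dw : ℝ → StrongDual ℝ V) (y : ℝ → H), IsW T J w dw ∧
      ContinuousOn y (Icc 0 T) ∧ (∀ᵐ t ∂volume.restrict (Ioo 0 T), y t = J (w t)) ∧ y 0 = y₀ ∧
      ∀ t v, dw t v = - inner ℝ (G (w t)) (G v) + inner ℝ (P t (J (w t))) (J v)
        + inner ℝ (f t) (J v) := by
  obtain ⟨w, hw, hvar⟩ := exists_variational_solution (J := J) (G := G) hT hV hM0 hM hP hf y₀
  have hJw : MemLp (fun t => J (w t)) 2 (volume.restrict (Ioo 0 T)) := J.comp_memLp' hw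
  have hPw : MemLp (fun t => P t (J (w t))) 2 (volume.restrict (Ioo 0 T)) :=
    memLp_operator_apply hM hJw (aestronglyMeasurable_operator_apply hP hJw.aestronglyMeasurable)
  -- The time derivative is defined by the equation itself, so the equation holds at every t; what
  -- remains to be shown is that it is the weak derivative.
  let dw : ℝ → StrongDual ℝ V := fun t =>
    ((compL ℝ V H ℝ).flip J).comp (innerSL ℝ) (P t (J (w t)) + f t) - gelfand G (w t)
  have hdw : ∀ t v, dw t v = - inner ℝ (G (w t)) (G v) + inner ℝ (P t (J (w t))) (J v)
      + inner ℝ (f t) (J v) := by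
    intro t v
    have : dw t v = inner ℝ (P t (J (w t)) + f t) (J v) - inner ℝ (G (w t)) (G v) := rfl
    rw [this, inner_add_left]
    ring
  have hdwm : MemLp dw 2 (volume.restrict (Ioo 0 T)) :=
    ((((compL ℝ V H ℝ).flip J).comp (innerSL ℝ)).comp_memLp' (hPw.add hf)).sub
      ((gelfand G).comp_memLp' hw)
  -- Tensor test functions `a(t) v`. Those with `a` compactly supported in `(0,T)` identify the weak
  -- derivative, and one with `a 0 = 1` will identify the initial value.
  have hvar' : ∀ (a : ℝ → ℝ) (v : V), ContDiff ℝ 1 a → a T = 0 →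
      ∫ t in Ioo 0 T, (deriv a t * inner ℝ (J (w t)) (J v) + a t * dw t v)
        = - (a 0 * inner ℝ y₀ (J v)) := by
    intro a v ha haT
    have hψ : ContDiff ℝ 1 fun t => a t • v := ha.smul contDiff_const
    have h1 := hvar (fun t => a t • v) hψ (by simp [haT])
    have i1 : IntegrableOn (fun t => (inner ℝ (w t)
        (formalAdjoint J G P (fun t => a t • v) t) : ℝ)) (Ioo 0 T) :=
      integrable_inner_of_memLp hw (memLp_formalAdjoint hM hP hψ)
    have i2 : IntegrableOn (fun t => (inner ℝ (f t) (J (a t • v)) : ℝ)) (Ioo 0 T) :=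
      integrable_inner_of_memLp hf (J.comp_memLp' (hψ.continuous.memLp_Ioo 0 T))
    have h2 : ∀ t, deriv a t * inner ℝ (J (w t)) (J v) + a t * dw t v
        = inner ℝ (f t) (J (a t • v))
          - inner ℝ (w t) (formalAdjoint J G P (fun t => a t • v) t) := by
      intro t
      have hd : deriv (fun t => a t • v) t = deriv a t • v :=
        deriv_smul_const (ha.differentiable (by simp) t) v
      rw [inner_formalAdjoint, hdw, hd]
      simp only [map_smul, inner_smul_right]
      ring
    simp only [h2]
    rw [integral_sub i2 i1, h1]
    simp only [map_smul, inner_smul_right]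
    ring
  have hW : IsW T J w dw := by
    refine ⟨hw, hdwm, ?_⟩
    intro θ hθ hc hs
    have hθ' : Continuous (deriv θ) := hθ.continuous_deriv (by simp)
    have h0 : ∀ t, t ∉ Ioo 0 T → θ t = 0 := fun t ht =>
      image_eq_zero_of_notMem_tsupport fun h => ht (hs h)
    have i1 : IntegrableOn (fun t => deriv θ t • gelfand J (w t)) (Ioo 0 T) :=
      integrable_smul_of_test hθ' hc.deriv (((gelfand J).comp_memLp' hw).integrable (by norm_num))
    have i2 : IntegrableOn (fun t => θ t • dw t) (Ioo 0 T) :=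
      integrable_smul_of_test hθ.continuous hc (hdwm.integrable (by norm_num))
    rw [eq_neg_iff_add_eq_zero, ← integral_add i1 i2]
    ext v
    have i3 : Integrable (fun t => deriv θ t • gelfand J (w t) + θ t • dw t)
        (volume.restrict (Ioo 0 T)) := integrableOn_add_of_normed i1 i2
    rw [ContinuousLinearMap.integral_apply i3]
    have := hvar' θ v (hθ.of_le (by simp)) (h0 T (by simp))
    rw [h0 0 (by simp), zero_mul, neg_zero] at this
    exact this
  obtain ⟨y, hy, hyw⟩ := hW.exists_continuousOn_rep hT
  refine ⟨w, dw, y, hW, hy, hyw, ?_, hdw⟩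
  rw [← sub_eq_zero]
  refine hJ _ fun v => ?_
  -- This `a` is 1 at time 0 and 0 at time T. The variational identity and the product rule applied
  -- to `a(t) v` have the same integral, so `y 0` and `y₀` agree against every `J v`; the range of
  -- `J` is dense by `hJ`.
  have ha : ContDiff ℝ 1 fun t : ℝ => 1 - t / T := by fun_prop
  have h1 := hvar' _ v ha (by field_simp; simp)
  have h2 := hW.inner_sub_inner (isW_smul_const J hT ha v) hT hy hyw
    (ζ := fun t => J ((1 - t / T) • v)) (by fun_prop) (ae_of_all _ fun _ => rfl) T
    (right_mem_Icc.2 hT.le)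
  rw [intervalIntegral.integral_of_le hT.le, integral_Ioc_eq_integral_Ioo] at h2
  have h3 : ∀ s, dw s ((1 - s / T) • v) + (deriv (fun t => 1 - t / T) s • gelfand J v) (w s)
      = deriv (fun t => 1 - t / T) s * inner ℝ (J (w s)) (J v) + (1 - s / T) * dw s v := by
    intro s
    rw [map_smul, smul_apply, gelfand_apply, real_inner_comm (J v)]
    simp only [smul_eq_mul]
    ring
  simp only [h3] at h2
  rw [h1] at h2
  simp only [div_self hT.ne', sub_self, zero_smul, map_zero, inner_zero_right, zero_div, sub_zero,
    one_smul, one_mul, zero_sub] at h2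
  rw [inner_sub_left]
  linarith

end existence

/-! ### Functions of two variables as L²-valued functions of time -/

section slices
open Filter Topology

variable {τ α : Type*} [MeasurableSpace τ] [MeasurableSpace α] {μ : Measure τ} {ν : Measure α}

open Classical in
/-- The function `g (t, ·)`, as an element of `L²`. -/
noncomputable def slice (ν : Measure α) (g : τ × α → ℝ) (t : τ) : Lp ℝ 2 ν :=
  if h : MemLp (fun x => g (t, x)) 2 ν then h.toLp _ else 0

theorem inner_L2_eq (f g : Lp ℝ 2 ν) : inner ℝ f g = ∫ x, f x * g x ∂ν := by
  rw [L2.inner_def]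
  refine integral_congr_ae (ae_of_all _ fun x => ?_)
  simp [mul_comm]

theorem norm_sq_L2_eq (f : Lp ℝ 2 ν) : ‖f‖ ^ 2 = ∫ x, f x ^ 2 ∂ν := by
  rw [← real_inner_self_eq_norm_sq, inner_L2_eq]
  simp only [sq]

instance secondCountableTopology_L2 [SFinite ν] [MeasurableSpace.CountablyGenerated α] :
    SecondCountableTopology (Lp ℝ 2 ν) :=
  have : Fact ((2 : ENNReal) ≠ ⊤) := ⟨by simp⟩
  inferInstance

variable [SFinite ν] {g : τ × α → ℝ}

theorem ae_memLp_slice [SFinite μ] (hg : MemLp g 2 (μ.prod ν)) :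
    ∀ᵐ t ∂μ, MemLp (fun x => g (t, x)) 2 ν := by
  have h1 := (memLp_two_iff_integrable_sq hg.aestronglyMeasurable).1 hg
  filter_upwards [h1.prod_right_ae, hg.aestronglyMeasurable.prodMk_left] with t h2 h3
  exact (memLp_two_iff_integrable_sq h3).2 h2

theorem slice_ae_eq [SFinite μ] (hg : MemLp g 2 (μ.prod ν)) :
    ∀ᵐ t ∂μ, slice ν g t =ᵐ[ν] fun x => g (t, x) := by
  filter_upwards [ae_memLp_slice hg] with t ht
  rw [slice, dif_pos ht]
  exact ht.coeFn_toLp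

theorem aestronglyMeasurable_slice [SFinite μ] [MeasurableSpace.CountablyGenerated α]
    (hg : MemLp g 2 (μ.prod ν)) : AEStronglyMeasurable (slice ν g) μ := by
  refine aestronglyMeasurable_of_inner fun k => ?_
  have h1 : AEStronglyMeasurable (fun z : τ × α => k z.2 * g z) (μ.prod ν) :=
    (Lp.aestronglyMeasurable k).comp_snd.mul hg.aestronglyMeasurable
  refine h1.integral_prod_right'.congr ?_
  filter_upwards [slice_ae_eq hg] with t ht
  rw [inner_L2_eq]
  refine integral_congr_ae ?_
  filter_upwards [ht] with x hx
  rw [hx]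

theorem memLp_slice [SFinite μ] [MeasurableSpace.CountablyGenerated α]
    (hg : MemLp g 2 (μ.prod ν)) : MemLp (slice ν g) 2 μ := by
  rw [memLp_two_iff_integrable_sq_norm (aestronglyMeasurable_slice hg)]
  have h1 := (memLp_two_iff_integrable_sq hg.aestronglyMeasurable).1 hg
  refine h1.integral_prod_left.congr ?_
  filter_upwards [slice_ae_eq hg] with t ht
  rw [norm_sq_L2_eq]
  refine integral_congr_ae ?_
  filter_upwards [ht] with x hx
  rw [hx]

theorem integral_inner_slice [SFinite μ] {f : τ × α → ℝ} (hf : MemLp f 2 (μ.prod ν))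
    (hg : MemLp g 2 (μ.prod ν)) :
    ∫ t, (inner ℝ (slice ν f t) (slice ν g t) : ℝ) ∂μ = ∫ z, f z * g z ∂(μ.prod ν) := by
  rw [integral_prod (fun z => f z * g z) (hf.integrable_mul hg)]
  refine integral_congr_ae ?_
  filter_upwards [slice_ae_eq hf, slice_ae_eq hg] with t h1 h2
  rw [inner_L2_eq]
  refine integral_congr_ae ?_
  filter_upwards [h1, h2] with x h1 h2
  rw [h1, h2]

/-- Slicing, as a linear isometry `L²(τ × α) → L²(τ; L²(α))`. -/
noncomputable def sliceIsometry (μ : Measure τ) (ν : Measure α) [SFinite ν] [SFinite μ]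
    [MeasurableSpace.CountablyGenerated α] : Lp ℝ 2 (μ.prod ν) →ₗᵢ[ℝ] Lp (Lp ℝ 2 ν) 2 μ where
  toFun u := (memLp_slice (Lp.memLp u)).toLp _
  map_add' u v := by
    rw [← MemLp.toLp_add, MemLp.toLp_eq_toLp_iff]
    filter_upwards [slice_ae_eq (Lp.memLp u), slice_ae_eq (Lp.memLp v),
      slice_ae_eq (Lp.memLp (u + v)), Measure.ae_ae_of_ae_prod (Lp.coeFn_add u v)] with t h1 h2 h3 h4
    refine Lp.ext (h3.trans ?_)
    filter_upwards [h1, h2, h4, Lp.coeFn_add (slice ν u t) (slice ν v t)] with x h1 h2 h4 h5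
    rw [h4, Pi.add_apply, Pi.add_apply, h5, Pi.add_apply, h1, h2]
  map_smul' c u := by
    rw [RingHom.id_apply, ← MemLp.toLp_const_smul, MemLp.toLp_eq_toLp_iff]
    filter_upwards [slice_ae_eq (Lp.memLp u),
      slice_ae_eq (Lp.memLp (c • u)), Measure.ae_ae_of_ae_prod (Lp.coeFn_smul c u)] with t h1 h3 h4
    refine Lp.ext (h3.trans ?_)
    filter_upwards [h1, h4, Lp.coeFn_smul c (slice ν u t)] with x h1 h4 h5
    rw [h4, Pi.smul_apply, Pi.smul_apply, h5, Pi.smul_apply, h1]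
  norm_map' u := by
    have h1 := inner_toLp_toLp (memLp_slice (Lp.memLp u)) (memLp_slice (Lp.memLp u))
    rw [integral_inner_slice (Lp.memLp u) (Lp.memLp u), ← inner_L2_eq] at h1
    rw [real_inner_self_eq_norm_sq, real_inner_self_eq_norm_sq] at h1
    exact (sq_eq_sq₀ (norm_nonneg _) (norm_nonneg _)).1 h1

/-- The slices of these products are the functions equal to `v` on `s` and 0 elsewhere, which
suffice to detect any element of L²(τ; L²(α)). -/
theorem memLp_indicator_mul [IsFiniteMeasure μ] {s : Set τ} (hs : MeasurableSet s) (v : Lp ℝ 2 ν) :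
    MemLp (fun z : τ × α => s.indicator (fun _ => (1 : ℝ)) z.1 * v z.2) 2 (μ.prod ν) := by
  have h1 : MemLp (fun z : τ × α => v z.2) 2 (μ.prod ν) := (Lp.memLp v).comp_snd μ
  have h2 : Measurable fun z : τ × α => s.indicator (fun _ => (1 : ℝ)) z.1 :=
    (measurable_const.indicator hs).comp measurable_fst
  refine h1.of_le_mul (c := 1) (h2.aestronglyMeasurable.mul h1.aestronglyMeasurable)
    (ae_of_all _ fun z => ?_)
  rw [norm_mul]
  gcongr
  by_cases h : z.1 ∈ s <;> simp [h]

/-- Every element of `L²(τ; L²(α))` comes from a function of two variables. -/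
theorem exists_slice_eq [IsFiniteMeasure μ] [MeasurableSpace.CountablyGenerated α]
    {β : τ → Lp ℝ 2 ν} (hβ : MemLp β 2 μ) :
    ∃ u : τ × α → ℝ, MemLp u 2 (μ.prod ν) ∧ ∀ᵐ t ∂μ, slice ν u t = β t := by
  let S := sliceIsometry μ ν
  -- The range of an isometry of a complete space is complete, so it suffices that its orthogonal
  -- complement be trivial. An element b orthogonal to all slices of products has ∫ over s of ⟨v, b⟩
  -- equal to 0 for all s and v.
  have hrange : LinearMap.range S.toLinearMap = ⊤ := by
    have hc : IsComplete (LinearMap.range S.toLinearMap : Set (Lp (Lp ℝ 2 ν) 2 μ)) := by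
      rw [LinearMap.coe_range]
      exact S.isometry.isUniformInducing.isComplete_range
    have : CompleteSpace (LinearMap.range S.toLinearMap) := hc.completeSpace_coe
    rw [← Submodule.orthogonal_eq_bot_iff, Submodule.eq_bot_iff]
    intro b hb
    refine Lp.ext ((ae_eq_zero_of_forall_inner (𝕜 := ℝ) fun v => ?_).trans
      (Lp.coeFn_zero _ _ _).symm)
    have hbi : Integrable (fun t => (inner ℝ v (b t) : ℝ)) μ :=
      integrable_inner_of_memLp (memLp_const v) (Lp.memLp b)
    refine hbi.ae_eq_zero_of_forall_setIntegral_eq_zero fun s hs _ => ?_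
    have hm := memLp_indicator_mul (μ := μ) hs v
    have h1 := (Submodule.mem_orthogonal _ _).1 hb (S (hm.toLp _)) ⟨_, rfl⟩
    rw [L2.inner_def] at h1
    rw [← integral_indicator hs, ← h1]
    refine integral_congr_ae ?_
    filter_upwards [(memLp_slice (Lp.memLp (hm.toLp _))).coeFn_toLp,
      slice_ae_eq (Lp.memLp (hm.toLp _)), Measure.ae_ae_of_ae_prod hm.coeFn_toLp] with t h2 h3 h4
    have h5 : S (hm.toLp _) t = s.indicator (fun _ => v) t := by
      have h6 : (fun x => hm.toLp _ (t, x)) =ᵐ[ν]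
        fun x => s.indicator (fun _ => (1 : ℝ)) t * v x := h4
      refine Eq.trans h2 (Lp.ext (h3.trans (h6.trans ?_)))
      by_cases ht : t ∈ s
      · simp [ht]
      · simp only [indicator_of_notMem ht, zero_mul]
        exact (Lp.coeFn_zero _ _ _).symm
    rw [h5]
    by_cases ht : t ∈ s <;> simp [ht]
  obtain ⟨u, hu⟩ : hβ.toLp β ∈ LinearMap.range S.toLinearMap := hrange ▸ Submodule.mem_top
  refine ⟨u, Lp.memLp u, ?_⟩
  have h1 : S u = hβ.toLp β := hu
  filter_upwards [hβ.coeFn_toLp, (memLp_slice (Lp.memLp u)).coeFn_toLp] with t h2 h3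
  rw [← h2, ← h1, ← h3]
  rfl

end slices

/-! ### Multiplication operators with bounded matrix coefficients -/

section multiplication
open Filter Topology

variable {τ α : Type*} [MeasurableSpace τ] [MeasurableSpace α] {μ : Measure τ} {ν : Measure α}

open Classical in
/-- Multiplication by a function bounded by `M`. -/
noncomputable def mulOp (ν : Measure α) (M : ℝ) (b : α → ℝ) : Lp ℝ 2 ν →L[ℝ] Lp ℝ 2 ν :=
  if h : MemLp b ⊤ ν ∧ ∀ᵐ x ∂ν, ‖b x‖ ≤ M then
    (ContinuousLinearMap.lsmul ℝ ℝ).holderL ν ⊤ 2 2 (h.1.toLp b) else 0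

theorem mulOp_ae_eq {M : ℝ} {b : α → ℝ} (h : MemLp b ⊤ ν ∧ ∀ᵐ x ∂ν, ‖b x‖ ≤ M) (f : Lp ℝ 2 ν) :
    mulOp ν M b f =ᵐ[ν] fun x => b x * f x := by
  rw [mulOp, dif_pos h]
  have h1 := ContinuousLinearMap.coeFn_holder (r := 2) (B := ContinuousLinearMap.lsmul ℝ ℝ)
    (h.1.toLp b) f
  filter_upwards [h1, h.1.coeFn_toLp] with x h1 h2
  refine Eq.trans h1 ?_
  rw [h2]
  simp

/-- The value 0 given to `mulOp` on inadmissible coefficients is what frees this bound, and the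
symmetry below, from any hypothesis on `b`. The operators built from `A (t, ·)` are thus bounded
uniformly at every t, not only at almost every t. -/
theorem norm_mulOp_apply_le {M : ℝ} (hM : 0 ≤ M) (b : α → ℝ) (f : Lp ℝ 2 ν) :
    ‖mulOp ν M b f‖ ≤ M * ‖f‖ := by
  by_cases h : MemLp b ⊤ ν ∧ ∀ᵐ x ∂ν, ‖b x‖ ≤ M
  · refine Lp.norm_le_mul_norm_of_ae_le_mul ?_
    filter_upwards [mulOp_ae_eq h f, h.2] with x h1 h2
    rw [h1, norm_mul]
    gcongr
  · rw [mulOp, dif_neg h]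
    simp only [zero_apply, norm_zero]
    positivity

theorem inner_mulOp_left (M : ℝ) (b : α → ℝ) (f g : Lp ℝ 2 ν) :
    (inner ℝ (mulOp ν M b f) g : ℝ) = inner ℝ f (mulOp ν M b g) := by
  by_cases h : MemLp b ⊤ ν ∧ ∀ᵐ x ∂ν, ‖b x‖ ≤ M
  · rw [inner_L2_eq, inner_L2_eq]
    refine integral_congr_ae ?_
    filter_upwards [mulOp_ae_eq h f, mulOp_ae_eq h g] with x h1 h2
    rw [h1, h2]
    ring
  · rw [mulOp, dif_neg h]
    simp

/-- The entries of `A` are measurable and bounded by `M`. -/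
structure IsBddMatrix {k l : ℕ} (μ : Measure τ) (ν : Measure α) (M : ℝ)
    (A : τ × α → Matrix (Fin k) (Fin l) ℝ) : Prop where
  nonneg : 0 ≤ M
  aesm : ∀ i j, AEStronglyMeasurable (fun z => A z i j) (μ.prod ν)
  bound : ∀ i j, ∀ᵐ z ∂(μ.prod ν), ‖A z i j‖ ≤ M

theorem IsBddMatrix.transpose {k l : ℕ} {M : ℝ} {A : τ × α → Matrix (Fin k) (Fin l) ℝ}
    (hA : IsBddMatrix μ ν M A) : IsBddMatrix μ ν M fun z => (A z)ᵀ :=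
  ⟨hA.nonneg, fun i j => hA.aesm j i, fun i j => hA.bound j i⟩

theorem exists_isBddMatrix {k l : ℕ} {A : τ × α → Matrix (Fin k) (Fin l) ℝ}
    (hA : ∀ i j, MemLp (fun z => A z i j) ⊤ (μ.prod ν)) : ∃ M, IsBddMatrix μ ν M A := by
  have h : ∀ i j, ∃ M : ℝ, 0 ≤ M ∧ ∀ᵐ z ∂(μ.prod ν), ‖A z i j‖ ≤ M := by
    intro i j
    have h1 := (hA i j).2
    rw [eLpNorm_exponent_top] at h1
    refine ⟨(eLpNormEssSup (fun z => A z i j) (μ.prod ν)).toReal, ENNReal.toReal_nonneg, ?_⟩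
    filter_upwards [enorm_ae_le_eLpNormEssSup (fun z => A z i j) (μ.prod ν)] with z hz
    rw [← toReal_enorm]
    exact ENNReal.toReal_mono h1.ne hz
  choose M hM0 hM using h
  refine ⟨∑ i, ∑ j, M i j, Finset.sum_nonneg fun i _ => Finset.sum_nonneg fun j _ => hM0 i j,
    fun i j => (hA i j).1, fun i j => ?_⟩
  filter_upwards [hM i j] with z hz
  refine hz.trans ((Finset.single_le_sum (f := fun j => M i j) (fun j _ => hM0 i j)
    (Finset.mem_univ j)).trans ?_)
  exact Finset.single_le_sum (f := fun i => ∑ j, M i j)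
    (fun i _ => Finset.sum_nonneg fun j _ => hM0 i j) (Finset.mem_univ i)

/-- Multiplication of vector valued functions by the matrix valued function `A (t, ·)`. -/
noncomputable def matOp {τ : Type*} {k l : ℕ} (ν : Measure α) (M : ℝ) (A : τ × α → Matrix (Fin k) (Fin l) ℝ)
    (t : τ) : PiLp 2 (fun _ : Fin l => Lp ℝ 2 ν) →L[ℝ] PiLp 2 (fun _ : Fin k => Lp ℝ 2 ν) :=
  ((PiLp.continuousLinearEquiv 2 ℝ fun _ : Fin k => Lp ℝ 2 ν).symm :
    (Fin k → Lp ℝ 2 ν) →L[ℝ] PiLp 2 (fun _ : Fin k => Lp ℝ 2 ν)) ∘L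
    ContinuousLinearMap.pi fun i => ∑ j, (mulOp ν M fun x => A (t, x) i j) ∘L
      PiLp.proj 2 (fun _ : Fin l => Lp ℝ 2 ν) j

theorem matOp_apply {τ : Type*} {k l : ℕ} (M : ℝ) (A : τ × α → Matrix (Fin k) (Fin l) ℝ)
    (t : τ) (y : PiLp 2 (fun _ : Fin l => Lp ℝ 2 ν)) (i : Fin k) :
    matOp ν M A t y i = ∑ j, mulOp ν M (fun x => A (t, x) i j) (y j) := by
  simp [matOp]

theorem inner_matOp_left {τ : Type*} {k l : ℕ} (M : ℝ) (A : τ × α → Matrix (Fin k) (Fin l) ℝ)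
    (t : τ) (y : PiLp 2 (fun _ : Fin l => Lp ℝ 2 ν)) (z : PiLp 2 (fun _ : Fin k => Lp ℝ 2 ν)) :
    (inner ℝ (matOp ν M A t y) z : ℝ) = inner ℝ y (matOp ν M (fun z => (A z)ᵀ) t z) := by
  simp only [PiLp.inner_apply, matOp_apply, sum_inner, inner_sum, Matrix.transpose_apply,
    inner_mulOp_left]
  exact Finset.sum_comm

theorem norm_matOp_le {τ : Type*} {k l : ℕ} {M : ℝ} (hM : 0 ≤ M) (A : τ × α → Matrix (Fin k) (Fin l) ℝ)
    (t : τ) : ‖matOp ν M A t‖ ≤ k * (l * M) := by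
  refine ContinuousLinearMap.opNorm_le_bound _ (by positivity) fun y => ?_
  have h1 : ∀ i, ‖matOp ν M A t y i‖ ≤ l * M * ‖y‖ := by
    intro i
    rw [matOp_apply]
    calc ‖∑ j, mulOp ν M (fun x => A (t, x) i j) (y j)‖
        ≤ ∑ j : Fin l, M * ‖y‖ := norm_sum_le_of_le _ fun j _ =>
          (norm_mulOp_apply_le hM _ _).trans (by gcongr; exact PiLp.norm_apply_le y j)
      _ = l * M * ‖y‖ := by simp [mul_assoc]
  refine le_of_sq_le_sq ?_ (by positivity)
  rw [PiLp.norm_sq_eq_of_L2]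
  calc ∑ i, ‖matOp ν M A t y i‖ ^ 2 ≤ ∑ i : Fin k, (l * M * ‖y‖) ^ 2 := by
        gcongr with i; exact h1 i
    _ = k * (l * M * ‖y‖) ^ 2 := by simp
    -- The bound k ≤ k² avoids a square root; any constant independent of t will do.
    _ ≤ (k : ℝ) ^ 2 * (l * M * ‖y‖) ^ 2 := by
        gcongr
        exact_mod_cast Nat.le_self_pow two_ne_zero k
    _ = (k * (l * M) * ‖y‖) ^ 2 := by ring

variable [SFinite ν] {k l : ℕ} {M : ℝ} {A : τ × α → Matrix (Fin k) (Fin l) ℝ}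

theorem IsBddMatrix.ae_slice (hA : IsBddMatrix μ ν M A) :
    ∀ᵐ t ∂μ, ∀ i j, MemLp (fun x => A (t, x) i j) ⊤ ν ∧ ∀ᵐ x ∂ν, ‖A (t, x) i j‖ ≤ M := by
  simp only [ae_all_iff]
  intro i j
  filter_upwards [Measure.ae_ae_of_ae_prod (hA.bound i j), (hA.aesm i j).prodMk_left] with t h1 h2
  exact ⟨memLp_top_of_bound h2 M h1, h1⟩

theorem IsBddMatrix.matOp_ae_eq (hA : IsBddMatrix μ ν M A) :
    ∀ᵐ t ∂μ, ∀ (y : PiLp 2 (fun _ : Fin l => Lp ℝ 2 ν)) (i : Fin k),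
      matOp ν M A t y i =ᵐ[ν] fun x => (A (t, x) *ᵥ fun j => y j x) i := by
  filter_upwards [hA.ae_slice] with t ht y i
  rw [matOp_apply]
  refine (Lp.coeFn_fun_finsetSum _ _).trans ?_
  have : ∀ᵐ x ∂ν, ∀ j, mulOp ν M (fun x => A (t, x) i j) (y j) x = A (t, x) i j * y j x :=
    ae_all_iff.2 fun j => mulOp_ae_eq (ht i j) (y j)
  filter_upwards [this] with x hx
  simp only [hx, Matrix.mulVec, dotProduct]

/-- By Fubini's theorem: the inner product is, for almost every t, a finite sum of integrals in x of
jointly measurable functions. This is the weak measurability demanded of `P`. -/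
theorem IsBddMatrix.aestronglyMeasurable_inner [SFinite μ] (hA : IsBddMatrix μ ν M A)
    (h : PiLp 2 (fun _ : Fin l => Lp ℝ 2 ν)) (y : PiLp 2 (fun _ : Fin k => Lp ℝ 2 ν)) :
    AEStronglyMeasurable (fun t => (inner ℝ y (matOp ν M A t h) : ℝ)) μ := by
  simp only [PiLp.inner_apply, matOp_apply, inner_sum]
  refine Finset.aestronglyMeasurable_fun_sum _ fun i _ =>
    Finset.aestronglyMeasurable_fun_sum _ fun j _ => ?_
  have h1 : AEStronglyMeasurable (fun z : τ × α => y i z.2 * (A z i j * h j z.2)) (μ.prod ν) :=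
    (Lp.aestronglyMeasurable (y i)).comp_snd.mul
      ((hA.aesm i j).mul (Lp.aestronglyMeasurable (h j)).comp_snd)
  refine h1.integral_prod_right'.congr ?_
  filter_upwards [hA.ae_slice] with t ht
  rw [inner_L2_eq]
  refine integral_congr_ae ?_
  filter_upwards [mulOp_ae_eq (ht i j) (h j)] with x hx
  rw [hx]

instance separableSpace_piLp {X : Type*} [NormedAddCommGroup X] [TopologicalSpace.SeparableSpace X]
    {n : ℕ} : TopologicalSpace.SeparableSpace (PiLp 2 fun _ : Fin n => X) :=
  (PiLp.homeomorph 2 fun _ : Fin n => X).symm.surjective.denseRange.separableSpace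
    (PiLp.homeomorph 2 fun _ : Fin n => X).symm.continuous

theorem IsBddMatrix.memLp_matOp [SFinite μ] [MeasurableSpace.CountablyGenerated α]
    (hA : IsBddMatrix μ ν M A) {x : τ → PiLp 2 (fun _ : Fin l => Lp ℝ 2 ν)} (hx : MemLp x 2 μ) :
    MemLp (fun t => matOp ν M A t (x t)) 2 μ :=
  memLp_operator_apply (norm_matOp_le hA.nonneg A) hx
    (aestronglyMeasurable_operator_apply hA.aestronglyMeasurable_inner hx.aestronglyMeasurable)

end multiplication

/-! ### Product spaces, and H¹₀(Ω) inside L²(Ω) -/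

section spaces
open Filter Topology ContinuousLinearMap

section piLp
variable {X Y : Type*} [NormedAddCommGroup X] [NormedSpace ℝ X] [NormedAddCommGroup Y]
  [NormedSpace ℝ Y] {n : ℕ}

/-- The map acting as `L` on each component. -/
noncomputable def piMap (n : ℕ) (L : X →L[ℝ] Y) :
    PiLp 2 (fun _ : Fin n => X) →L[ℝ] PiLp 2 (fun _ : Fin n => Y) :=
  ((PiLp.continuousLinearEquiv 2 ℝ fun _ : Fin n => Y).symm :
    (Fin n → Y) →L[ℝ] PiLp 2 (fun _ : Fin n => Y)) ∘L
    ContinuousLinearMap.pi fun i => L ∘L PiLp.proj 2 (fun _ : Fin n => X) i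

theorem piMap_apply (L : X →L[ℝ] Y) (v : PiLp 2 (fun _ : Fin n => X)) (i : Fin n) :
    piMap n L v i = L (v i) := rfl

/-- The inclusion of the `i`-th component. -/
noncomputable def inclL (X : Type*) [NormedAddCommGroup X] [NormedSpace ℝ X] (i : Fin n) :
    X →L[ℝ] PiLp 2 (fun _ : Fin n => X) :=
  ((PiLp.continuousLinearEquiv 2 ℝ fun _ : Fin n => X).symm :
    (Fin n → X) →L[ℝ] PiLp 2 (fun _ : Fin n => X)) ∘L ContinuousLinearMap.single ℝ (fun _ => X) i

theorem inclL_apply (i j : Fin n) (x : X) : inclL X i x j = if j = i then x else 0 := by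
  have : inclL X i x j = Pi.single (M := fun _ => X) i x j := rfl
  rw [this, Pi.single_apply]

theorem sum_inclL (v : PiLp 2 (fun _ : Fin n => X)) : ∑ i, inclL X i (v i) = v := by
  ext j
  simp [inclL_apply]

theorem memLp_piLp {τ : Type*} [MeasurableSpace τ] {μ : Measure τ} {f : Fin n → τ → X}
    (hf : ∀ i, MemLp (f i) 2 μ) :
    MemLp (fun t => (WithLp.toLp 2 fun i => f i t : PiLp 2 (fun _ : Fin n => X))) 2 μ := by
  have : (fun t => (WithLp.toLp 2 fun i => f i t : PiLp 2 (fun _ : Fin n => X)))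
      = fun t => ∑ i, inclL X i (f i t) :=
    funext fun t => (sum_inclL (WithLp.toLp 2 fun i => f i t)).symm
  rw [this]
  exact memLp_finsetSum _ fun i _ => (inclL X i).comp_memLp' (hf i)

end piLp

section weakDeriv
variable {X Y : Type*} [NormedAddCommGroup X] [NormedSpace ℝ X] [NormedAddCommGroup Y]
  [NormedSpace ℝ Y] {T : ℝ}

theorem MemLp.clm {τ : Type*} [MeasurableSpace τ] {μ : Measure τ} {f : τ → X} (hf : MemLp f 2 μ)
    (L : X →L[ℝ] Y) : MemLp (fun t => L (f t)) 2 μ := L.comp_memLp' hf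

theorem IntegrableOn.clm {f : ℝ → X} {s : Set ℝ} (hf : IntegrableOn f s) (L : X →L[ℝ] Y) :
    IntegrableOn (fun t => L (f t)) s := L.integrable_comp hf

theorem memLp_fun_finsetSum {τ ι X : Type*} [NormedAddCommGroup X] [MeasurableSpace τ] {μ : Measure τ} (s : Finset ι)
    {f : ι → τ → X} (hf : ∀ i, MemLp (f i) 2 μ) : MemLp (fun t => ∑ i ∈ s, f i t) 2 μ :=
  memLp_finsetSum s fun i _ => hf i

theorem ParabolicControl.HasWeakTimeDeriv.clm_comp [CompleteSpace X] [CompleteSpace Y] {f df : ℝ → X} (h : HasWeakTimeDeriv T f df)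
    (L : X →L[ℝ] Y) (hf : IntegrableOn f (Ioo 0 T)) (hdf : IntegrableOn df (Ioo 0 T)) :
    HasWeakTimeDeriv T (fun t => L (f t)) (fun t => L (df t)) := by
  intro θ hθ hc hs
  have hθ' : Continuous (deriv θ) := hθ.continuous_deriv (by simp)
  simp only [← map_smul]
  rw [L.integral_comp_comm (integrable_smul_of_test hθ' hc.deriv hf),
    L.integral_comp_comm (integrable_smul_of_test hθ.continuous hc hdf), h θ hθ hc hs, map_neg]

theorem ParabolicControl.HasWeakTimeDeriv.finset_sum {ι : Type*} (s : Finset ι) {f df : ι → ℝ → X}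
    (h : ∀ i, HasWeakTimeDeriv T (f i) (df i)) (hf : ∀ i, IntegrableOn (f i) (Ioo 0 T))
    (hdf : ∀ i, IntegrableOn (df i) (Ioo 0 T)) :
    HasWeakTimeDeriv T (fun t => ∑ i ∈ s, f i t) (fun t => ∑ i ∈ s, df i t) := by
  intro θ hθ hc hs
  have hθ' : Continuous (deriv θ) := hθ.continuous_deriv (by simp)
  simp only [Finset.smul_sum]
  rw [integral_finsetSum _ fun i _ => integrable_smul_of_test hθ' hc.deriv (hf i),
    integral_finsetSum _ fun i _ => integrable_smul_of_test hθ.continuous hc (hdf i),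
    ← Finset.sum_neg_distrib]
  exact Finset.sum_congr rfl fun i _ => h i θ hθ hc hs

end weakDeriv

section pack
variable {X Y : Type*} [NormedAddCommGroup X] [InnerProductSpace ℝ X] [NormedAddCommGroup Y]
  [InnerProductSpace ℝ Y] {T : ℝ} {n : ℕ} {J : X →L[ℝ] Y}

/-- The transpose of `L`. -/
noncomputable def dualPrecomp {X Y : Type*} [NormedAddCommGroup X] [NormedSpace ℝ X]
    [NormedAddCommGroup Y] [NormedSpace ℝ Y] (L : X →L[ℝ] Y) :
    StrongDual ℝ Y →L[ℝ] StrongDual ℝ X := (compL ℝ X Y ℝ).flip L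

theorem dualPrecomp_apply {X Y : Type*} [NormedAddCommGroup X] [NormedSpace ℝ X]
    [NormedAddCommGroup Y] [NormedSpace ℝ Y] (L : X →L[ℝ] Y) (f : StrongDual ℝ Y) (x : X) :
    dualPrecomp L f x = f (L x) := rfl

/-- The functional `v ↦ ∑ᵢ ⟨dᵢ, vᵢ⟩`. -/
noncomputable def packDual (d : Fin n → StrongDual ℝ X) :
    StrongDual ℝ (PiLp 2 fun _ : Fin n => X) :=
  ∑ i, dualPrecomp (PiLp.proj 2 (fun _ : Fin n => X) i) (d i)

theorem packDual_apply (d : Fin n → StrongDual ℝ X) (v : PiLp 2 fun _ : Fin n => X) :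
    packDual d v = ∑ i, d i (v i) := by
  simp only [packDual, sum_apply, dualPrecomp_apply, PiLp.proj_apply]

theorem gelfand_piMap (v : PiLp 2 fun _ : Fin n => X) :
    gelfand (piMap n J) v = packDual fun i => gelfand J (v i) := by
  ext z
  simp only [gelfand_apply, packDual_apply, PiLp.inner_apply, piMap_apply]

theorem gelfand_piMap_inclL (v : PiLp 2 fun _ : Fin n => X) (i : Fin n) :
    dualPrecomp (inclL X i) (gelfand (piMap n J) v) = gelfand J (v i) := by
  ext z
  rw [dualPrecomp_apply, gelfand_piMap, packDual_apply, Finset.sum_eq_single i]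
  · rw [inclL_apply, if_pos rfl]
  · intro j _ hj
    rw [inclL_apply, if_neg hj, map_zero]
  · exact fun h => absurd (Finset.mem_univ i) h

/-- The matrix `A` couples the components, so the system must be seen as one equation for the
product triple, with `A` acting as a single operator on Hⁿ. -/
theorem IsW.pack [CompleteSpace X] {w : Fin n → ℝ → X} {dw : Fin n → ℝ → StrongDual ℝ X}
    (h : ∀ i, IsW T J (w i) (dw i)) :
    IsW T (piMap n J) (fun t => (WithLp.toLp 2 fun i => w i t : PiLp 2 fun _ : Fin n => X))
      (fun t => packDual fun i => dw i t) := by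
  refine ⟨memLp_piLp fun i => (h i).memLp, ?_, ?_⟩
  · exact memLp_fun_finsetSum _ fun i => MemLp.clm (h i).memLp_deriv
      (dualPrecomp (PiLp.proj 2 (fun _ : Fin n => X) i))
  · simp only [gelfand_piMap]
    exact HasWeakTimeDeriv.finset_sum _
      (fun i => (h i).weak_deriv.clm_comp (dualPrecomp (PiLp.proj 2 (fun _ : Fin n => X) i))
        (h i).integrableOn_gelfand (h i).integrableOn_deriv)
      (fun i => IntegrableOn.clm (h i).integrableOn_gelfand _)
      (fun i => IntegrableOn.clm (h i).integrableOn_deriv _)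

theorem IsW.component [CompleteSpace X] {w : ℝ → PiLp 2 fun _ : Fin n => X}
    {dw : ℝ → StrongDual ℝ (PiLp 2 fun _ : Fin n => X)} (h : IsW T (piMap n J) w dw) (i : Fin n) :
    IsW T J (fun t => w t i) (fun t => dualPrecomp (inclL X i) (dw t)) := by
  refine ⟨MemLp.clm h.memLp (PiLp.proj 2 (fun _ : Fin n => X) i),
    MemLp.clm h.memLp_deriv (dualPrecomp (inclL X i)), ?_⟩
  have := h.weak_deriv.clm_comp (dualPrecomp (inclL X i)) h.integrableOn_gelfand
    h.integrableOn_deriv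
  simpa only [gelfand_piMap_inclL] using this

end pack

variable {N : ℕ} {Ω : Set (EuclideanSpace ℝ (Fin N))} {T : ℝ} {n : ℕ}

theorem norm_sq_H10 (v : H10 Ω) : ‖v‖ ^ 2 = ‖toL2 v‖ ^ 2 + ‖grad v‖ ^ 2 :=
  WithLp.prod_norm_sq_eq_of_L2 v.1

/-- `H¹₀(Ω)` is dense in `L²(Ω)`. -/
theorem eq_zero_of_inner_toL2 (hΩ : IsOpen Ω) {f : L2 Ω}
    (h : ∀ v : H10 Ω, (inner ℝ f (toL2 v) : ℝ) = 0) : f = 0 := by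
  refine Lp.ext (EventuallyEq.trans ?_ (Lp.coeFn_zero _ _ _).symm)
  have hf : LocallyIntegrableOn f Ω volume := by
    have h1 : LocallyIntegrable f (volume.restrict Ω) :=
      (Lp.memLp f).locallyIntegrable (by norm_num)
    exact (locallyIntegrableOn_of_locallyIntegrable_restrict h1)
  have := hΩ.ae_eq_zero_of_integral_contDiff_smul_eq_zero hf fun ψ hψ hc hs => ?_
  · exact (ae_restrict_iff' hΩ.measurableSet).2 this
  have hg : Continuous (gradient ψ) :=
    (InnerProductSpace.toDual ℝ _).symm.continuous.comp (hψ.continuous_fderiv (by simp))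
  have hgc : HasCompactSupport (gradient ψ) := by
    have := hc.fderiv (𝕜 := ℝ)
    exact this.comp_left (g := (InnerProductSpace.toDual ℝ (EuclideanSpace ℝ (Fin N))).symm)
      (map_zero _)
  have m1 : MemLp ψ 2 (volume.restrict Ω) := (hψ.continuous.memLp_of_hasCompactSupport hc).restrict Ω
  have m2 : MemLp (gradient ψ) 2 (volume.restrict Ω) :=
    (hg.memLp_of_hasCompactSupport hgc).restrict Ω
  let z : WithLp 2 (L2 Ω × L2Field Ω) := WithLp.toLp 2 (m1.toLp ψ, m2.toLp (gradient ψ))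
  have hz : z ∈ testGraph Ω := ⟨ψ, ⟨hψ, hc, hs⟩, m1.coeFn_toLp, m2.coeFn_toLp⟩
  have h1 := h ⟨z, (testGraph Ω).le_topologicalClosure hz⟩
  have h2 : toL2 (⟨z, (testGraph Ω).le_topologicalClosure hz⟩ : H10 Ω) = m1.toLp ψ := rfl
  rw [h2, inner_L2_eq] at h1
  rw [← setIntegral_eq_integral_of_forall_compl_eq_zero (s := Ω)]
  · rw [← h1]
    refine integral_congr_ae ?_
    filter_upwards [m1.coeFn_toLp] with x hx
    rw [hx, smul_eq_mul, mul_comm]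
  · intro x hx
    rw [image_eq_zero_of_notMem_tsupport fun h => hx (hs h), zero_smul]

theorem memW_iff_isW {w : ℝ → H10 Ω} {dw : ℝ → Hm1 Ω} : MemW T Ω w dw ↔ IsW T toL2 w dw :=
  ⟨fun h => ⟨h.memLp, h.memLp_deriv, h.weak_deriv⟩, fun h => ⟨h.memLp, h.memLp_deriv, h.weak_deriv⟩⟩

end spaces

/-! ### Time reversal, well-posedness and duality for abstract systems -/

section evolution
open Filter Topology ContinuousLinearMap

section reversal
variable {T : ℝ}

theorem measurePreserving_reverse (T : ℝ) :
    MeasurePreserving (fun t => T - t) (volume.restrict (Ioo 0 T)) (volume.restrict (Ioo 0 T)) := by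
  have h := (Measure.measurePreserving_sub_left (volume : Measure ℝ) T).restrict_preimage
    (measurableSet_Ioo (a := (0 : ℝ)) (b := T))
  have : (fun t => T - t) ⁻¹' Ioo 0 T = Ioo 0 T := by
    ext t; simp only [mem_preimage, mem_Ioo]; constructor <;> rintro ⟨h1, h2⟩ <;> constructor <;> linarith
  rwa [this] at h

theorem integral_Ioo_reverse {X : Type*} [NormedAddCommGroup X] [NormedSpace ℝ X] (f : ℝ → X) :
    ∫ t in Ioo 0 T, f (T - t) = ∫ t in Ioo 0 T, f t :=
  (measurePreserving_reverse T).integral_comp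
    (Homeomorph.subLeft T).measurableEmbedding f

theorem ParabolicControl.HasWeakTimeDeriv.reverse {X : Type*} [NormedAddCommGroup X]
    [NormedSpace ℝ X] {f df : ℝ → X} (h : HasWeakTimeDeriv T f df) :
    HasWeakTimeDeriv T (fun t => f (T - t)) (fun t => -df (T - t)) := by
  intro θ hθ hc hs
  have hd : ∀ t, deriv (fun t => θ (T - t)) t = -deriv θ (T - t) := fun t =>
    deriv_comp_const_sub ..
  have h1 := h (fun t => θ (T - t)) (hθ.comp (contDiff_const.sub contDiff_id))
    (hc.comp_homeomorph (Homeomorph.subLeft T)) ?_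
  · simp only [hd, neg_smul, integral_neg, neg_inj] at h1
    rw [← integral_Ioo_reverse (fun t => deriv θ t • f (T - t)),
      ← integral_Ioo_reverse (fun t => θ t • -df (T - t))]
    simp only [sub_sub_cancel, smul_neg, integral_neg, neg_neg]
    exact h1
  · have : tsupport (fun t => θ (T - t)) = (fun t => T - t) ⁻¹' tsupport θ :=
      (tsupport_comp_eq_preimage θ (Homeomorph.subLeft T))
    rw [this]
    intro t ht
    have := hs ht
    exact ⟨by linarith [this.2], by linarith [this.1]⟩

theorem IsW.reverse {V H : Type*} [NormedAddCommGroup V] [InnerProductSpace ℝ V]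
    [NormedAddCommGroup H] [InnerProductSpace ℝ H] {J : V →L[ℝ] H} {w : ℝ → V}
    {dw : ℝ → StrongDual ℝ V} (h : IsW T J w dw) :
    IsW T J (fun t => w (T - t)) (fun t => -dw (T - t)) :=
  ⟨h.memLp.comp_measurePreserving (measurePreserving_reverse T),
    (h.memLp_deriv.comp_measurePreserving (measurePreserving_reverse T)).neg,
    h.weak_deriv.reverse⟩

end reversal

variable {X Y K : Type*} [NormedAddCommGroup X] [InnerProductSpace ℝ X]
  [NormedAddCommGroup Y] [InnerProductSpace ℝ Y] [NormedAddCommGroup K] [InnerProductSpace ℝ K]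
  {T : ℝ} {n : ℕ}
  {J : X →L[ℝ] Y} {G : X →L[ℝ] K}

/-- `y` is the continuous representative of a solution of `s ∂ₜ y = -G*G y + P y + f`. -/
def EvolSol (s T : ℝ) (J : X →L[ℝ] Y) (G : X →L[ℝ] K)
    (P : ℝ → PiLp 2 (fun _ : Fin n => Y) →L[ℝ] PiLp 2 (fun _ : Fin n => Y))
    (f : ℝ → PiLp 2 (fun _ : Fin n => Y)) (y : ℝ → PiLp 2 (fun _ : Fin n => Y)) : Prop :=
  ∃ (W : ℝ → PiLp 2 fun _ : Fin n => X)
    (dW : ℝ → StrongDual ℝ (PiLp 2 fun _ : Fin n => X)),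
    IsW T (piMap n J) W dW ∧ ContinuousOn y (Icc 0 T) ∧
    (∀ᵐ t ∂volume.restrict (Ioo 0 T), y t = piMap n J (W t)) ∧
    ∀ᵐ t ∂volume.restrict (Ioo 0 T), ∀ v, s * dW t v =
      - inner ℝ (piMap n G (W t)) (piMap n G v)
        + inner ℝ (P t (piMap n J (W t))) (piMap n J v) + inner ℝ (f t) (piMap n J v)

/-- The substitution t ↦ T - t changes only the sign in front of the time derivative. Thus the
backward problem, `s = -1`, inherits existence and uniqueness from the forward one. -/
theorem EvolSol.reverse {s : ℝ}
    {P : ℝ → PiLp 2 (fun _ : Fin n => Y) →L[ℝ] PiLp 2 (fun _ : Fin n => Y)} {f y : ℝ → PiLp 2 (fun _ : Fin n => Y)}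
    (h : EvolSol s T J G P f y) :
    EvolSol (-s) T J G (fun t => P (T - t)) (fun t => f (T - t)) (fun t => y (T - t)) := by
  obtain ⟨W, dW, hW, hy, hyW, heq⟩ := h
  have hq := (measurePreserving_reverse T).quasiMeasurePreserving
  refine ⟨_, _, hW.reverse, hy.comp (by fun_prop) fun t ht => ⟨by linarith [ht.2], by linarith [ht.1]⟩,
    hq.ae hyW, ?_⟩
  filter_upwards [hq.ae heq] with t ht v
  rw [← ht v, neg_apply, neg_mul_neg]

theorem evolSol_of_components [CompleteSpace X] {s : ℝ}
    {P : ℝ → PiLp 2 (fun _ : Fin n => Y) →L[ℝ] PiLp 2 (fun _ : Fin n => Y)} {f y : ℝ → PiLp 2 (fun _ : Fin n => Y)}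
    {w : Fin n → ℝ → X} {dw : Fin n → ℝ → StrongDual ℝ X} (h : ∀ i, IsW T J (w i) (dw i))
    (hy : ContinuousOn y (Icc 0 T))
    (hyw : ∀ᵐ t ∂volume.restrict (Ioo 0 T), ∀ i, y t i = J (w i t))
    (heq : ∀ᵐ t ∂volume.restrict (Ioo 0 T), ∀ (i : Fin n) (v : X),
      s * dw i t v = - inner ℝ (G (w i t)) (G v)
        + inner ℝ (P t (WithLp.toLp 2 fun j => J (w j t)) i) (J v)
        + inner ℝ (f t i) (J v)) : EvolSol s T J G P f y := by
  refine ⟨_, _, IsW.pack h, hy, ?_, ?_⟩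
  · filter_upwards [hyw] with t ht
    ext1 i
    exact ht i
  · filter_upwards [heq] with t ht v
    have h1 : piMap n J (WithLp.toLp 2 fun i => w i t : PiLp 2 fun _ : Fin n => X)
        = WithLp.toLp 2 fun j => J (w j t) := rfl
    rw [h1, packDual_apply, Finset.mul_sum, PiLp.inner_apply, PiLp.inner_apply, PiLp.inner_apply,
      ← Finset.sum_neg_distrib, ← Finset.sum_add_distrib, ← Finset.sum_add_distrib]
    refine Finset.sum_congr rfl fun i _ => ?_
    rw [ht i (v i)]
    simp only [piMap_apply]

theorem inner_piMap_inclL {X Y : Type*} [NormedAddCommGroup X] [NormedSpace ℝ X]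
    [NormedAddCommGroup Y] [InnerProductSpace ℝ Y] (L : X →L[ℝ] Y)
    (z : PiLp 2 fun _ : Fin n => Y) (i : Fin n) (v : X) :
    (inner ℝ z (piMap n L (inclL X i v)) : ℝ) = inner ℝ (z i) (L v) := by
  rw [PiLp.inner_apply, Finset.sum_eq_single i]
  · rw [piMap_apply, inclL_apply, if_pos rfl]
  · intro j _ hj
    rw [piMap_apply, inclL_apply, if_neg hj, map_zero, inner_zero_right]
  · exact fun h => absurd (Finset.mem_univ i) h

theorem EvolSol.components [CompleteSpace X] {s : ℝ}
    {P : ℝ → PiLp 2 (fun _ : Fin n => Y) →L[ℝ] PiLp 2 (fun _ : Fin n => Y)} {f y : ℝ → PiLp 2 (fun _ : Fin n => Y)}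
    (h : EvolSol s T J G P f y) :
    ∃ (w : Fin n → ℝ → X) (dw : Fin n → ℝ → StrongDual ℝ X), (∀ i, IsW T J (w i) (dw i)) ∧
      ContinuousOn y (Icc 0 T) ∧ (∀ᵐ t ∂volume.restrict (Ioo 0 T), ∀ i, y t i = J (w i t)) ∧
      ∀ᵐ t ∂volume.restrict (Ioo 0 T), ∀ (i : Fin n) (v : X),
      s * dw i t v = - inner ℝ (G (w i t)) (G v)
        + inner ℝ (P t (WithLp.toLp 2 fun j => J (w j t)) i) (J v)
        + inner ℝ (f t i) (J v) := by
  obtain ⟨W, dW, hW, hy, hyW, heq⟩ := h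
  refine ⟨fun i t => W t i, fun i t => dualPrecomp (inclL (X) i) (dW t),
    hW.component, hy, ?_, ?_⟩
  · filter_upwards [hyW] with t ht i
    rw [ht]
    rfl
  · filter_upwards [heq] with t ht i v
    have h1 : piMap n J (W t) = WithLp.toLp 2 fun j => J (W t j) := rfl
    rw [dualPrecomp_apply, ht, inner_piMap_inclL, inner_piMap_inclL, inner_piMap_inclL, h1,
      piMap_apply]

theorem norm_sq_piMap (hV : ∀ v, ‖v‖ ^ 2 = ‖J v‖ ^ 2 + ‖G v‖ ^ 2) (v : PiLp 2 fun _ : Fin n => X) :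
    ‖v‖ ^ 2 = ‖piMap n J v‖ ^ 2 + ‖piMap n G v‖ ^ 2 := by
  simp only [PiLp.norm_sq_eq_of_L2, hV, Finset.sum_add_distrib, piMap_apply]

theorem eq_zero_of_inner_piMap (hJ : ∀ h : Y, (∀ v, (inner ℝ h (J v) : ℝ) = 0) → h = 0)
    (f : PiLp 2 fun _ : Fin n => Y)
    (h : ∀ v : PiLp 2 fun _ : Fin n => X, (inner ℝ f (piMap n J v) : ℝ) = 0) : f = 0 := by
  ext1 i
  refine hJ _ fun v => ?_
  rw [← inner_piMap_inclL]
  exact h _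

theorem EvolSol.unique (hT : 0 < T) {P : ℝ → PiLp 2 (fun _ : Fin n => Y) →L[ℝ] PiLp 2 (fun _ : Fin n => Y)} {M : ℝ}
    (hM : ∀ t, ‖P t‖ ≤ M) {f y z : ℝ → PiLp 2 (fun _ : Fin n => Y)} (hy : EvolSol 1 T J G P f y)
    (hz : EvolSol 1 T J G P f z) (h0 : y 0 = z 0) : EqOn y z (Icc 0 T) := by
  obtain ⟨W, dW, hW, hyc, hyW, hyeq⟩ := hy
  obtain ⟨Z, dZ, hZ, hzc, hzZ, hzeq⟩ := hz
  have := (hW.sub hZ).eqOn_zero hT (piMap n G) hM (y := fun t => y t - z t) (hyc.sub hzc) (by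
    filter_upwards [hyW, hzZ] with t h1 h2
    rw [h1, h2, map_sub]) (by rw [h0, sub_self]) (by
    filter_upwards [hyeq, hzeq] with t h1 h2 v
    have h1 := h1 v
    have h2 := h2 v
    rw [one_mul] at h1 h2
    rw [sub_apply, h1, h2]
    simp only [map_sub, inner_sub_left]
    ring)
  intro t ht
  exact sub_eq_zero.1 (this ht)

theorem exists_evolSol [CompleteSpace X] [CompleteSpace Y] [TopologicalSpace.SeparableSpace Y]
    [CompleteSpace K] (hV : ∀ v, ‖v‖ ^ 2 = ‖J v‖ ^ 2 + ‖G v‖ ^ 2)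
    (hJ : ∀ h : Y, (∀ v, (inner ℝ h (J v) : ℝ) = 0) → h = 0) (hT : 0 < T) {P : ℝ → PiLp 2 (fun _ : Fin n => Y) →L[ℝ] PiLp 2 (fun _ : Fin n => Y)} {M : ℝ}
    (hM0 : 0 ≤ M) (hM : ∀ t, ‖P t‖ ≤ M)
    (hP : ∀ h k, AEStronglyMeasurable (fun t => (inner ℝ k (P t h) : ℝ))
      (volume.restrict (Ioo 0 T))) {f : ℝ → PiLp 2 (fun _ : Fin n => Y)}
    (hf : MemLp f 2 (volume.restrict (Ioo 0 T))) (y₀ : PiLp 2 (fun _ : Fin n => Y)) :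
    ∃ y, y 0 = y₀ ∧ EvolSol 1 T J G P f y := by
  obtain ⟨w, dw, y, h1, h2, h3, h4, h5⟩ := exists_isW_solution (J := piMap n J)
    (G := piMap n G) hT (norm_sq_piMap hV) (eq_zero_of_inner_piMap hJ) hM0 hM hP hf y₀
  exact ⟨y, h4, w, dw, h1, h2, h3, ae_of_all _ fun t v => by rw [one_mul, h5]⟩

/-- The duality formula between the forward problem and the backward problem. -/
theorem EvolSol.duality (hT : 0 < T) {P Q : ℝ → PiLp 2 (fun _ : Fin n => Y) →L[ℝ] PiLp 2 (fun _ : Fin n => Y)}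
    (hPQ : ∀ t y z, (inner ℝ (P t y) z : ℝ) = inner ℝ y (Q t z)) {f y φ : ℝ → PiLp 2 (fun _ : Fin n => Y)}
    (hy : EvolSol 1 T J G P f y) (hφ : EvolSol (-1) T J G Q 0 φ) :
    (inner ℝ (y T) (φ T) : ℝ) - inner ℝ (y 0) (φ 0)
      = ∫ t in Ioo 0 T, (inner ℝ (f t) (φ t) : ℝ) := by
  obtain ⟨W, dW, hW, hyc, hyW, hyeq⟩ := hy
  obtain ⟨Z, dZ, hZ, hφc, hφZ, hφeq⟩ := hφ
  rw [hW.inner_sub_inner hZ hT hyc hyW hφc hφZ T (right_mem_Icc.2 hT.le),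
    intervalIntegral.integral_of_le hT.le, integral_Ioc_eq_integral_Ioo]
  refine integral_congr_ae ?_
  filter_upwards [hyeq, hφeq, hφZ] with t h1 h2 h3
  -- Each equation is tested with the other solution. On adding, the `G` terms cancel by symmetry
  -- and the zero order terms by `hPQ`, so only the source remains.
  have h1 := h1 (Z t)
  have h2 := h2 (W t)
  rw [Pi.zero_apply, inner_zero_left, real_inner_comm (piMap n J (W t)), ← hPQ,
    real_inner_comm (piMap n G (W t))] at h2
  rw [h3]
  linarith

end evolution

/-! ### The parabolic systems as abstract evolution problems -/

section systems
open Filter Topology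

variable {N n m : ℕ} {Ω ω : Set (EuclideanSpace ℝ (Fin N))} {T : ℝ}

theorem volume_restrict_cylinder (T : ℝ) (Ω : Set (EuclideanSpace ℝ (Fin N))) :
    volume.restrict (cylinder T Ω)
      = (volume.restrict (Ioo 0 T)).prod (volume.restrict Ω) := by
  rw [Measure.prod_restrict]
  rfl

theorem exists_isBddMatrix_of_isLInfty {k l : ℕ}
    {A : ℝ × EuclideanSpace ℝ (Fin N) → Matrix (Fin k) (Fin l) ℝ} (hA : IsLInfty T Ω A) :
    ∃ M, IsBddMatrix (volume.restrict (Ioo 0 T)) (volume.restrict Ω) M A :=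
  exists_isBddMatrix fun i j => volume_restrict_cylinder T Ω ▸ hA i j

/-- The matrix `1_ω B`. -/
noncomputable def ctrlMatrix (ω : Set (EuclideanSpace ℝ (Fin N)))
    (B : ℝ × EuclideanSpace ℝ (Fin N) → Matrix (Fin n) (Fin m) ℝ)
    (z : ℝ × EuclideanSpace ℝ (Fin N)) : Matrix (Fin n) (Fin m) ℝ :=
  ω.indicator (fun _ => (1 : ℝ)) z.2 • B z

theorem isLInfty_ctrlMatrix (hω : MeasurableSet ω)
    {B : ℝ × EuclideanSpace ℝ (Fin N) → Matrix (Fin n) (Fin m) ℝ} (hB : IsLInfty T Ω B) :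
    IsLInfty T Ω (ctrlMatrix ω B) := by
  intro i j
  have h2 : Measurable fun z : ℝ × EuclideanSpace ℝ (Fin N) =>
      ω.indicator (fun _ => (1 : ℝ)) z.2 := (measurable_const.indicator hω).comp measurable_snd
  refine (hB i j).of_le_mul (c := 1)
    (h2.aestronglyMeasurable.mul (hB i j).aestronglyMeasurable) (ae_of_all _ fun z => ?_)
  simp only [ctrlMatrix, Matrix.smul_apply, smul_eq_mul, norm_mul]
  gcongr
  by_cases h : z.2 ∈ ω <;> simp [h]

/-- The time slices of a control. -/
noncomputable def ctrlSlices (u : L2Cyl T Ω m) (t : ℝ) : L2Vec Ω m :=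
  WithLp.toLp 2 fun k => slice (volume.restrict Ω) (u k) t

theorem memLp_ctrl (u : L2Cyl T Ω m) (k : Fin m) :
    MemLp (u k) 2 ((volume.restrict (Ioo 0 T)).prod (volume.restrict Ω)) :=
  volume_restrict_cylinder T Ω ▸ Lp.memLp (u k)

theorem memLp_ctrlSlices (u : L2Cyl T Ω m) :
    MemLp (ctrlSlices u) 2 (volume.restrict (Ioo 0 T)) :=
  memLp_piLp fun k => memLp_slice (memLp_ctrl u k)

theorem IsBddMatrix.integral_mulVec_mul {k l : ℕ} {M : ℝ}
    {A : ℝ × EuclideanSpace ℝ (Fin N) → Matrix (Fin k) (Fin l) ℝ}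
    (hA : IsBddMatrix (volume.restrict (Ioo 0 T)) (volume.restrict Ω) M A) :
    ∀ᵐ t ∂volume.restrict (Ioo 0 T), ∀ (g : Fin l → L2 Ω) (i : Fin k) (v : L2 Ω),
      ∫ x in Ω, (A (t, x) *ᵥ fun j => g j x) i * v x
        = inner ℝ (matOp (volume.restrict Ω) M A t (WithLp.toLp 2 g) i) v := by
  filter_upwards [hA.matOp_ae_eq] with t ht g i v
  rw [inner_L2_eq]
  refine integral_congr_ae ?_
  filter_upwards [ht (WithLp.toLp 2 g) i] with x hx
  rw [hx]

variable {A : ℝ × EuclideanSpace ℝ (Fin N) → Matrix (Fin n) (Fin n) ℝ}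
  {B : ℝ × EuclideanSpace ℝ (Fin N) → Matrix (Fin n) (Fin m) ℝ} {M M' : ℝ}

theorem setIntegral_eq_of_subset (hω : MeasurableSet ω) (hωΩ : ω ⊆ Ω)
    (F : EuclideanSpace ℝ (Fin N) → ℝ) :
    ∫ x in ω, F x = ∫ x in Ω, ω.indicator F x := by
  rw [setIntegral_indicator hω, inter_eq_self_of_subset_right hωΩ]

theorem ctrlMatrix_mulVec (t : ℝ) (x : EuclideanSpace ℝ (Fin N)) (g : Fin m → ℝ) (i : Fin n) :
    (ctrlMatrix ω B (t, x) *ᵥ g) i = ω.indicator (fun x => (B (t, x) *ᵥ g) i) x := by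
  by_cases h : x ∈ ω
  · simp [ctrlMatrix, h]
  · simp [ctrlMatrix, h]

/-- Extending the control term by zero from `ω` to `Ω` turns it into a source with values in L²(Ω)ⁿ,
given by the bounded matrix `1_ω B` acting on the slices of the control. -/
theorem integral_ctrl_mul (hω : MeasurableSet ω) (hωΩ : ω ⊆ Ω)
    (hB : IsBddMatrix (volume.restrict (Ioo 0 T)) (volume.restrict Ω) M' (ctrlMatrix ω B))
    (u : L2Cyl T Ω m) :
    ∀ᵐ t ∂volume.restrict (Ioo 0 T), ∀ (i : Fin n) (v : L2 Ω),
      ∫ x in ω, (B (t, x) *ᵥ fun k => u k (t, x)) i * v x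
        = inner ℝ (matOp (volume.restrict Ω) M' (ctrlMatrix ω B) t (ctrlSlices u t) i) v := by
  have hs : ∀ᵐ t ∂volume.restrict (Ioo 0 T), ∀ k,
      slice (volume.restrict Ω) (u k) t =ᵐ[volume.restrict Ω] fun x => u k (t, x) :=
    ae_all_iff.2 fun k => slice_ae_eq (memLp_ctrl u k)
  filter_upwards [hB.integral_mulVec_mul, hs] with t h1 h2 i v
  refine Eq.trans ?_ (h1 _ i v)
  rw [setIntegral_eq_of_subset hω hωΩ]
  refine integral_congr_ae ?_
  filter_upwards [ae_all_iff.2 h2] with x hx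
  rw [ctrlMatrix_mulVec]
  simp only [hx]
  by_cases h : x ∈ ω <;> simp [h]

/-- The dictionary with the abstract problem: almost every slice of the coefficients and of the
control is regular enough for the integrals over `Ω` and `ω` to be inner products in L²(Ω). -/
theorem isSolution_iff (hω : MeasurableSet ω) (hωΩ : ω ⊆ Ω)
    (hA : IsBddMatrix (volume.restrict (Ioo 0 T)) (volume.restrict Ω) M A)
    (hB : IsBddMatrix (volume.restrict (Ioo 0 T)) (volume.restrict Ω) M' (ctrlMatrix ω B))
    (y₀ : L2Vec Ω n) (u : L2Cyl T Ω m) (y : ℝ → L2Vec Ω n) :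
    IsSolution T Ω ω A B y₀ u y ↔ y 0 = y₀ ∧
      EvolSol 1 T (toL2 (Ω := Ω)) grad (matOp (volume.restrict Ω) M A)
        (fun t => matOp (volume.restrict Ω) M' (ctrlMatrix ω B) t (ctrlSlices u t)) y := by
  refine and_congr_right fun _ => ⟨?_, fun h => ?_⟩
  · rintro ⟨w, dw, hw, heq⟩
    refine evolSol_of_components (fun i => memW_iff_isW.1 (hw.memW i)) hw.continuousOn hw.ae_eq ?_
    filter_upwards [heq, hA.integral_mulVec_mul, integral_ctrl_mul hω hωΩ hB u] with t h1 h2 h3 i v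
    rw [one_mul, h1, h2, h3]
  · obtain ⟨w, dw, hw, hy, hyw, heq⟩ := h.components
    refine ⟨w, dw, ⟨fun i => memW_iff_isW.2 (hw i), hy, hyw⟩, ?_⟩
    filter_upwards [heq, hA.integral_mulVec_mul, integral_ctrl_mul hω hωΩ hB u] with t h1 h2 h3 i v
    rw [← one_mul (dw i t v), h1, h2, h3]

theorem isAdjointSolution_iff
    (hA : IsBddMatrix (volume.restrict (Ioo 0 T)) (volume.restrict Ω) M A)
    (φT : L2Vec Ω n) (φ : ℝ → L2Vec Ω n) :
    IsAdjointSolution T Ω A φT φ ↔ φ T = φT ∧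
      EvolSol (-1) T (toL2 (Ω := Ω)) grad (matOp (volume.restrict Ω) M fun z => (A z)ᵀ) 0 φ := by
  refine and_congr_right fun _ => ⟨?_, fun h => ?_⟩
  · rintro ⟨w, dw, hw, heq⟩
    refine evolSol_of_components (fun i => memW_iff_isW.1 (hw.memW i)) hw.continuousOn hw.ae_eq ?_
    filter_upwards [heq, hA.transpose.integral_mulVec_mul] with t h1 h2 i v
    rw [neg_one_mul, h1, h2, Pi.zero_apply, PiLp.zero_apply, inner_zero_left, add_zero]
  · obtain ⟨w, dw, hw, hy, hyw, heq⟩ := h.components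
    refine ⟨w, dw, ⟨fun i => memW_iff_isW.2 (hw i), hy, hyw⟩, ?_⟩
    filter_upwards [heq, hA.transpose.integral_mulVec_mul] with t h1 h2 i v
    rw [← neg_one_mul (dw i t v), h1, h2, Pi.zero_apply, PiLp.zero_apply, inner_zero_left, add_zero]

theorem exists_unique_isSolution (hΩ : IsOpen Ω) (hT : 0 < T) (hω : MeasurableSet ω) (hωΩ : ω ⊆ Ω)
    (hA : IsBddMatrix (volume.restrict (Ioo 0 T)) (volume.restrict Ω) M A)
    (hB : IsBddMatrix (volume.restrict (Ioo 0 T)) (volume.restrict Ω) M' (ctrlMatrix ω B))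
    (y₀ : L2Vec Ω n) (u : L2Cyl T Ω m) :
    ∃ y, IsSolution T Ω ω A B y₀ u y ∧
      ∀ z, IsSolution T Ω ω A B y₀ u z → EqOn z y (Icc 0 T) := by
  simp only [isSolution_iff hω hωΩ hA hB]
  have hM := norm_matOp_le (ν := volume.restrict Ω) hA.nonneg A
  have hM0 : 0 ≤ (n : ℝ) * (n * M) := by have := hA.nonneg; positivity
  obtain ⟨y, hy0, hy⟩ := exists_evolSol norm_sq_H10 (fun _ => eq_zero_of_inner_toL2 hΩ) hT hM0 hM
    hA.aestronglyMeasurable_inner (hB.memLp_matOp (memLp_ctrlSlices u)) y₀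
  exact ⟨y, ⟨hy0, hy⟩, fun z hz => hz.2.unique hT hM hy (hz.1.trans hy0.symm)⟩

theorem exists_unique_isAdjointSolution (hΩ : IsOpen Ω) (hT : 0 < T)
    (hA : IsBddMatrix (volume.restrict (Ioo 0 T)) (volume.restrict Ω) M A) (φT : L2Vec Ω n) :
    ∃ φ, IsAdjointSolution T Ω A φT φ ∧
      ∀ ψ, IsAdjointSolution T Ω A φT ψ → EqOn ψ φ (Icc 0 T) := by
  simp only [isAdjointSolution_iff hA]
  have hA' := hA.transpose
  have hM := fun t => norm_matOp_le (ν := volume.restrict Ω) hA.nonneg (fun z => (A z)ᵀ) (T - t)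
  have hM0 : 0 ≤ (n : ℝ) * (n * M) := by have := hA.nonneg; positivity
  obtain ⟨y, hy0, hy⟩ := exists_evolSol norm_sq_H10 (fun _ => eq_zero_of_inner_toL2 hΩ) hT hM0 hM
    (fun h k => (hA'.aestronglyMeasurable_inner h k).comp_measurePreserving
      (measurePreserving_reverse T)) (f := 0) MemLp.zero φT
  -- The forward problem was solved with the coefficients at time T - t; reversing time restores
  -- them at time t.
  have hy' := hy.reverse
  simp only [sub_sub_cancel] at hy'
  refine ⟨fun t => y (T - t), ⟨by simpa only [sub_self] using hy0, hy'⟩, fun ψ hψ => ?_⟩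
  have hψ' := hψ.2.reverse
  rw [neg_neg] at hψ'
  have h := hψ'.unique hT hM hy (by rw [sub_zero, hψ.1, hy0])
  intro t ht
  have := h (x := T - t) ⟨by linarith [ht.2], by linarith [ht.1]⟩
  simpa only [sub_sub_cancel] using this

end systems

/-! ### Controllability and observability for abstract dual pairs -/

section duality
variable {E F W : Type*} [NormedAddCommGroup E] [InnerProductSpace ℝ E]
  [NormedAddCommGroup F] [InnerProductSpace ℝ F] [NormedAddCommGroup W] [InnerProductSpace ℝ W]
  {R : F → W → E} {S : E → F} {K : E → W}

/-- The observation operators of a pair of systems in duality are linear. -/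
theorem isLinearMap_of_duality
    (h : ∀ y U φ, (inner ℝ (R y U) φ : ℝ) - inner ℝ y (S φ) = inner ℝ U (K φ)) :
    IsLinearMap ℝ S ∧ IsLinearMap ℝ K := by
  have hS : ∀ y φ, (inner ℝ y (S φ) : ℝ) = inner ℝ (R y 0) φ := fun y φ => by
    have := h y 0 φ
    rw [inner_zero_left] at this
    linarith
  have hK : ∀ U φ, (inner ℝ U (K φ) : ℝ) = inner ℝ (R 0 U) φ := fun U φ => by
    rw [← h 0 U φ, inner_zero_left, sub_zero]
  refine ⟨⟨fun x y => ext_inner_left ℝ fun v => ?_, fun c x => ext_inner_left ℝ fun v => ?_⟩,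
    ⟨fun x y => ext_inner_left ℝ fun v => ?_, fun c x => ext_inner_left ℝ fun v => ?_⟩⟩
  · rw [inner_add_right, hS, hS, hS, inner_add_right]
  · rw [inner_smul_right, hS, hS, inner_smul_right]
  · rw [inner_add_right, hK, hK, hK, inner_add_right]
  · rw [inner_smul_right, hK, hK, inner_smul_right]

/-- Controllability to zero is equivalent to observability, for a pair of systems in duality. -/
theorem forall_exists_eq_zero_iff_observability [CompleteSpace F] [CompleteSpace W]
    (h : ∀ y U φ, (inner ℝ (R y U) φ : ℝ) - inner ℝ y (S φ) = inner ℝ U (K φ)) :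
    (∀ y, ∃ U, R y U = 0) ↔ ∃ C : ℝ, 0 < C ∧ ∀ φ, ‖S φ‖ ^ 2 ≤ C * ‖K φ‖ ^ 2 := by
  obtain ⟨hS, hK⟩ := isLinearMap_of_duality h
  constructor
  · intro hn
    -- For fixed y, a control U steering y to 0 gives |⟨S φ, y⟩| = |⟨U, K φ⟩| ≤ ‖U‖ whenever ‖K φ‖ ≤
    -- 1: pointwise boundedness.
    obtain ⟨C, hC⟩ := banach_steinhaus (g := fun φ : {φ : E // ‖K φ‖ ≤ 1} => innerSL ℝ (S φ.1))
      fun y => by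
        obtain ⟨U, hU⟩ := hn y
        refine ⟨‖U‖, fun φ => ?_⟩
        have h1 := h y U φ.1
        rw [hU, inner_zero_left, zero_sub] at h1
        rw [innerSL_apply_apply, real_inner_comm, ← norm_neg, h1]
        exact (norm_inner_le_norm U _).trans
          (mul_le_of_le_one_right (norm_nonneg U) φ.2)
    have hC' : ∀ φ, ‖K φ‖ ≤ 1 → ‖S φ‖ ≤ C := fun φ hφ => by
      have := hC ⟨φ, hφ⟩
      rwa [innerSL_apply_norm] at this
    have hC0 : 0 ≤ C := (norm_nonneg _).trans (hC' 0 (by rw [hK.map_zero, norm_zero]; exact zero_le_one))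
    -- Scaling by homogeneity. The extra `δ / (C + 1)` keeps the normalising factor positive when `K
    -- φ = 0`, and costs at most `δ`.
    have key : ∀ φ, ‖S φ‖ ≤ C * ‖K φ‖ := fun φ => by
      refine le_of_forall_pos_le_add fun δ hδ => ?_
      have hpos : 0 < ‖K φ‖ + δ / (C + 1) := by positivity
      have h1 := hC' ((‖K φ‖ + δ / (C + 1))⁻¹ • φ) (by
        rw [hK.map_smul, norm_smul, norm_inv, Real.norm_of_nonneg hpos.le, inv_mul_le_iff₀ hpos,
          mul_one]
        exact le_add_of_nonneg_right (by positivity))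
      rw [hS.map_smul, norm_smul, norm_inv, Real.norm_of_nonneg hpos.le, inv_mul_le_iff₀ hpos] at h1
      have h2 : δ / (C + 1) * C ≤ δ := by
        rw [div_mul_eq_mul_div, div_le_iff₀ (by positivity)]
        nlinarith
      linarith
    -- The summand 1 only makes the constant positive, as `C` may be 0.
    refine ⟨C ^ 2 + 1, by positivity, fun φ => ?_⟩
    have h1 : ‖S φ‖ ^ 2 ≤ (C * ‖K φ‖) ^ 2 := pow_le_pow_left₀ (norm_nonneg _) (key φ) 2
    rw [mul_pow] at h1
    nlinarith [sq_nonneg ‖K φ‖]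
  · rintro ⟨C, hC, hobs⟩ y
    -- The control is the vector representing φ ↦ -⟨y, S φ⟩ through K; with it, duality gives ⟨R y
    -- U, φ⟩ = 0 for every φ.
    obtain ⟨U, hU⟩ := exists_inner_eq_of_le_norm (hK.mk' K)
      (-((innerₛₗ ℝ y).comp (hS.mk' S))) (‖y‖ * √C) fun φ => by
        have h1 : ‖S φ‖ ≤ √C * ‖K φ‖ := by
          refine abs_le_of_sq_le_sq' ?_ (by positivity) |>.2
          rw [mul_pow, Real.sq_sqrt hC.le]
          exact hobs φ
        simp only [LinearMap.neg_apply, LinearMap.comp_apply, IsLinearMap.mk'_apply, abs_neg]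
        rw [mul_assoc]
        exact (abs_real_inner_le_norm y (S φ)).trans (by gcongr)
    refine ⟨U, ext_inner_right ℝ fun φ => ?_⟩
    have h1 : (inner ℝ U (K φ) : ℝ) = - inner ℝ y (S φ) := hU φ
    have h2 := h y U φ
    rw [inner_zero_left]
    linarith

/-- Approximate controllability is equivalent to the injectivity of the observation, for a pair of
systems in duality. -/
theorem forall_exists_norm_sub_le_iff_injective [CompleteSpace E]
    (h : ∀ y U φ, (inner ℝ (R y U) φ : ℝ) - inner ℝ y (S φ) = inner ℝ U (K φ)) :
    (∀ ε : ℝ, 0 < ε → ∀ y z, ∃ U, ‖R y U - z‖ ≤ ε) ↔ ∀ φ, K φ = 0 → φ = 0 := by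
  constructor
  · intro ha φ hφ
    -- The target is `φ` itself, starting from 0. Since `K φ = 0`, all reachable states are
    -- orthogonal to `φ`, so ‖φ‖² = ⟨φ - R 0 U, φ⟩.
    have key : ∀ ε : ℝ, 0 < ε → ‖φ‖ ^ 2 ≤ 0 + ε := fun ε hε => by
      obtain ⟨U, hU⟩ := ha (ε / (‖φ‖ + 1)) (by positivity) 0 φ
      have h1 := h 0 U φ
      rw [inner_zero_left, hφ, inner_zero_right, sub_zero] at h1
      have h2 : ‖φ‖ ^ 2 = inner ℝ (φ - R 0 U) φ := by
        rw [inner_sub_left, h1, sub_zero, real_inner_self_eq_norm_sq]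
      rw [h2, zero_add]
      refine (real_inner_le_norm _ _).trans ?_
      rw [norm_sub_rev]
      refine (mul_le_mul_of_nonneg_right hU (norm_nonneg φ)).trans ?_
      rw [div_mul_eq_mul_div, div_le_iff₀ (by positivity)]
      nlinarith
    have := le_of_forall_pos_le_add key
    exact norm_eq_zero.1 (pow_eq_zero_iff two_ne_zero |>.1 (le_antisymm this (sq_nonneg _)))
  · intro hi ε hε y z
    -- `R` was not assumed affine in the control; this too follows from the duality identity, by
    -- testing with all φ.
    have hadd : ∀ y U V, R y (U + V) = R y U + R 0 V := fun y U V => ext_inner_right ℝ fun φ => by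
      have h1 := h y (U + V) φ
      have h2 := h y U φ
      have h3 := h 0 V φ
      rw [inner_add_left] at h1 ⊢
      rw [inner_zero_left] at h3
      linarith
    have hsmul : ∀ (c : ℝ) V, R 0 (c • V) = c • R 0 V := fun c V => ext_inner_right ℝ fun φ => by
      have h1 := h 0 (c • V) φ
      have h3 := h 0 V φ
      rw [inner_smul_left] at h1 ⊢
      rw [inner_zero_left, sub_zero] at h1 h3
      rw [h1, h3]
    let L : W →ₗ[ℝ] E :=
      { toFun := R 0
        map_add' := hadd 0
        map_smul' := hsmul }
    -- A vector φ orthogonal to the range satisfies ⟨U, K φ⟩ = ⟨R 0 U, φ⟩ = 0 for all U, hence `K φ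
    -- = 0`.
    have hdense : (LinearMap.range L).topologicalClosure = ⊤ := by
      rw [Submodule.topologicalClosure_eq_top_iff, Submodule.eq_bot_iff]
      intro φ hφ
      refine hi φ (ext_inner_left ℝ fun U => ?_)
      rw [inner_zero_right, ← h 0 U φ, inner_zero_left, sub_zero]
      exact hφ _ ⟨U, rfl⟩
    have hz : z - R y 0 ∈ closure (LinearMap.range L : Set E) := by
      rw [← Submodule.topologicalClosure_coe, hdense]
      trivial
    obtain ⟨_, ⟨U, rfl⟩, hU⟩ := Metric.mem_closure_iff.1 hz ε hε
    refine ⟨U, ?_⟩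
    have h1 : R y U - z = -((z - R y 0) - L U) := by
      have := hadd y 0 U
      rw [zero_add] at this
      rw [this]
      change _ = -((z - R y 0) - R 0 U)
      abel
    rw [h1, norm_neg, ← dist_eq_norm]
    exact hU.le

end duality

/-! ### The control system and its adjoint as a dual pair -/

section controllability
open Filter Topology

variable {N n m p : ℕ} {Ω ω : Set (EuclideanSpace ℝ (Fin N))} {T : ℝ}
  {A : ℝ × EuclideanSpace ℝ (Fin N) → Matrix (Fin n) (Fin n) ℝ}
  {B : ℝ × EuclideanSpace ℝ (Fin N) → Matrix (Fin n) (Fin m) ℝ} {M M' : ℝ}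

theorem inner_projAdj (hpn : p ≤ n) (y : L2Vec Ω n) (φ : L2Vec Ω p) :
    (inner ℝ y (projAdj n φ) : ℝ) = inner ℝ (proj hpn y) φ := by
  rw [PiLp.inner_apply, PiLp.inner_apply]
  refine (Fintype.sum_of_injective (Fin.castLE hpn) (Fin.castLE_injective hpn) _ _
    (fun i hi => ?_) fun i => ?_).symm
  · have h : ¬ (i : ℕ) < p := fun h => hi ⟨⟨i, h⟩, rfl⟩
    simp only [projAdj, dif_neg h, inner_zero_right]
  · have h : (Fin.castLE hpn i : ℕ) < p := i.2
    simp only [projAdj, proj, dif_pos h]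
    rfl

theorem proj_projAdj (hpn : p ≤ n) (φ : L2Vec Ω p) : proj hpn (projAdj n φ) = φ := by
  ext1 i
  have h : (Fin.castLE hpn i : ℕ) < p := i.2
  simp only [projAdj, proj, dif_pos h]
  rfl

theorem EvolSol.memLp {X Y K : Type*} [NormedAddCommGroup X] [InnerProductSpace ℝ X]
    [NormedAddCommGroup Y] [InnerProductSpace ℝ Y] [NormedAddCommGroup K] [InnerProductSpace ℝ K]
    {J : X →L[ℝ] Y} {G : X →L[ℝ] K} {s : ℝ}
    {P : ℝ → PiLp 2 (fun _ : Fin n => Y) →L[ℝ] PiLp 2 (fun _ : Fin n => Y)}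
    {f y : ℝ → PiLp 2 (fun _ : Fin n => Y)} (h : EvolSol s T J G P f y) :
    MemLp y 2 (volume.restrict (Ioo 0 T)) := by
  obtain ⟨W, dW, hW, -, hyW, -⟩ := h
  exact (memLp_congr_ae hyW).2 (_root_.MemLp.clm hW.memLp (piMap n J))

theorem EvolSol.continuousOn {X Y K : Type*} [NormedAddCommGroup X] [InnerProductSpace ℝ X]
    [NormedAddCommGroup Y] [InnerProductSpace ℝ Y] [NormedAddCommGroup K] [InnerProductSpace ℝ K]
    {J : X →L[ℝ] Y} {G : X →L[ℝ] K} {s : ℝ}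
    {P : ℝ → PiLp 2 (fun _ : Fin n => Y) →L[ℝ] PiLp 2 (fun _ : Fin n => Y)}
    {f y : ℝ → PiLp 2 (fun _ : Fin n => Y)} (h : EvolSol s T J G P f y) :
    ContinuousOn y (Icc 0 T) := by
  obtain ⟨W, dW, -, hy, -, -⟩ := h
  exact hy

theorem memLp_zero_of_normed {X : Type*} [NormedAddCommGroup X] (p : ENNReal) (μ : Measure ℝ) :
    MemLp (0 : ℝ → X) p μ := MemLp.zero

theorem ParabolicControl.HasWeakTimeDeriv.zero {X : Type*} [NormedAddCommGroup X]
    [NormedSpace ℝ X] (T : ℝ) : HasWeakTimeDeriv T (fun _ => (0 : X)) 0 := fun θ _ _ _ => by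
  simp only [Pi.zero_apply, smul_zero, integral_zero, neg_zero]

theorem isW_zero {V H : Type*} [NormedAddCommGroup V] [InnerProductSpace ℝ V]
    [NormedAddCommGroup H] [InnerProductSpace ℝ H] (J : V →L[ℝ] H) : IsW T J 0 0 := by
  refine ⟨memLp_zero_of_normed 2 _, memLp_zero_of_normed 2 _, ?_⟩
  have h : (fun t => gelfand J ((0 : ℝ → V) t)) = fun _ => 0 := funext fun _ => map_zero _
  rw [h]
  exact HasWeakTimeDeriv.zero T

theorem evolSol_zero {X Y K : Type*} [NormedAddCommGroup X] [InnerProductSpace ℝ X]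
    [NormedAddCommGroup Y] [InnerProductSpace ℝ Y] [NormedAddCommGroup K] [InnerProductSpace ℝ K]
    {J : X →L[ℝ] Y} {G : X →L[ℝ] K} {s : ℝ}
    {P : ℝ → PiLp 2 (fun _ : Fin n => Y) →L[ℝ] PiLp 2 (fun _ : Fin n => Y)} :
    EvolSol s T J G P 0 0 := by
  refine ⟨0, 0, isW_zero _, continuousOn_const, ?_, ?_⟩
  · exact ae_of_all _ fun t => by rw [Pi.zero_apply, Pi.zero_apply, map_zero]
  · exact ae_of_all _ fun t v => by
      have h1 : (0 : ℝ → StrongDual ℝ (PiLp 2 fun _ : Fin n => X)) t v = 0 := rfl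
      have h2 : (0 : ℝ → PiLp 2 fun _ : Fin n => X) t = 0 := rfl
      have h3 : (0 : ℝ → PiLp 2 fun _ : Fin n => Y) t = 0 := rfl
      rw [h1, h2, h3, map_zero, map_zero, map_zero, inner_zero_left, inner_zero_left, mul_zero,
        neg_zero, add_zero, add_zero]

/-- The observation `1_ω B* φ`, as a function of time. -/
noncomputable def observation (ω : Set (EuclideanSpace ℝ (Fin N)))
    (B : ℝ × EuclideanSpace ℝ (Fin N) → Matrix (Fin n) (Fin m) ℝ) (M' : ℝ) (φ : ℝ → L2Vec Ω n)
    (t : ℝ) : L2Vec Ω m :=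
  matOp (volume.restrict Ω) M' (fun z => (ctrlMatrix ω B z)ᵀ) t (φ t)

theorem ctrlMatrix_transpose_mulVec (t : ℝ) (x : EuclideanSpace ℝ (Fin N)) (g : Fin n → ℝ)
    (k : Fin m) : ((ctrlMatrix ω B (t, x))ᵀ *ᵥ g) k
      = ω.indicator (fun x => ((B (t, x))ᵀ *ᵥ g) k) x := by
  by_cases h : x ∈ ω
  · simp [ctrlMatrix, h]
  · simp [ctrlMatrix, h]

theorem observation_ae_eq
    (hB : IsBddMatrix (volume.restrict (Ioo 0 T)) (volume.restrict Ω) M' (ctrlMatrix ω B)) :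
    ∀ᵐ t ∂volume.restrict (Ioo 0 T), ∀ (φ : ℝ → L2Vec Ω n) (k : Fin m),
      observation ω B M' φ t k =ᵐ[volume.restrict Ω]
        ω.indicator fun x => ctrlAdj B φ t x k := by
  filter_upwards [hB.transpose.matOp_ae_eq] with t ht φ k
  refine (ht (φ t) k).trans (ae_of_all _ fun x => ?_)
  exact ctrlMatrix_transpose_mulVec t x _ k

theorem norm_sq_observation (hω : MeasurableSet ω) (hωΩ : ω ⊆ Ω)
    (hB : IsBddMatrix (volume.restrict (Ioo 0 T)) (volume.restrict Ω) M' (ctrlMatrix ω B))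
    (φ : ℝ → L2Vec Ω n) : ∀ᵐ t ∂volume.restrict (Ioo 0 T),
      ‖observation ω B M' φ t‖ ^ 2 = ∫ x in ω, ∑ k, (ctrlAdj B φ t x k) ^ 2 := by
  filter_upwards [observation_ae_eq hB] with t ht
  rw [PiLp.norm_sq_eq_of_L2, setIntegral_eq_of_subset hω hωΩ]
  simp only [norm_sq_L2_eq]
  rw [← integral_finsetSum _ fun k _ => (Lp.memLp (observation ω B M' φ t k)).integrable_sq]
  refine integral_congr_ae ?_
  filter_upwards [ae_all_iff.2 (ht φ)] with x hx
  simp only [hx]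
  by_cases h : x ∈ ω <;> simp [h]

theorem observation_eq_zero_iff (hω : MeasurableSet ω) (hωΩ : ω ⊆ Ω)
    (hB : IsBddMatrix (volume.restrict (Ioo 0 T)) (volume.restrict Ω) M' (ctrlMatrix ω B))
    (φ : ℝ → L2Vec Ω n) : (∀ᵐ t ∂volume.restrict (Ioo 0 T), observation ω B M' φ t = 0) ↔
      ∀ᵐ t ∂volume.restrict (Ioo 0 T), ∀ᵐ x ∂volume.restrict ω, ctrlAdj B φ t x = 0 := by
  constructor
  · intro h
    filter_upwards [h, observation_ae_eq hB] with t h1 h2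
    have h3 : ∀ᵐ x ∂volume.restrict Ω, ∀ k, ω.indicator (fun x => ctrlAdj B φ t x k) x = 0 := by
      refine ae_all_iff.2 fun k => ?_
      have h4 := h2 φ k
      rw [h1] at h4
      exact h4.symm.trans (Lp.coeFn_zero _ _ _)
    filter_upwards [ae_restrict_of_ae_restrict_of_subset hωΩ h3, ae_restrict_mem hω] with x h4 h5
    ext k
    have := h4 k
    rwa [indicator_of_mem h5] at this
  · intro h
    filter_upwards [h, norm_sq_observation hω hωΩ hB φ] with t h1 h2
    have h3 : ∫ x in ω, ∑ k, (ctrlAdj B φ t x k) ^ 2 = 0 := by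
      rw [integral_congr_ae (g := fun _ => (0 : ℝ)), integral_zero]
      filter_upwards [h1] with x hx
      simp [hx]
    rw [h3] at h2
    exact norm_eq_zero.1 (pow_eq_zero_iff two_ne_zero |>.1 h2)

/-- The abstract duality provides a control only as an element of L²(0,T; L²(Ω)ᵐ). Surjectivity of
slicing, applied to each component, turns it into a function on the cylinder. -/
theorem exists_ctrlSlices_eq {U : ℝ → L2Vec Ω m} (hU : MemLp U 2 (volume.restrict (Ioo 0 T))) :
    ∃ u : L2Cyl T Ω m, ∀ᵐ t ∂volume.restrict (Ioo 0 T), ctrlSlices u t = U t := by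
  have h1 : ∀ k, ∃ u : Lp ℝ 2 (volume.restrict (cylinder T Ω)),
      ∀ᵐ t ∂volume.restrict (Ioo 0 T), slice (volume.restrict Ω) u t = U t k := fun k => by
    obtain ⟨u, hu, hut⟩ := exists_slice_eq
      (_root_.MemLp.clm hU (PiLp.proj 2 (𝕜 := ℝ) (fun _ : Fin m => L2 Ω) k))
    have hu' : MemLp u 2 (volume.restrict (cylinder T Ω)) :=
      (volume_restrict_cylinder T Ω).symm ▸ hu
    have hv : MemLp (hu'.toLp u) 2 ((volume.restrict (Ioo 0 T)).prod (volume.restrict Ω)) :=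
      volume_restrict_cylinder T Ω ▸ Lp.memLp (hu'.toLp u)
    have he : hu'.toLp u =ᵐ[(volume.restrict (Ioo 0 T)).prod (volume.restrict Ω)] u :=
      volume_restrict_cylinder T Ω ▸ hu'.coeFn_toLp
    refine ⟨hu'.toLp u, ?_⟩
    filter_upwards [hut, slice_ae_eq hu, slice_ae_eq hv, Measure.ae_ae_of_ae_prod he]
      with t h2 h3 h4 h5
    refine Eq.trans (Lp.ext (h4.trans (EventuallyEq.trans h5 h3.symm))) h2
  choose u hu using h1
  refine ⟨WithLp.toLp 2 u, ?_⟩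
  filter_upwards [ae_all_iff.2 hu] with t ht
  ext1 k
  exact ht k

theorem IsBddMatrix.duality (hT : 0 < T) (hω : MeasurableSet ω) (hωΩ : ω ⊆ Ω)
    (hA : IsBddMatrix (volume.restrict (Ioo 0 T)) (volume.restrict Ω) M A)
    (hB : IsBddMatrix (volume.restrict (Ioo 0 T)) (volume.restrict Ω) M' (ctrlMatrix ω B))
    (hpn : p ≤ n) {y₀ : L2Vec Ω n} {u : L2Cyl T Ω m} {y φ : ℝ → L2Vec Ω n} {φ₀ : L2Vec Ω p}
    (hy : IsSolution T Ω ω A B y₀ u y) (hφ : IsAdjointSolution T Ω A (projAdj n φ₀) φ) :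
    (inner ℝ (proj hpn (y T)) φ₀ : ℝ) - inner ℝ y₀ (φ 0)
      = ∫ t in Ioo 0 T, (inner ℝ (ctrlSlices u t) (observation ω B M' φ t) : ℝ) := by
  obtain ⟨h0, hy⟩ := (isSolution_iff hω hωΩ hA hB y₀ u y).1 hy
  obtain ⟨h1, hφ⟩ := (isAdjointSolution_iff hA _ φ).1 hφ
  have h := hy.duality hT (fun t y z => inner_matOp_left M A t y z) hφ
  rw [h0, h1, inner_projAdj hpn] at h
  rw [h]
  refine integral_congr_ae (ae_of_all _ fun t => ?_)
  exact inner_matOp_left M' (ctrlMatrix ω B) t (ctrlSlices u t) (φ t)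

theorem memLp_observation
    (hA : IsBddMatrix (volume.restrict (Ioo 0 T)) (volume.restrict Ω) M A)
    (hB : IsBddMatrix (volume.restrict (Ioo 0 T)) (volume.restrict Ω) M' (ctrlMatrix ω B))
    {φT : L2Vec Ω n} {φ : ℝ → L2Vec Ω n} (hφ : IsAdjointSolution T Ω A φT φ) :
    MemLp (observation ω B M' φ) 2 (volume.restrict (Ioo 0 T)) :=
  hB.transpose.memLp_matOp ((isAdjointSolution_iff hA _ φ).1 hφ).2.memLp

/-- The system and its adjoint, as a pair of systems in duality. -/
theorem exists_dual_pair (hΩ : IsOpen Ω) (hT : 0 < T) (hω : MeasurableSet ω) (hωΩ : ω ⊆ Ω)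
    (hA : IsBddMatrix (volume.restrict (Ioo 0 T)) (volume.restrict Ω) M A)
    (hB : IsBddMatrix (volume.restrict (Ioo 0 T)) (volume.restrict Ω) M' (ctrlMatrix ω B))
    (hpn : p ≤ n) :
    ∃ (R : L2Vec Ω n → Lp (L2Vec Ω m) 2 (volume.restrict (Ioo 0 T)) → L2Vec Ω p)
      (S : L2Vec Ω p → L2Vec Ω n)
      (K : L2Vec Ω p → Lp (L2Vec Ω m) 2 (volume.restrict (Ioo 0 T))),
      (∀ y U φ, (inner ℝ (R y U) φ : ℝ) - inner ℝ y (S φ) = inner ℝ U (K φ)) ∧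
      (∀ y U, ∃ u y', IsSolution T Ω ω A B y u y' ∧ R y U = proj hpn (y' T)) ∧
      (∀ y u y', IsSolution T Ω ω A B y u y' → ∃ U, R y U = proj hpn (y' T)) ∧
      ∀ φ₀ φ, IsAdjointSolution T Ω A (projAdj n φ₀) φ → S φ₀ = φ 0 ∧
        K φ₀ =ᵐ[volume.restrict (Ioo 0 T)] observation ω B M' φ := by
  choose Y hY hYu using exists_unique_isSolution hΩ hT hω hωΩ hA hB
  choose Φ hΦ hΦu using exists_unique_isAdjointSolution (n := n) hΩ hT hA
  have hex : ∀ U : Lp (L2Vec Ω m) 2 (volume.restrict (Ioo 0 T)), ∃ u : L2Cyl T Ω m,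
      ∀ᵐ t ∂volume.restrict (Ioo 0 T), ctrlSlices u t = U t :=
    fun U => exists_ctrlSlices_eq (Lp.memLp U)
  choose c hc using hex
  have hobs : ∀ φ₀ : L2Vec Ω p, MemLp (observation ω B M' (Φ (projAdj n φ₀))) 2
      (volume.restrict (Ioo 0 T)) := fun φ₀ => memLp_observation hA hB (hΦ _)
  -- Stated for any control with slices `U` and any solution it drives, so that it serves for the
  -- chosen ones and for arbitrary ones.
  have hdual : ∀ (y : L2Vec Ω n) (U : Lp (L2Vec Ω m) 2 (volume.restrict (Ioo 0 T)))
      (φ : L2Vec Ω p) (u : L2Cyl T Ω m) (y' : ℝ → L2Vec Ω n),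
      (∀ᵐ t ∂volume.restrict (Ioo 0 T), ctrlSlices u t = U t) → IsSolution T Ω ω A B y u y' →
      (inner ℝ (proj hpn (y' T)) φ : ℝ) - inner ℝ y (Φ (projAdj n φ) 0)
        = inner ℝ U ((hobs φ).toLp _) := fun y U φ u y' hu hy => by
    rw [hA.duality hT hω hωΩ hB hpn hy (hΦ _), L2.inner_def]
    refine integral_congr_ae ?_
    filter_upwards [hu, (hobs φ).coeFn_toLp] with t h1 h2
    rw [h1, h2]
  refine ⟨fun y U => proj hpn (Y y (c U) T), fun φ => Φ (projAdj n φ) 0,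
    fun φ => (hobs φ).toLp _, fun y U φ => hdual y U φ _ _ (hc U) (hY _ _),
    fun y U => ⟨_, _, hY _ _, rfl⟩, fun y u y' hy => ?_, fun φ₀ φ hφ => ?_⟩
  -- The given `u` and the control chosen from its slices have the same inner products on the dual
  -- side, so the two final states have the same projection.
  · refine ⟨(memLp_ctrlSlices u).toLp _, ext_inner_right ℝ fun φ => ?_⟩
    have h1 := hdual y ((memLp_ctrlSlices u).toLp _) φ u y'
      ((memLp_ctrlSlices u).coeFn_toLp.mono fun t ht => ht.symm) hy
    have h2 := hdual y ((memLp_ctrlSlices u).toLp _) φ _ _ (hc _) (hY _ _)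
    linarith
  · have he := hΦu _ φ hφ
    refine ⟨(he (left_mem_Icc.2 hT.le)).symm, (hobs φ₀).coeFn_toLp.trans ?_⟩
    filter_upwards [ae_restrict_mem measurableSet_Ioo] with t ht
    rw [observation, observation, he (Ioo_subset_Icc_self ht)]

end controllability

/-! ### Vanishing of adjoint solutions -/

section uniqueContinuation
open Filter Topology

variable {N n p : ℕ} {Ω : Set (EuclideanSpace ℝ (Fin N))} {T : ℝ}
  {A : ℝ × EuclideanSpace ℝ (Fin N) → Matrix (Fin n) (Fin n) ℝ} {M : ℝ}

/-- Identifies the conclusion of the unique continuation property with `φ₀ = 0`, the form given by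
injectivity of the observation. One direction is continuity up to time T, the other uniqueness for
the backward problem. -/
theorem ParabolicControl.IsAdjointSolution.eqOn_zero_iff (hΩ : IsOpen Ω) (hT : 0 < T)
    (hA : IsBddMatrix (volume.restrict (Ioo 0 T)) (volume.restrict Ω) M A) (hpn : p ≤ n)
    {φ₀ : L2Vec Ω p} {φ : ℝ → L2Vec Ω n} (hφ : IsAdjointSolution T Ω A (projAdj n φ₀) φ) :
    (∀ t ∈ Ioo 0 T, φ t = 0) ↔ φ₀ = 0 := by
  constructor
  · intro h
    have hc := ((isAdjointSolution_iff hA _ φ).1 hφ).2.continuousOn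
    have h1 : EqOn φ (fun _ => 0) (Icc 0 T) := eqOn_Icc_of_ae_eq_Ioo hT hc continuousOn_const
      ((ae_restrict_mem measurableSet_Ioo).mono h)
    have h2 := h1 (right_mem_Icc.2 hT.le)
    rw [hφ.1] at h2
    rw [← proj_projAdj hpn φ₀, h2]
    rfl
  · rintro rfl
    have h0 : projAdj n (0 : L2Vec Ω p) = 0 := by
      ext1 i
      simp only [projAdj, PiLp.zero_apply]
      split_ifs <;> rfl
    rw [h0] at hφ
    obtain ⟨ψ, -, hψ⟩ := exists_unique_isAdjointSolution hΩ hT hA (0 : L2Vec Ω n)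
    have hz : IsAdjointSolution T Ω A (0 : L2Vec Ω n) 0 :=
      (isAdjointSolution_iff hA _ _).2 ⟨rfl, evolSol_zero⟩
    intro t ht
    rw [hψ φ hφ (Ioo_subset_Icc_self ht), ← hψ 0 hz (Ioo_subset_Icc_self ht)]
    rfl

end uniqueContinuation

theorem proposition2p2 {N n m p : ℕ} (hN : 1 ≤ N) (hn : 1 ≤ n) (hm : 1 ≤ m) (hp : 1 ≤ p)
    (hpn : p ≤ n) (hmn : m ≤ n)
    (Ω ω : Set (EuclideanSpace ℝ (Fin N))) (hΩo : IsOpen Ω) (hΩc : IsConnected Ω)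
    (hΩb : Bornology.IsBounded Ω) (hΩr : HasC2Boundary Ω)
    (hωo : IsOpen ω) (hωn : ω.Nonempty) (hωΩ : ω ⊆ Ω)
    (T : ℝ) (hT : 0 < T)
    (A : ℝ × EuclideanSpace ℝ (Fin N) → Matrix (Fin n) (Fin n) ℝ)
    (hA : IsLInfty T Ω A)
    (B : ℝ × EuclideanSpace ℝ (Fin N) → Matrix (Fin n) (Fin m) ℝ)
    (hB : IsLInfty T Ω B) :
    -- both systems are well posed, so that one can speak of the solution
    (∀ (y₀ : L2Vec Ω n) (u : L2Cyl T Ω m),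
      ∃ y, IsSolution T Ω ω A B y₀ u y ∧
        ∀ z, IsSolution T Ω ω A B y₀ u z → EqOn z y (Icc 0 T)) ∧
    (∀ φT : L2Vec Ω n,
      ∃ φ, IsAdjointSolution T Ω A φT φ ∧
        ∀ ψ, IsAdjointSolution T Ω A φT ψ → EqOn ψ φ (Icc 0 T)) ∧
    -- null controllability and observability
    (NullControllable T Ω ω A B hpn ↔
      ∃ C : ℝ, 0 < C ∧ ∀ (φ₀ : L2Vec Ω p) (φ : ℝ → L2Vec Ω n),
        IsAdjointSolution T Ω A (projAdj n φ₀) φ →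
          ‖φ 0‖ ^ 2 ≤ C * ∫ t in Ioo 0 T, ∫ x in ω,
            ∑ k, (ctrlAdj B φ t x k) ^ 2) ∧
    -- approximate controllability and unique continuation
    (ApproxControllable T Ω ω A B hpn ↔
      ∀ (φ₀ : L2Vec Ω p) (φ : ℝ → L2Vec Ω n),
        IsAdjointSolution T Ω A (projAdj n φ₀) φ →
          (∀ᵐ t ∂volume.restrict (Ioo 0 T), ∀ᵐ x ∂volume.restrict ω,
            ctrlAdj B φ t x = 0) →
          ∀ t ∈ Ioo 0 T, φ t = 0) := by
  obtain ⟨M, hA⟩ := exists_isBddMatrix_of_isLInfty hA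
  have hω := hωo.measurableSet
  obtain ⟨M', hB⟩ := exists_isBddMatrix_of_isLInfty (isLInfty_ctrlMatrix hω hB)
  refine ⟨exists_unique_isSolution hΩo hT hω hωΩ hA hB,
    exists_unique_isAdjointSolution hΩo hT hA, ?_, ?_⟩
  all_goals
    obtain ⟨R, S, K, hdual, hR, hR', hSK⟩ := exists_dual_pair hΩo hT hω hωΩ hA hB hpn
    have hsol : ∀ φ₀ : L2Vec Ω p, ∃ φ, IsAdjointSolution T Ω A (projAdj n φ₀) φ := fun φ₀ =>
      (exists_unique_isAdjointSolution hΩo hT hA (projAdj n φ₀)).imp fun _ h => h.1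
  · have h1 : NullControllable T Ω ω A B hpn ↔ ∀ y, ∃ U, R y U = 0 := by
      refine forall_congr' fun y => ⟨?_, ?_⟩
      · rintro ⟨u, y', hy, h0⟩
        obtain ⟨U, hU⟩ := hR' y u y' hy
        exact ⟨U, hU.trans h0⟩
      · rintro ⟨U, hU⟩
        obtain ⟨u, y', hy, h0⟩ := hR y U
        exact ⟨u, y', hy, h0.symm.trans hU⟩
    have hK : ∀ φ₀ φ, IsAdjointSolution T Ω A (projAdj n φ₀) φ → ‖K φ₀‖ ^ 2
        = ∫ t in Ioo 0 T, ∫ x in ω, ∑ k, (ctrlAdj B φ t x k) ^ 2 := fun φ₀ φ hφ => by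
      have hm := memLp_observation hA hB hφ
      have h2 : K φ₀ = hm.toLp _ := Lp.ext ((hSK φ₀ φ hφ).2.trans hm.coeFn_toLp.symm)
      rw [h2, norm_toLp_sq]
      exact integral_congr_ae (norm_sq_observation hω hωΩ hB φ)
    rw [h1, forall_exists_eq_zero_iff_observability hdual]
    refine exists_congr fun C => and_congr_right fun _ => ⟨fun h φ₀ φ hφ => ?_, fun h φ₀ => ?_⟩
    · rw [← hK φ₀ φ hφ, ← (hSK φ₀ φ hφ).1]
      exact h φ₀
    · obtain ⟨φ, hφ⟩ := hsol φ₀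
      rw [hK φ₀ φ hφ, (hSK φ₀ φ hφ).1]
      exact h φ₀ φ hφ
  · have h1 : ApproxControllable T Ω ω A B hpn ↔
        ∀ ε : ℝ, 0 < ε → ∀ y z, ∃ U, ‖R y U - z‖ ≤ ε := by
      refine forall_congr' fun ε => forall_congr' fun _ => forall_congr' fun y =>
        ⟨fun h z => ?_, fun h yT => ?_⟩
      -- Every target in L²(Ω)ᵖ is the projection of its extension by zero components.
      · obtain ⟨u, y', hy, h0⟩ := h (projAdj n z)
        obtain ⟨U, hU⟩ := hR' y u y' hy
        rw [proj_projAdj, ← hU] at h0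
        exact ⟨U, h0⟩
      · obtain ⟨U, hU⟩ := h (proj hpn yT)
        obtain ⟨u, y', hy, h0⟩ := hR y U
        rw [h0] at hU
        exact ⟨u, y', hy, hU⟩
    have hK : ∀ φ₀ φ, IsAdjointSolution T Ω A (projAdj n φ₀) φ → (K φ₀ = 0 ↔
        ∀ᵐ t ∂volume.restrict (Ioo 0 T), ∀ᵐ x ∂volume.restrict ω, ctrlAdj B φ t x = 0) :=
      fun φ₀ φ hφ => by
        rw [← observation_eq_zero_iff hω hωΩ hB φ, Lp.eq_zero_iff_ae_eq_zero]
        have h2 := (hSK φ₀ φ hφ).2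
        exact ⟨fun h => h2.symm.trans h, fun h => h2.trans h⟩
    rw [h1, forall_exists_norm_sub_le_iff_injective hdual]
    refine forall_congr' fun φ₀ => ⟨fun h φ hφ h0 => ?_, fun h h0 => ?_⟩
    · exact (hφ.eqOn_zero_iff hΩo hT hA hpn).2 (h ((hK φ₀ φ hφ).2 h0))
    · obtain ⟨φ, hφ⟩ := hsol φ₀
      exact (hφ.eqOn_zero_iff hΩo hT hA hpn).1 (h φ hφ ((hK φ₀ φ hφ).1 h0))
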